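/- **Setting.** Let $\chi\in C^\infty(\mathbb R)$ satisfy $\chi(s)=1$ for $|s|\le 1$, $\chi(s)=0$ for $|s|\ge 2$ and $s\chi'(s)\le 0$ for all $s$. For $m\ge 0$ put $f_m(s)=s(e^{s^2}-1)-m\chi(s)s$. A *singular disk solution* is a function $u_\infty:(0,R_\infty]\to\mathbb R$, $R_\infty>0$, that is positive on $(0,R_\infty)$, continuous up to $R_\infty$ with $u_\infty(R_\infty)=0$, solves $-u''-u'/r=u(e^{u^2}-1)$ on $(0,R_\infty)$, and satisfies $$u_\infty(r)=\bigl(-2\log r-2\log(-\log r)-2\log 2\bigr)^{1/2}+O\bigl((-\log r)^{-3/2}\log(-\log r)\bigr)\quad(r\to 0).$$ Given such a $u_\infty$, let $R\in(0,R_\infty)$ be the radius with $u_\infty(R)=2$, and for $m\ge0$ let $\phi_m$ be equal to $u_\infty$ on $(0,R]$ and be continued to $(R,\infty)$ as the solution of $-\phi''-\phi'/r=f_m(\phi)$ with $\phi(R)=u_\infty(R)$, $\phi'(R)=u_\infty'(R)$. Let $m_*=\inf\{m>0:\ \phi_m>0 \text{ on }(R,\infty)\}$. The radial function $\varphi_*(x)=\phi_{m_*}(|x|)$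 on $\mathbb R^2$ is called a *singular soliton*. Let $(e^{t\Delta}g)(x)=\frac1{4\pi t}\int_{\mathbb R^2}e^{-|x-y|^2/(4t)}g(y)\,dy$ for $t>0$, $e^{0\Delta}g=g$, and let $X=\bigcap_{1\le p<\infty}L^p(\mathbb R^2)$. A *strong solution on $[0,T)$* of $$\partial_t u-\Delta u=f_{m_*}(u),\qquad u|_{t=0}=\varphi_*,\tag{1}$$ is a function $u\in C([0,T);X)$ with $u(0)=\varphi_*$ and $u(t)=e^{t\Delta}\varphi_*+\int_0^te^{(t-s)\Delta}f_{m_*}(u(s))\,ds$ for $0<t<T$, almost everywhere in $\mathbb R^2$, the last integral being absolutely convergent. **Theorem 3.1.** For every $\chi$ as above a singular soliton exists. Let $\varphi_*$ be a singular soliton, with mass $m_*$, and let $u_0(t)=e^{t\Delta}\varphi_*$. Then for every $t>0$ the integral defining $u_0(t)$ converges absolutely at every point and $u_0(t)$ is bounded on $\mathbb R^2$. Moreover, there are $T\in(0,1)$ and a strong solution $u_R$ of (1) on $[0,T)$ such that $$u_R-u_0\in|\log t|^{-1/2}L^\infty([0,T)\times\mathbb R^2).$$ In addition, $u_R$ can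 be chosen so that $u_R-u_0$ lies in the ball $$B_T=\Bigl\{v\in C([0,T)\times\mathbb R^2):\ \sup_{0<t<T}|\log t|^{1/2}\|v(t)\|_{L^\infty}\le 1\Bigr\},$$ and $u_R$ is then the only strong solution $w$ of (1) on $[0,T)$ with $w-u_0\in B_T$. -/

import Mathlib

open Set Filter Topology MeasureTheory
open scoped ENNReal ContDiff

noncomputable section

namespace HeatExp

/-- The Euclidean plane. -/
abbrev Plane : Type := EuclideanSpace ℝ (Fin 2)

/-- Admissible cut-off functions `χ`. -/
structure IsCutoff (χ : ℝ → ℝ) : Prop where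
  smooth : ContDiff ℝ ∞ χ
  eq_one : ∀ s, |s| ≤ 1 → χ s = 1
  eq_zero : ∀ s, 2 ≤ |s| → χ s = 0
  mul_deriv_nonpos : ∀ s, s * deriv χ s ≤ 0

/-- The nonlinearity `f_m(s) = s (e^{s²} - 1) - m χ(s) s`. -/
def nonlin (χ : ℝ → ℝ) (m s : ℝ) : ℝ :=
  s * (Real.exp (s ^ 2) - 1) - m * χ s * s

/-- `u` is a classical (twice differentiable) solution of the radial equation
`-u'' - u'/r = f(u)` at every point of the open set `I` of radii. -/
def SolvesRadial (f : ℝ → ℝ) (I : Set ℝ) (u : ℝ → ℝ) : Prop :=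
  ∀ r ∈ I, DifferentiableAt ℝ u r ∧
    HasDerivAt (deriv u) (-(deriv u r / r) - f (u r)) r

/-- `u` is the radial profile of the positive singular solution of `-Δu = u (e^{u²} - 1)` in the
disk of radius `ρ`, with zero boundary values and with the prescribed singularity
`u(r) = (-2 log r - 2 log(-log r) - 2 log 2)^{1/2} + O((-log r)^{-3/2} log(-log r))` at `0`. -/
structure IsSingularDiskSolution (ρ : ℝ) (u : ℝ → ℝ) : Prop where
  radius_pos : 0 < ρ
  ode : SolvesRadial (fun s => s * (Real.exp (s ^ 2) - 1)) (Ioo 0 ρ) u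
  pos : ∀ r ∈ Ioo 0 ρ, 0 < u r
  continuousOn : ContinuousOn u (Ioc 0 ρ)
  boundary : u ρ = 0
  singular :
    (fun r => u r - Real.sqrt (-2 * Real.log r - 2 * Real.log (-Real.log r) - 2 * Real.log 2))
      =O[𝓝[>] 0] fun r => (-Real.log r) ^ (-(3 / 2) : ℝ) * Real.log (-Real.log r)

/-- `ψ` is the solution `φ_m` with mass `m`: it equals `u` on `(0, R]` and is continued beyond `R`
by the Cauchy problem `-ψ'' - ψ'/r = f_m(ψ)`, `ψ(R) = u(R)`, `ψ'(R) = u'(R)`.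
When `u ≥ 2` on `(0, R]`, the cut-off vanishes there, so that gluing at `R` with matching value
and derivative is the same as solving the equation with `f_m` on all of `(0, ∞)`. -/
structure IsShot (χ : ℝ → ℝ) (u : ℝ → ℝ) (R m : ℝ) (ψ : ℝ → ℝ) : Prop where
  eq_inner : ∀ r ∈ Ioc 0 R, ψ r = u r
  ode : SolvesRadial (nonlin χ m) (Ioi 0) ψ

/-- The masses `m > 0` for which the solution `φ_m` stays positive on `(R, ∞)`. -/
def positiveMasses (χ : ℝ → ℝ) (u : ℝ → ℝ) (R : ℝ) : Set ℝ :=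
  {m | 0 < m ∧ ∃ ψ, IsShot χ u R m ψ ∧ ∀ r, R < r → 0 < ψ r}

/-- `m` is the critical mass `m_*` and `φ` is the radial profile of the singular soliton
`φ_* = φ_{m_*}`, obtained by shooting from the singular disk solution `u`, starting at the radius
`R` at which `u` takes the value `2`. -/
def IsSingularSoliton (χ : ℝ → ℝ) (m : ℝ) (φ : ℝ → ℝ) : Prop :=
  ∃ ρ u R, IsSingularDiskSolution ρ u ∧ R ∈ Ioo 0 ρ ∧ u R = 2 ∧
    IsGLB (positiveMasses χ u R) m ∧ IsShot χ u R m φ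

/-- The radial function on the plane with a given profile (its value at the origin is
irrelevant). -/
def radial (φ : ℝ → ℝ) (x : Plane) : ℝ := φ ‖x‖

/-- The heat kernel of the plane. -/
def heatKernel (t : ℝ) (x : Plane) : ℝ :=
  (4 * Real.pi * t)⁻¹ * Real.exp (-‖x‖ ^ 2 / (4 * t))

/-- The heat semigroup `e^{tΔ}`, for `t ≥ 0`. -/
def heat (t : ℝ) (g : Plane → ℝ) (x : Plane) : ℝ :=
  if t = 0 then g x else ∫ y, heatKernel t (x - y) * g y

/-- `u ∈ C([0, T), X)`, where `X` is the Fréchet space `⋂_{1 ≤ p < ∞} L^p(ℝ²)`. -/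
def IsContinuousCurve (T : ℝ) (u : ℝ → Plane → ℝ) : Prop :=
  ∀ p : ℝ≥0∞, 1 ≤ p → p ≠ ⊤ → ∀ t ∈ Ico 0 T,
    MemLp (u t) p volume ∧
      Tendsto (fun s => eLpNorm (u s - u t) p volume) (𝓝[Ico 0 T] t) (𝓝 0)

/-- `u` is a strong solution on `[0, T)` of `∂ₜu - Δu = f(u)`, `u(0) = g`, in the sense of the
Duhamel formula `u(t) = e^{tΔ} g + ∫₀ᵗ e^{(t-s)Δ} f(u(s)) ds` in `C([0, T), X)`; the absolute
convergence of the Duhamel integral is part of the definition. -/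
structure IsStrongSolution (f : ℝ → ℝ) (T : ℝ) (g : Plane → ℝ) (u : ℝ → Plane → ℝ) : Prop where
  continuousCurve : IsContinuousCurve T u
  initial : u 0 =ᵐ[volume] g
  duhamel_integrable : ∀ t ∈ Ioo 0 T, ∀ᵐ x : Plane,
    IntegrableOn (fun q : ℝ × Plane => heatKernel (t - q.1) (x - q.2) * f (u q.1 q.2))
      (Ioo 0 t ×ˢ univ) volume
  duhamel : ∀ t ∈ Ioo 0 T, ∀ᵐ x : Plane,
    u t x = heat t g x + ∫ s in (0 : ℝ)..t, heat (t - s) (fun y => f (u s y)) x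

/-- `v ∈ |log t|^{-1/2} L^∞([0, T) × ℝ²)`. -/
def InLogWeightedLinfty (T : ℝ) (v : ℝ → Plane → ℝ) : Prop :=
  MemLp (fun q : ℝ × Plane => |Real.log q.1| ^ (1 / 2 : ℝ) * v q.1 q.2) ⊤
    (volume.restrict (Ico 0 T ×ˢ univ))

/-- The closed unit ball of continuous `v` for the norm `sup_{0<t<T} |log t|^{1/2} ‖v(t)‖_∞`. -/
def InLogWeightedBall (T : ℝ) (v : ℝ → Plane → ℝ) : Prop :=
  ContinuousOn (fun q : ℝ × Plane => v q.1 q.2) (Ico 0 T ×ˢ univ) ∧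
    ∀ t ∈ Ioo 0 T, ∀ x, |Real.log t| ^ (1 / 2 : ℝ) * |v t x| ≤ 1

end HeatExp

end

/-!
# Singular solitons and the strong solution of the exponential heat equation issuing from them

**The singular disk solution.** With `s = -log r` the radial equation becomes
`y'' = -e^{-2s} y (e^{y²} - 1)`. An explicit approximate solution `Y`, with
`Y² = 2s - 2ℓ + (2ℓ - 4)/s` and `ℓ = log (2s)`, has a residual of size `o(s^{-3})`
(`abs_approx_residual_le`), and the linearization around it is
`z'' + (1/s + 3/(16 s²)) z`, up to a coefficient of size `o(s^{-3/2})`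
(`abs_linear_perturbation_le`). The homogeneous equation is solved exactly by
`s^{1/4} cos(2√s)` and `s^{1/4} sin(2√s)`, so variation of constants from infinity inverts the
linear part and gains a factor `s^{3/2}`; the contraction principle then corrects `Y` by
`O(s^{-3/2})` (`exists_decaying_solution`, `exists_emden_solution`). For the equation without mass
`r u'` is negative and decreasing, so the continued solution reaches zero at a finite radius
(`exists_isSingularDiskSolution`).

**The critical mass.** The energy `φ'²/2 + F_m(φ)` is nonincreasing and `F_m` is coercive, so every
shot is global (`exists_global_extension`). For large `m` the energy at `R` is negative, which
prevents zeros, so the critical mass `m_*` exists. Continuous dependence on `m` shows that the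
critical shot is positive (`critical_pos`), that `m_* > 0` (`critical_mass_pos`) and that the
energy never becomes negative (`critical_energy_nonneg`). Hence the critical shot decreases to zero
and, as `f_m(s) ≈ -m s` near `0`, decays exponentially. The outcome is `IsSingularProfile`: besides
the decay, `e^{φ²/2} = O(1 / (r |log r|))` at the origin.

**The heat equation.** Write `U(t) = e^{tΔ} φ_*`, `P(t) = e^{tΔ} e^{φ_*²/2}` and
`G(t) = e^{tΔ} (φ_* e^{φ_*²/2})`. Jensen's inequality gives `e^{U²/2} ≤ P` and `U e^{U²/2} ≤ G`, and
the singularity of `φ_*` gives `P ≤ C t^{-1/2} |log t|^{-1}` (`exists_heat_exp_le`), hence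
`U² ≤ C |log t|`. For `|v| ≤ |log t|^{-1/2}` it follows that `e^{(U+v)²} ≤ C P²`, so that
`|f(U + v)| ≤ C t^{-1/2} |log t|^{-1/2} P(t)`: one factor `P` is spent on the integrable time
weight, and the other one is propagated without loss by the semigroup, `e^{(t-s)Δ} P(s) = P(t)`
(`IsDominatedSource.abs_duhamelIntegral_le`). The Duhamel integral is therefore at most
`C t^{1/2} |log t|^{-1/2} P(t) ≤ C |log t|^{-3/2}`. Since `|f'(s)| ≤ C (1 + s²) e^{s²}`, differences
obey the same bound times their weighted distance, and for small `T` the Duhamel map is a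
contraction of the ball (`exists_duhamel_fixedPoint`); this yields existence and uniqueness.

The ball only controls the sup norm. Integrability comes from the bound `|v(t)| ≤ t^{1/2} G(t)`,
which the Duhamel map also preserves, and which makes the perturbation small in `L¹`, thus in every
`L^p` (`isContinuousCurve_perturbedFlow`).
-/


open Set Filter Topology MeasureTheory
open scoped ENNReal ContDiff

noncomputable section

namespace HeatExp

/-! ### The cut-off and the nonlinearity -/

namespace IsCutoff

variable {χ : ℝ → ℝ}

lemma differentiable (hχ : IsCutoff χ) : Differentiable ℝ χ :=
  hχ.smooth.differentiable (by simp)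

lemma continuous (hχ : IsCutoff χ) : Continuous χ := hχ.smooth.continuous

lemma antitoneOn (hχ : IsCutoff χ) : AntitoneOn χ (Ici 0) := by
  refine antitoneOn_of_deriv_nonpos (convex_Ici 0) hχ.continuous.continuousOn
    hχ.differentiable.differentiableOn ?_
  intro s hs
  rw [interior_Ici, mem_Ioi] at hs
  by_contra! h
  exact absurd (hχ.mul_deriv_nonpos s) (not_le.2 (mul_pos hs h))

lemma monotoneOn (hχ : IsCutoff χ) : MonotoneOn χ (Iic 0) := by
  refine monotoneOn_of_deriv_nonneg (convex_Iic 0) hχ.continuous.continuousOn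
    hχ.differentiable.differentiableOn ?_
  intro s hs
  rw [interior_Iic, mem_Iio] at hs
  by_contra! h
  exact absurd (hχ.mul_deriv_nonpos s) (not_le.2 (mul_pos_of_neg_of_neg hs h))

lemma le_one (hχ : IsCutoff χ) (s : ℝ) : χ s ≤ 1 := by
  have h0 : χ 0 = 1 := hχ.eq_one 0 (by simp)
  rcases le_total 0 s with h | h
  · exact h0 ▸ hχ.antitoneOn self_mem_Ici h h
  · exact h0 ▸ hχ.monotoneOn h self_mem_Iic h

lemma nonneg (hχ : IsCutoff χ) (s : ℝ) : 0 ≤ χ s := by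
  rcases le_or_gt 2 |s| with h2 | h2
  · exact (hχ.eq_zero s h2).ge
  have h2' := abs_lt.1 h2
  rcases le_total 0 s with h | h
  · have := hχ.antitoneOn h (show (0:ℝ) ≤ 2 by norm_num) h2'.2.le
    rwa [hχ.eq_zero 2 (by norm_num)] at this
  · have := hχ.monotoneOn (show (-2:ℝ) ≤ 0 by norm_num) h h2'.1.le
    rwa [hχ.eq_zero (-2) (by norm_num)] at this

lemma exists_lipschitz (hχ : IsCutoff χ) :
    ∃ K : ℝ, 0 ≤ K ∧ ∀ a b, |χ a * a - χ b * b| ≤ K * |a - b| := by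
  have hs : HasCompactSupport (fun s => χ s * s) := by
    refine HasCompactSupport.of_support_subset_isCompact (isCompact_Icc (a := (-2:ℝ)) (b := 2)) ?_
    intro s hs
    by_contra h
    apply hs
    have : 2 ≤ |s| := by
      by_contra! h'
      exact h ⟨(abs_lt.1 h').1.le, (abs_lt.1 h').2.le⟩
    simp [hχ.eq_zero s this]
  obtain ⟨K, hK⟩ := (hχ.smooth.mul contDiff_id).lipschitzWith_of_hasCompactSupport hs (by simp)
  refine ⟨K, K.2, fun a b => ?_⟩
  simpa [Real.dist_eq] using hK.dist_le_mul a b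

end IsCutoff

/-- The factor `κ` in `f_m(s) = s κ(s)`. -/
def growthFactor (χ : ℝ → ℝ) (m s : ℝ) : ℝ := Real.exp (s ^ 2) - 1 - m * χ s

lemma nonlin_eq (χ : ℝ → ℝ) (m s : ℝ) : nonlin χ m s = s * growthFactor χ m s := by
  simp only [nonlin, growthFactor]; ring

lemma nonlin_zero_mass (χ : ℝ → ℝ) :
    nonlin χ 0 = fun s => s * (Real.exp (s ^ 2) - 1) := by
  funext s; simp [nonlin]

lemma nonlin_of_two_le {χ : ℝ → ℝ} (hχ : IsCutoff χ) (m : ℝ) {s : ℝ} (hs : 2 ≤ s) :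
    nonlin χ m s = s * (Real.exp (s ^ 2) - 1) := by
  simp [nonlin, hχ.eq_zero s (hs.trans (le_abs_self s))]

lemma contDiff_nonlin {χ : ℝ → ℝ} (hχ : IsCutoff χ) (m : ℝ) : ContDiff ℝ 1 (nonlin χ m) := by
  have h : ContDiff ℝ 1 χ := hχ.smooth.of_le (by exact_mod_cast le_top)
  unfold nonlin
  fun_prop

lemma continuous_nonlin {χ : ℝ → ℝ} (hχ : IsCutoff χ) (m : ℝ) : Continuous (nonlin χ m) :=
  (contDiff_nonlin hχ m).continuous

lemma growthFactor_strictMonoOn {χ : ℝ → ℝ} (hχ : IsCutoff χ) {m : ℝ} (hm : 0 ≤ m) :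
    StrictMonoOn (growthFactor χ m) (Ici 0) := by
  intro a ha b hb hab
  have h1 : Real.exp (a ^ 2) < Real.exp (b ^ 2) :=
    Real.exp_lt_exp.2 (by
      have ha' : (0:ℝ) ≤ a := ha
      nlinarith)
  have h2 := mul_le_mul_of_nonneg_left (hχ.antitoneOn ha hb hab.le) hm
  simp only [growthFactor]
  linarith

/-- The primitive `∫₀ˢ τ χ(τ) dτ` of the mass term. -/
def massPotential (χ : ℝ → ℝ) (s : ℝ) : ℝ := ∫ τ in (0 : ℝ)..s, χ τ * τ

/-- The primitive of the nonlinearity `f_m` vanishing at `0`. -/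
def potential (χ : ℝ → ℝ) (m s : ℝ) : ℝ :=
  (Real.exp (s ^ 2) - 1 - s ^ 2) / 2 - m * massPotential χ s

section Potential

variable {χ : ℝ → ℝ}

lemma hasDerivAt_massPotential (hχ : IsCutoff χ) (s : ℝ) :
    HasDerivAt (massPotential χ) (χ s * s) s := by
  have hc : Continuous fun τ => χ τ * τ := hχ.continuous.mul continuous_id
  exact intervalIntegral.integral_hasDerivAt_right (hc.intervalIntegrable _ _)
    hc.aestronglyMeasurable.stronglyMeasurableAtFilter hc.continuousAt

lemma hasDerivAt_potential (hχ : IsCutoff χ) (m s : ℝ) :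
    HasDerivAt (potential χ m) (nonlin χ m s) s := by
  have h1 : HasDerivAt (fun s : ℝ => (Real.exp (s ^ 2) - 1 - s ^ 2) / 2)
      ((Real.exp (s ^ 2) * (2 * s) - 2 * s) / 2) s := by
    have := (hasDerivAt_pow 2 s)
    simpa using (((this.exp).sub_const 1).sub this).div_const 2
  have h2 := h1.sub ((hasDerivAt_massPotential hχ s).const_mul m)
  refine h2.congr_deriv ?_
  simp only [nonlin]; ring

@[simp] lemma potential_zero (m : ℝ) : potential χ m 0 = 0 := by
  simp [potential, massPotential]

lemma continuous_potential (hχ : IsCutoff χ) (m : ℝ) : Continuous (potential χ m) :=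
  continuous_iff_continuousAt.2 fun s => (hasDerivAt_potential hχ m s).continuousAt

lemma massPotential_nonneg (hχ : IsCutoff χ) (s : ℝ) : 0 ≤ massPotential χ s := by
  rcases le_total 0 s with h | h
  · exact intervalIntegral.integral_nonneg h fun τ hτ => mul_nonneg (hχ.nonneg τ) hτ.1
  · rw [massPotential, intervalIntegral.integral_symm, ← intervalIntegral.integral_neg]
    refine intervalIntegral.integral_nonneg h fun τ hτ => ?_
    have := mul_nonpos_of_nonneg_of_nonpos (hχ.nonneg τ) hτ.2
    linarith

lemma massPotential_le (hχ : IsCutoff χ) (s : ℝ) : massPotential χ s ≤ s ^ 2 / 2 := by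
  have hc : Continuous fun τ => χ τ * τ := hχ.continuous.mul continuous_id
  have hs : s ^ 2 / 2 = ∫ τ in (0:ℝ)..s, τ := by simp [integral_id]
  rw [hs, massPotential]
  rcases le_total 0 s with h | h
  · refine intervalIntegral.integral_mono_on h (hc.intervalIntegrable _ _)
      (continuous_id.intervalIntegrable _ _) fun τ hτ => ?_
    exact mul_le_of_le_one_left hτ.1 (hχ.le_one τ)
  · rw [intervalIntegral.integral_symm s 0, intervalIntegral.integral_symm s 0]
    refine neg_le_neg (intervalIntegral.integral_mono_on h
      (intervalIntegral.intervalIntegrable_id (μ := volume)) (hc.intervalIntegrable (μ := volume) _ _) fun τ hτ => ?_)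
    have := mul_nonneg (sub_nonneg.2 (hχ.le_one τ)) (neg_nonneg.2 hτ.2)
    linarith

lemma half_le_massPotential_two (hχ : IsCutoff χ) : 1 / 2 ≤ massPotential χ 2 := by
  have hc : Continuous fun τ => χ τ * τ := hχ.continuous.mul continuous_id
  have h1 : (∫ τ in (0:ℝ)..1, χ τ * τ) = 1 / 2 := by
    have : (∫ τ in (0:ℝ)..1, χ τ * τ) = ∫ τ in (0:ℝ)..1, τ := by
      refine intervalIntegral.integral_congr fun τ hτ => ?_
      rw [uIcc_of_le zero_le_one] at hτ
      simp [hχ.eq_one τ (abs_le.2 ⟨by linarith [hτ.1], hτ.2⟩)]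
    rw [this, integral_id]; norm_num
  have h2 : 0 ≤ ∫ τ in (1:ℝ)..2, χ τ * τ :=
    intervalIntegral.integral_nonneg (by norm_num) fun τ hτ =>
      mul_nonneg (hχ.nonneg τ) (by linarith [hτ.1])
  have h3 := intervalIntegral.integral_add_adjacent_intervals
    (hc.intervalIntegrable (μ := volume) 0 1) (hc.intervalIntegrable (μ := volume) 1 2)
  rw [massPotential, ← h3, h1]
  linarith

lemma le_potential (hχ : IsCutoff χ) {m : ℝ} (hm : 0 ≤ m) (s : ℝ) :
    s ^ 4 / 4 - m * (s ^ 2 / 2) ≤ potential χ m s := by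
  have h1 := Real.quadratic_le_exp_of_nonneg (sq_nonneg s)
  have h2 := mul_le_mul_of_nonneg_left (massPotential_le hχ s) hm
  simp only [potential]
  nlinarith

/-- Where the potential is nonnegative, the nonlinearity is positive: `κ` is increasing, so `f_m`
can only change sign from negative to positive. -/
lemma growthFactor_pos_of_potential_nonneg (hχ : IsCutoff χ) {m s : ℝ} (hm : 0 ≤ m) (hs : 0 < s)
    (h : 0 ≤ potential χ m s) : 0 < growthFactor χ m s := by
  by_contra! hκ
  have hanti : StrictAntiOn (potential χ m) (Icc 0 s) := by
    refine strictAntiOn_of_deriv_neg (convex_Icc 0 s)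
      (continuous_potential hχ m).continuousOn fun x hx => ?_
    rw [interior_Icc] at hx
    rw [(hasDerivAt_potential hχ m x).deriv, nonlin_eq]
    exact mul_neg_of_pos_of_neg hx.1
      ((growthFactor_strictMonoOn hχ hm hx.1.le hs.le hx.2).trans_le hκ)
  have := hanti (left_mem_Icc.2 hs.le) (right_mem_Icc.2 hs.le) hs
  rw [potential_zero] at this
  linarith

/-- Coercivity of the potential, uniformly for bounded masses. -/
lemma sq_le_of_potential_le (hχ : IsCutoff χ) {m E s : ℝ} (hm : 0 ≤ m)
    (h : potential χ m s ≤ E) : s ^ 2 ≤ 1 + 2 * m + 4 * |E| := by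
  have h1 := (le_potential hχ hm s).trans h
  by_contra! h2
  have h3 := le_abs_self E
  have h4 := abs_nonneg E
  nlinarith [mul_pos (sub_pos.2 h2) (show 0 < s ^ 2 by linarith), mul_nonneg hm h4]

end Potential

section Bounds

variable {χ : ℝ → ℝ}

lemma abs_nonlin_le (hχ : IsCutoff χ) {m : ℝ} (hm : 0 ≤ m) (s : ℝ) :
    |nonlin χ m s| ≤ (1 + m) * |s| * Real.exp (s ^ 2) := by
  rw [nonlin_eq, abs_mul]
  have h1 : 1 ≤ Real.exp (s ^ 2) := Real.one_le_exp (sq_nonneg s)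
  have h2 := hχ.nonneg s
  have h3 := hχ.le_one s
  have h4 : |growthFactor χ m s| ≤ (1 + m) * Real.exp (s ^ 2) := by
    rw [growthFactor, abs_le]
    constructor <;> nlinarith [mul_nonneg hm h2, mul_nonneg hm (sub_nonneg.2 h3)]
  calc |s| * |growthFactor χ m s| ≤ |s| * ((1 + m) * Real.exp (s ^ 2)) := by gcongr
    _ = _ := by ring

/-- The nonlinearity is locally Lipschitz with a constant of the size of its derivative. -/
lemma exists_abs_nonlin_sub_le (hχ : IsCutoff χ) {m : ℝ} (hm : 0 ≤ m) :
    ∃ C : ℝ, 0 ≤ C ∧ ∀ M a b : ℝ, |a| ≤ M → |b| ≤ M →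
      |nonlin χ m a - nonlin χ m b| ≤ C * ((1 + M ^ 2) * Real.exp (M ^ 2)) * |a - b| := by
  obtain ⟨K, hK, hL⟩ := hχ.exists_lipschitz
  refine ⟨2 + m * K, by positivity, fun M a b ha hb => ?_⟩
  have hE : 1 ≤ (1 + M ^ 2) * Real.exp (M ^ 2) := by
    nlinarith [Real.one_le_exp (sq_nonneg M), sq_nonneg M]
  have h1 : |a * (Real.exp (a ^ 2) - 1) - b * (Real.exp (b ^ 2) - 1)|
      ≤ 2 * ((1 + M ^ 2) * Real.exp (M ^ 2)) * |a - b| := by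
    have key := (convex_Icc (-M) M).norm_image_sub_le_of_norm_hasDerivWithin_le
      (f := fun s : ℝ => s * (Real.exp (s ^ 2) - 1))
      (f' := fun s : ℝ => 1 * (Real.exp (s ^ 2) - 1) + s * (Real.exp (s ^ 2) * (2 * s)))
      (C := 2 * ((1 + M ^ 2) * Real.exp (M ^ 2))) (x := b) (y := a) ?_ ?_
      (abs_le.1 hb) (abs_le.1 ha)
    · simpa [Real.norm_eq_abs] using key
    · intro x _
      have := (hasDerivAt_pow 2 x)
      have h := (hasDerivAt_id x).mul ((this.exp).sub_const 1)
      simp only [id] at h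
      refine (HasDerivAt.congr_deriv h ?_).hasDerivWithinAt
      norm_num
    · intro x hx
      have hx2 : x ^ 2 ≤ M ^ 2 := sq_le_sq' hx.1 hx.2
      have he : Real.exp (x ^ 2) ≤ Real.exp (M ^ 2) := Real.exp_le_exp.2 hx2
      have he1 : 1 ≤ Real.exp (x ^ 2) := Real.one_le_exp (sq_nonneg x)
      rw [Real.norm_eq_abs, abs_of_nonneg (by nlinarith [sq_nonneg x])]
      nlinarith [sq_nonneg x, mul_le_mul hx2 he (by positivity) (sq_nonneg M)]
  have h2 : nonlin χ m a - nonlin χ m b = (a * (Real.exp (a ^ 2) - 1) - b * (Real.exp (b ^ 2) - 1))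
      - m * (χ a * a - χ b * b) := by simp only [nonlin]; ring
  rw [h2]
  calc _ ≤ |a * (Real.exp (a ^ 2) - 1) - b * (Real.exp (b ^ 2) - 1)|
        + |m * (χ a * a - χ b * b)| := abs_sub _ _
    _ ≤ 2 * ((1 + M ^ 2) * Real.exp (M ^ 2)) * |a - b| + m * (K * |a - b|) := by
        rw [abs_mul, abs_of_nonneg hm]
        gcongr
        exact hL a b
    _ ≤ 2 * ((1 + M ^ 2) * Real.exp (M ^ 2)) * |a - b|
        + m * K * ((1 + M ^ 2) * Real.exp (M ^ 2)) * |a - b| := by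
        have := mul_le_mul_of_nonneg_right hE (show 0 ≤ m * K * |a - b| by positivity)
        linarith
    _ = _ := by ring

end Bounds

/-! ### The radial equation as a Cauchy problem -/

/-- Lipschitz continuity on bounded intervals. -/
def IsLocLipschitz (f : ℝ → ℝ) : Prop :=
  ∀ M : ℝ, ∃ K : NNReal, LipschitzOnWith K f (Icc (-M) M)

lemma isLocLipschitz_nonlin {χ : ℝ → ℝ} (hχ : IsCutoff χ) {m : ℝ} (hm : 0 ≤ m) :
    IsLocLipschitz (nonlin χ m) := by
  intro M
  obtain ⟨C, hC, h⟩ := exists_abs_nonlin_sub_le hχ hm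
  refine ⟨Real.toNNReal (C * ((1 + M ^ 2) * Real.exp (M ^ 2))), ?_⟩
  exact LipschitzOnWith.of_dist_le_mul fun a ha b hb => by
    rw [Real.coe_toNNReal _ (by positivity), Real.dist_eq, Real.dist_eq]
    exact h M a b (abs_le.2 ha) (abs_le.2 hb)

/-- Truncation to the interval `[-M, M]`. -/
def clamp (M s : ℝ) : ℝ := max (-M) (min s M)

lemma clamp_mem {M : ℝ} (hM : 0 ≤ M) (s : ℝ) : clamp M s ∈ Icc (-M) M :=
  ⟨le_max_left _ _, max_le (by linarith) (min_le_right _ _)⟩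

lemma abs_clamp_le {M : ℝ} (hM : 0 ≤ M) (s : ℝ) : |clamp M s| ≤ M := abs_le.2 (clamp_mem hM s)

lemma clamp_of_mem {M s : ℝ} (hs : s ∈ Icc (-M) M) : clamp M s = s := by
  simp [clamp, hs.1, hs.2]

lemma lipschitzWith_clamp (M : ℝ) : LipschitzWith 1 (clamp M) :=
  (LipschitzWith.id.min_const M).const_max (-M)

lemma continuous_clamp (M : ℝ) : Continuous (clamp M) := (lipschitzWith_clamp M).continuous

lemma abs_clamp_sub_le (M a b : ℝ) : |clamp M a - clamp M b| ≤ |a - b| := by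
  simpa [Real.dist_eq] using (lipschitzWith_clamp M).dist_le_mul a b

namespace SolvesRadial

variable {f : ℝ → ℝ} {I J : Set ℝ} {u v : ℝ → ℝ}

lemma mono (h : SolvesRadial f I u) (hJ : J ⊆ I) : SolvesRadial f J u := fun r hr => h r (hJ hr)

lemma hasDerivAt (h : SolvesRadial f I u) {r : ℝ} (hr : r ∈ I) : HasDerivAt u (deriv u r) r :=
  (h r hr).1.hasDerivAt

lemma continuousOn (h : SolvesRadial f I u) : ContinuousOn u I := fun _ hr =>
  (h.hasDerivAt hr).continuousAt.continuousWithinAt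

lemma continuousOn_deriv (h : SolvesRadial f I u) : ContinuousOn (deriv u) I := fun r hr =>
  (h r hr).2.continuousAt.continuousWithinAt

/-- The divergence form `(r u')' = -r f(u)` of the radial equation. -/
lemma hasDerivAt_mul_deriv (h : SolvesRadial f I u) {r : ℝ} (hr : r ∈ I) (h0 : r ≠ 0) :
    HasDerivAt (fun r => r * deriv u r) (-(r * f (u r))) r := by
  refine ((hasDerivAt_id r).mul (h r hr).2).congr_deriv ?_
  simp only [id]
  field_simp
  ring

lemma congr (h : SolvesRadial f I u) (hI : IsOpen I) (huv : EqOn v u I) : SolvesRadial f I v := by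
  intro r hr
  have he : v =ᶠ[𝓝 r] u := huv.eventuallyEq_of_mem (hI.mem_nhds hr)
  have hd : deriv v =ᶠ[𝓝 r] deriv u := he.deriv
  refine ⟨he.differentiableAt_iff.2 (h r hr).1, ?_⟩
  rw [hd.eq_of_nhds, he.eq_of_nhds]
  exact (h r hr).2.congr_of_eventuallyEq hd

/-- A solution of the first-order system for `(u, r u')` solves the radial equation. -/
lemma of_system {p : ℝ → ℝ} (hI : IsOpen I) (h0 : ∀ r ∈ I, 0 < r)
    (hu : ∀ r ∈ I, HasDerivAt u (p r / r) r) (hp : ∀ r ∈ I, HasDerivAt p (-(r * f (u r))) r) :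
    SolvesRadial f I u := by
  intro r hr
  have hr0 := (h0 r hr).ne'
  refine ⟨(hu r hr).differentiableAt, ?_⟩
  have hd : deriv u =ᶠ[𝓝 r] fun r => p r / r := by
    filter_upwards [hI.mem_nhds hr] with x hx using (hu x hx).deriv
  rw [hd.eq_of_nhds]
  refine (((hp r hr).div (hasDerivAt_id r) hr0).congr_of_eventuallyEq hd).congr_deriv ?_
  simp only [id]
  field_simp
  ring

/-- The dissipation identity for the energy `u'² / 2 + F(u)`, where `F' = f`. -/
lemma hasDerivAt_energy {F : ℝ → ℝ} (hF : ∀ s, HasDerivAt F (f s) s) (h : SolvesRadial f I u)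
    {r : ℝ} (hr : r ∈ I) :
    HasDerivAt (fun r => deriv u r ^ 2 / 2 + F (u r)) (-(deriv u r ^ 2 / r)) r := by
  have h1 := (((h r hr).2.pow 2).div_const 2).add ((hF (u r)).comp r (h.hasDerivAt hr))
  refine h1.congr_deriv ?_
  simp only [Nat.cast_ofNat, Nat.add_one_sub_one, pow_one]
  ring

lemma energy_antitoneOn {F : ℝ → ℝ} (hF : ∀ s, HasDerivAt F (f s) s) (h : SolvesRadial f I u)
    (hI : Convex ℝ I) (h0 : ∀ r ∈ I, 0 < r) :
    AntitoneOn (fun r => deriv u r ^ 2 / 2 + F (u r)) I := by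
  refine antitoneOn_of_hasDerivWithinAt_nonpos (f' := fun r => -(deriv u r ^ 2 / r)) hI
    (fun r hr => (h.hasDerivAt_energy hF hr).continuousAt.continuousWithinAt)
    (fun r hr => (h.hasDerivAt_energy hF (interior_subset hr)).hasDerivWithinAt) fun r hr => ?_
  have := h0 r (interior_subset hr)
  have : 0 ≤ deriv u r ^ 2 / r := by positivity
  linarith

lemma lipschitz_system {K : NNReal} {s : Set ℝ} (hf : LipschitzOnWith K f s) {a b r : ℝ}
    (ha : 0 < a) (hr : r ∈ Icc a b) :
    LipschitzOnWith (Real.toNNReal (a⁻¹ + b * K))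
      (fun x : ℝ × ℝ => (x.2 / r, -(r * f x.1))) (s ×ˢ univ) := by
  have hr0 : 0 < r := ha.trans_le hr.1
  have hb : 0 ≤ b := hr0.le.trans hr.2
  refine LipschitzOnWith.of_dist_le_mul fun x hx y hy => ?_
  rw [Real.coe_toNNReal _ (by positivity), Prod.dist_eq]
  have h1 : dist (x.2 / r) (y.2 / r) ≤ a⁻¹ * dist x y := by
    rw [Real.dist_eq, ← sub_div, abs_div, abs_of_pos hr0, div_eq_inv_mul]
    gcongr
    · exact hr.1
    · rw [← Real.dist_eq, Prod.dist_eq]; exact le_max_right _ _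
  have h2 : dist (-(r * f x.1)) (-(r * f y.1)) ≤ b * K * dist x y := by
    rw [dist_neg_neg, Real.dist_eq, ← mul_sub, abs_mul, abs_of_pos hr0, mul_assoc]
    have := hf.dist_le_mul x.1 hx.1 y.1 hy.1
    rw [Real.dist_eq] at this
    have h3 : dist x.1 y.1 ≤ dist x y := by rw [Prod.dist_eq]; exact le_max_left _ _
    have h4 : |f x.1 - f y.1| ≤ K * dist x y := this.trans (by gcongr)
    exact mul_le_mul hr.2 h4 (abs_nonneg _) hb
  have h3 : 0 ≤ a⁻¹ * dist x y := by positivity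
  have h4 : 0 ≤ b * K * dist x y := by positivity
  rw [add_mul]
  exact max_le (by linarith) (by linarith)

lemma hasDerivAt_system (h : SolvesRadial f I u) {r : ℝ} (hr : r ∈ I) (h0 : 0 < r) :
    HasDerivAt (fun r => (u r, r * deriv u r)) (r * deriv u r / r, -(r * f (u r))) r := by
  refine HasDerivAt.prodMk ?_ (h.hasDerivAt_mul_deriv hr h0.ne')
  rw [mul_div_cancel_left₀ _ h0.ne']
  exact h.hasDerivAt hr

/-- Uniqueness for the Cauchy problem. -/
lemma eqOn (hf : IsLocLipschitz f) {a b t : ℝ} (ha : 0 ≤ a) (ht : t ∈ Ioo a b)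
    (hu : SolvesRadial f (Ioo a b) u) (hv : SolvesRadial f (Ioo a b) v)
    (h0 : u t = v t) (h1 : deriv u t = deriv v t) : EqOn u v (Ioo a b) := by
  intro r hr
  have hmin : a < min r t := lt_min hr.1 ht.1
  have hmax : max r t < b := max_lt hr.2 ht.2
  obtain ⟨a', ha1, ha2⟩ := exists_between hmin
  obtain ⟨b', hb1, hb2⟩ := exists_between hmax
  have ha0 : 0 < a' := ha.trans_lt ha1
  have hsub : Icc a' b' ⊆ Ioo a b := fun x hx => ⟨ha1.trans_le hx.1, hx.2.trans_lt hb2⟩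
  obtain ⟨M₁, hM₁⟩ := isCompact_Icc.exists_bound_of_continuousOn (hu.continuousOn.mono hsub)
  obtain ⟨M₂, hM₂⟩ := isCompact_Icc.exists_bound_of_continuousOn (hv.continuousOn.mono hsub)
  obtain ⟨K, hK⟩ := hf (max M₁ M₂)
  have key := ODE_solution_unique_of_mem_Ioo (a := a') (b := b') (t₀ := t)
    (v := fun r (x : ℝ × ℝ) => (x.2 / r, -(r * f x.1)))
    (s := fun _ => Icc (-(max M₁ M₂)) (max M₁ M₂) ×ˢ univ)
    (f := fun r => (u r, r * deriv u r)) (g := fun r => (v r, r * deriv v r))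
    (fun r hr => lipschitz_system hK ha0 (Ioo_subset_Icc_self hr))
    ⟨ha2.trans_le (min_le_right _ _), (le_max_right _ _).trans_lt hb1⟩
    (fun x hx => ⟨hu.hasDerivAt_system (hsub (Ioo_subset_Icc_self hx)) (ha0.trans hx.1),
      abs_le.1 ((hM₁ x (Ioo_subset_Icc_self hx)).trans (le_max_left _ _)), trivial⟩)
    (fun x hx => ⟨hv.hasDerivAt_system (hsub (Ioo_subset_Icc_self hx)) (ha0.trans hx.1),
      abs_le.1 ((hM₂ x (Ioo_subset_Icc_self hx)).trans (le_max_right _ _)), trivial⟩)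
    (by simp [h0, h1])
  have := key (show r ∈ Ioo a' b' from
    ⟨ha2.trans_le (min_le_left _ _), (le_max_left _ _).trans_lt hb1⟩)
  exact congrArg Prod.fst this

/-- Uniqueness for the backward Cauchy problem. -/
lemma eqOn_left (hf : IsLocLipschitz f) {a t : ℝ} (ha : 0 ≤ a)
    (hu : SolvesRadial f (Ioc a t) u) (hv : SolvesRadial f (Ioc a t) v)
    (h0 : u t = v t) (h1 : deriv u t = deriv v t) : EqOn u v (Ioc a t) := by
  intro r hr
  have hr0 : 0 < r := ha.trans_lt hr.1
  have hsub : Icc r t ⊆ Ioc a t := fun x hx => ⟨hr.1.trans_le hx.1, hx.2⟩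
  obtain ⟨M₁, hM₁⟩ := isCompact_Icc.exists_bound_of_continuousOn (hu.continuousOn.mono hsub)
  obtain ⟨M₂, hM₂⟩ := isCompact_Icc.exists_bound_of_continuousOn (hv.continuousOn.mono hsub)
  obtain ⟨K, hK⟩ := hf (max M₁ M₂)
  have hcont : ∀ {w : ℝ → ℝ}, SolvesRadial f (Ioc a t) w →
      ContinuousOn (fun r => (w r, r * deriv w r)) (Icc r t) := fun hw =>
    (hw.continuousOn.prodMk (continuousOn_id.mul hw.continuousOn_deriv)).mono hsub
  have key := ODE_solution_unique_of_mem_Icc_left (a := r) (b := t)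
    (v := fun r (x : ℝ × ℝ) => (x.2 / r, -(r * f x.1)))
    (s := fun _ => Icc (-(max M₁ M₂)) (max M₁ M₂) ×ˢ univ)
    (f := fun r => (u r, r * deriv u r)) (g := fun r => (v r, r * deriv v r))
    (fun x hx => lipschitz_system hK hr0 (Ioc_subset_Icc_self hx))
    (hcont hu)
    (fun x hx => (hu.hasDerivAt_system (hsub (Ioc_subset_Icc_self hx))
      (hr0.trans hx.1)).hasDerivWithinAt)
    (fun x hx => ⟨abs_le.1 ((hM₁ x (Ioc_subset_Icc_self hx)).trans (le_max_left _ _)), trivial⟩)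
    (hcont hv)
    (fun x hx => (hv.hasDerivAt_system (hsub (Ioc_subset_Icc_self hx))
      (hr0.trans hx.1)).hasDerivWithinAt)
    (fun x hx => ⟨abs_le.1 ((hM₂ x (Ioc_subset_Icc_self hx)).trans (le_max_right _ _)), trivial⟩)
    (by simp [h0, h1])
  exact congrArg Prod.fst (key (left_mem_Icc.2 hr.2))

/-- Continuous dependence of the solution of the Cauchy problem on the nonlinearity. -/
lemma abs_sub_le_gronwall {g : ℝ → ℝ} {K : NNReal} {M ε a b : ℝ}
    (hf : LipschitzOnWith K f (Icc (-M) M)) (ha : 0 < a)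
    (hu : SolvesRadial f (Icc a b) u) (hv : SolvesRadial g (Icc a b) v)
    (huM : ∀ r ∈ Icc a b, |u r| ≤ M) (hvM : ∀ r ∈ Icc a b, |v r| ≤ M)
    (hfg : ∀ s ∈ Icc (-M) M, |g s - f s| ≤ ε)
    (h0 : u a = v a) (h1 : deriv u a = deriv v a) {r : ℝ} (hr : r ∈ Icc a b) :
    |u r - v r| ≤ gronwallBound 0 (Real.toNNReal (a⁻¹ + b * K)) (b * ε) (r - a) ∧
    |r * deriv u r - r * deriv v r|
      ≤ gronwallBound 0 (Real.toNNReal (a⁻¹ + b * K)) (b * ε) (r - a) := by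
  have hcont : ∀ {h : ℝ → ℝ} {w : ℝ → ℝ}, SolvesRadial h (Icc a b) w →
      ContinuousOn (fun r => (w r, r * deriv w r)) (Icc a b) := fun hw =>
    hw.continuousOn.prodMk (continuousOn_id.mul hw.continuousOn_deriv)
  have key := dist_le_of_approx_trajectories_ODE_of_mem (a := a) (b := b) (δ := 0) (εf := 0)
    (εg := b * ε) (K := Real.toNNReal (a⁻¹ + b * K))
    (v := fun r (x : ℝ × ℝ) => (x.2 / r, -(r * f x.1)))
    (s := fun _ => Icc (-M) M ×ˢ univ)
    (f := fun r => (u r, r * deriv u r)) (g := fun r => (v r, r * deriv v r))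
    (f' := fun r => (r * deriv u r / r, -(r * f (u r))))
    (g' := fun r => (r * deriv v r / r, -(r * g (v r))))
    (fun r hr => lipschitz_system hf ha (Ico_subset_Icc_self hr)) (hcont hu)
    (fun x hx => (hu.hasDerivAt_system (Ico_subset_Icc_self hx)
      (ha.trans_le hx.1)).hasDerivWithinAt)
    (fun x hx => by simp)
    (fun x hx => ⟨abs_le.1 (huM x (Ico_subset_Icc_self hx)), trivial⟩) (hcont hv)
    (fun x hx => (hv.hasDerivAt_system (Ico_subset_Icc_self hx)
      (ha.trans_le hx.1)).hasDerivWithinAt)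
    (fun x hx => by
      have hx0 : 0 < x := ha.trans_le hx.1
      rw [Prod.dist_eq, dist_self, dist_neg_neg, Real.dist_eq, ← mul_sub, abs_mul, abs_of_pos hx0]
      have h3 := hfg (v x) (abs_le.1 (hvM x (Ico_subset_Icc_self hx)))
      have h4 : x * |g (v x) - f (v x)| ≤ b * ε :=
        mul_le_mul hx.2.le h3 (abs_nonneg _) (hx0.le.trans hx.2.le)
      exact max_le ((mul_nonneg hx0.le (abs_nonneg _)).trans h4) h4)
    (fun x hx => ⟨abs_le.1 (hvM x (Ico_subset_Icc_self hx)), trivial⟩)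
    (by simp [h0, h1]) r hr
  rw [zero_add, Prod.dist_eq] at key
  exact ⟨(le_max_left _ _).trans key, (le_max_right _ _).trans key⟩

/-- Solvability of the Cauchy problem on bounded intervals for bounded Lipschitz nonlinearities. -/
lemma exists_of_bounded {K : NNReal} {B : ℝ} (hf : LipschitzWith K f) (hB : ∀ s, |f s| ≤ B)
    {a b t : ℝ} (ha : 0 < a) (ht : t ∈ Ioo a b) (x₀ x₁ : ℝ) :
    ∃ w : ℝ → ℝ, SolvesRadial f (Ioo a b) w ∧ w t = x₀ ∧ deriv w t = x₁ := by
  have hB0 : 0 ≤ B := (abs_nonneg _).trans (hB 0)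
  have ht0 : 0 < t := ha.trans ht.1
  have hb0 : 0 < b := ht0.trans ht.2
  have hab : 0 < b - a := by linarith [ht.1, ht.2]
  -- A bound for `r w'`, obtained by integrating `(r w')' = -r f(w)`.
  set P : ℝ := |t * x₁| + b * B * (b - a) with hP
  have hP0 : 0 ≤ P := by positivity
  let V : ℝ → ℝ × ℝ → ℝ × ℝ := fun r x => (clamp P x.2 / r, -(r * f x.1))
  let L : NNReal := ⟨P / a + b * B, by positivity⟩
  have hPL : IsPicardLindelof V (tmin := a) (tmax := b) ⟨t, Ioo_subset_Icc_self ht⟩ (x₀, t * x₁)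
      (L * Real.toNNReal (b - a)) 0 L (Real.toNNReal (a⁻¹ + b * K) * 1) := by
    refine ⟨fun r hr => ?_, fun x _ => ?_, fun r hr x _ => ?_, ?_⟩
    · have h1 := (lipschitz_system (s := univ) (lipschitzOnWith_univ.2 hf) ha hr)
      rw [univ_prod_univ, lipschitzOnWith_univ] at h1
      have h2 : LipschitzWith 1 (fun x : ℝ × ℝ => (x.1, clamp P x.2)) := by
        have := (LipschitzWith.prod_fst (α := ℝ) (β := ℝ)).prodMk
          ((lipschitzWith_clamp P).comp (LipschitzWith.prod_snd (α := ℝ) (β := ℝ)))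
        simpa using this
      exact (h1.comp h2).lipschitzOnWith
    · have : ∀ r ∈ Icc a b, r ≠ 0 := fun r hr => (ha.trans_le hr.1).ne'
      exact (continuousOn_const.div continuousOn_id this).prodMk
        (continuousOn_id.mul continuousOn_const).neg
    · have hr0 : 0 < r := ha.trans_le hr.1
      change ‖(clamp P x.2 / r, -(r * f x.1))‖ ≤ P / a + b * B
      rw [Prod.norm_def, Real.norm_eq_abs, Real.norm_eq_abs, abs_div, abs_neg, abs_mul,
        abs_of_pos hr0]
      have h1 : |clamp P x.2| / r ≤ P / a :=
        div_le_div₀ hP0 (abs_clamp_le hP0 _) ha hr.1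
      have h2 : r * |f x.1| ≤ b * B := mul_le_mul hr.2 (hB _) (abs_nonneg _) hb0.le
      have h3 : 0 ≤ P / a := by positivity
      have h4 : 0 ≤ b * B := by positivity
      exact max_le (by linarith) (by linarith)
    · change (L : ℝ) * max (b - t) (t - a) ≤
        ((L * Real.toNNReal (b - a) : NNReal) : ℝ) - ((0 : NNReal) : ℝ)
      rw [NNReal.coe_zero, sub_zero, NNReal.coe_mul, Real.coe_toNNReal _ hab.le]
      refine mul_le_mul_of_nonneg_left ?_ L.2
      exact max_le (by linarith [ht.1]) (by linarith [ht.2])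
  obtain ⟨α, hα0, hα⟩ := hPL.exists_eq_forall_mem_Icc_hasDerivWithinAt₀
  have hα' : ∀ r ∈ Ioo a b, HasDerivAt α (V r (α r)) r := fun r hr =>
    (hα r (Ioo_subset_Icc_self hr)).hasDerivAt (Icc_mem_nhds hr.1 hr.2)
  have h1 : ∀ r ∈ Ioo a b, HasDerivAt (fun r => (α r).1) (clamp P (α r).2 / r) r := fun r hr =>
    (hα' r hr).fst
  have h2 : ∀ r ∈ Ioo a b, HasDerivAt (fun r => (α r).2) (-(r * f (α r).1)) r := fun r hr =>
    (hα' r hr).snd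
  have h0 : α t = (x₀, t * x₁) := hα0
  have h3 : ∀ r ∈ Ioo a b, |(α r).2| ≤ P := by
    intro r hr
    have := (convex_Ioo a b).norm_image_sub_le_of_norm_hasDerivWithin_le (C := b * B)
      (fun x hx => (h2 x hx).hasDerivWithinAt) (fun x hx => by
        have hx0 : 0 < x := ha.trans hx.1
        rw [Real.norm_eq_abs, abs_neg, abs_mul, abs_of_pos hx0]
        exact mul_le_mul hx.2.le (hB _) (abs_nonneg _) hb0.le) ht hr
    rw [h0, Real.norm_eq_abs, Real.norm_eq_abs] at this
    have h4 : |r - t| ≤ b - a := abs_le.2 ⟨by linarith [hr.1, ht.2], by linarith [hr.2, ht.1]⟩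
    have h5 : |(α r).2| - |t * x₁| ≤ |(α r).2 - t * x₁| := abs_sub_abs_le_abs_sub _ _
    have h6 := mul_le_mul_of_nonneg_left h4 (show 0 ≤ b * B by positivity)
    simp only [hP] at *
    linarith
  have h4 : ∀ r ∈ Ioo a b, HasDerivAt (fun r => (α r).1) ((α r).2 / r) r := fun r hr => by
    have := h1 r hr
    rwa [clamp_of_mem (abs_le.1 (h3 r hr))] at this
  refine ⟨fun r => (α r).1, of_system isOpen_Ioo (fun r hr => ha.trans hr.1) h4 h2, by simp [h0], ?_⟩
  rw [(h4 t ht).deriv, h0]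
  field_simp

end SolvesRadial

/-! ### Global continuation of radial solutions -/

section Truncation

variable {χ : ℝ → ℝ} {m M : ℝ}

lemma isLocLipschitz_of_lipschitzWith {f : ℝ → ℝ} {K : NNReal} (hf : LipschitzWith K f) :
    IsLocLipschitz f := fun _ => ⟨K, hf.lipschitzOnWith⟩

lemma exists_lipschitz_nonlin_clamp (hχ : IsCutoff χ) (hm : 0 ≤ m) (hM : 0 ≤ M) :
    ∃ K : NNReal, LipschitzWith K fun s => nonlin χ m (clamp M s) := by
  obtain ⟨K, hK⟩ := isLocLipschitz_nonlin hχ hm M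
  refine ⟨K * 1, ?_⟩
  have h := hK.comp (lipschitzWith_clamp M).lipschitzOnWith (s := univ)
    (fun s _ => clamp_mem hM s)
  exact lipschitzOnWith_univ.1 h

lemma exists_bound_nonlin_clamp (hχ : IsCutoff χ) (hM : 0 ≤ M) :
    ∃ B : ℝ, ∀ s, |nonlin χ m (clamp M s)| ≤ B := by
  obtain ⟨B, hB⟩ := (isCompact_Icc (a := -M) (b := M)).exists_bound_of_continuousOn
    (continuous_nonlin hχ m).continuousOn
  exact ⟨B, fun s => hB _ (clamp_mem hM s)⟩

/-- The primitive of the truncated nonlinearity. -/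
def truncPotential (χ : ℝ → ℝ) (m M s : ℝ) : ℝ := ∫ τ in (0 : ℝ)..s, nonlin χ m (clamp M τ)

lemma continuous_nonlin_clamp (hχ : IsCutoff χ) :
    Continuous fun s => nonlin χ m (clamp M s) :=
  (continuous_nonlin hχ m).comp (continuous_clamp M)

lemma hasDerivAt_truncPotential (hχ : IsCutoff χ) (s : ℝ) :
    HasDerivAt (truncPotential χ m M) (nonlin χ m (clamp M s)) s := by
  have hc : Continuous fun s => nonlin χ m (clamp M s) := continuous_nonlin_clamp hχ
  exact intervalIntegral.integral_hasDerivAt_right (hc.intervalIntegrable _ _)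
    hc.aestronglyMeasurable.stronglyMeasurableAtFilter hc.continuousAt

lemma truncPotential_of_mem (hχ : IsCutoff χ) {s : ℝ} (hM : 0 ≤ M) (hs : s ∈ Icc (-M) M) :
    truncPotential χ m M s = potential χ m s := by
  have h : truncPotential χ m M s = ∫ τ in (0 : ℝ)..s, nonlin χ m τ := by
    refine intervalIntegral.integral_congr fun τ hτ => ?_
    have : τ ∈ Icc (-M) M := (ordConnected_Icc.uIcc_subset ⟨by linarith, hM⟩ hs) hτ
    simp only [clamp_of_mem this]
  rw [h, intervalIntegral.integral_eq_sub_of_hasDerivAt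
    (fun τ _ => hasDerivAt_potential hχ m τ)
    ((continuous_nonlin hχ m).intervalIntegrable _ _), potential_zero, sub_zero]

lemma potential_clamp_le (hχ : IsCutoff χ) (hM : 2 ≤ M) (s : ℝ) :
    potential χ m (clamp M s) ≤ truncPotential χ m M s := by
  have hM0 : 0 ≤ M := by linarith
  have hc : Continuous fun s => nonlin χ m (clamp M s) := continuous_nonlin_clamp hχ
  have hE : 0 ≤ Real.exp (M ^ 2) - 1 := by linarith [Real.one_le_exp (sq_nonneg M)]
  have hsplit := intervalIntegral.integral_add_adjacent_intervals
    (hc.intervalIntegrable (μ := volume) 0 (clamp M s))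
    (hc.intervalIntegrable (μ := volume) (clamp M s) s)
  have h1 : (∫ τ in (0 : ℝ)..(clamp M s), nonlin χ m (clamp M τ)) = potential χ m (clamp M s) :=
    truncPotential_of_mem hχ hM0 (clamp_mem hM0 s)
  rw [truncPotential, ← hsplit, h1, le_add_iff_nonneg_right]
  rcases le_total s (-M) with hs | hs
  · have hcl : ∀ τ ≤ -M, clamp M τ = -M := fun τ hτ => by
      rw [clamp, min_eq_left (by linarith), max_eq_left hτ]
    rw [hcl s hs, intervalIntegral.integral_symm, ← intervalIntegral.integral_neg]
    refine intervalIntegral.integral_nonneg hs fun τ hτ => ?_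
    rw [hcl τ hτ.2, nonlin, hχ.eq_zero (-M) (by rw [abs_neg, abs_of_nonneg hM0]; exact hM)]
    rw [neg_sq]
    nlinarith
  · rcases le_total s M with hs' | hs'
    · rw [clamp_of_mem ⟨hs, hs'⟩, intervalIntegral.integral_same]
    · have hcl : ∀ τ, M ≤ τ → clamp M τ = M := fun τ hτ => by
        rw [clamp, min_eq_right hτ, max_eq_right (by linarith)]
      rw [hcl s hs']
      refine intervalIntegral.integral_nonneg hs' fun τ hτ => ?_
      rw [hcl τ hτ.1, nonlin_of_two_le hχ m hM]
      positivity

end Truncation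

/-- Solutions of `-u'' - u'/r = f_m(u)` on `(0, R]` can be continued to all radii: the energy is
decreasing and the potential is coercive, so truncating the nonlinearity at a high level does not
change the solution. -/
lemma exists_global_extension {χ : ℝ → ℝ} (hχ : IsCutoff χ) {m : ℝ} (hm : 0 ≤ m) {R : ℝ}
    (hR : 0 < R) {u : ℝ → ℝ} (hu : SolvesRadial (nonlin χ m) (Ioc 0 R) u) :
    ∃ ψ : ℝ → ℝ, (∀ r ∈ Ioc 0 R, ψ r = u r) ∧ SolvesRadial (nonlin χ m) (Ioi 0) ψ := by
  have hR2 : 0 < R / 2 := by linarith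
  have hsub : Icc (R / 2) R ⊆ Ioc 0 R := fun x hx => ⟨hR2.trans_le hx.1, hx.2⟩
  have hRm : R ∈ Icc (R / 2) R := ⟨by linarith, le_rfl⟩
  obtain ⟨M₀, hM₀⟩ := isCompact_Icc.exists_bound_of_continuousOn (hu.continuousOn.mono hsub)
  have hM₀0 : 0 ≤ M₀ := (norm_nonneg _).trans (hM₀ R hRm)
  set E₀ := deriv u R ^ 2 / 2 + potential χ m (u R) with hE₀
  set A := 1 + 2 * m + 4 * |E₀| with hA
  have hA1 : 1 ≤ A := by
    have := abs_nonneg E₀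
    linarith
  set M := M₀ + A + 1 with hM
  have hM2 : 2 ≤ M := by linarith
  have hM0 : 0 ≤ M := by linarith
  have hA0 : A < M ^ 2 := by nlinarith
  have huM : ∀ r ∈ Icc (R / 2) R, u r ∈ Icc (-M) M := fun r hr => by
    have := abs_le.1 (hM₀ r hr)
    exact ⟨by linarith, by linarith⟩
  obtain ⟨K, hK⟩ := exists_lipschitz_nonlin_clamp hχ hm hM0
  obtain ⟨B, hB⟩ := exists_bound_nonlin_clamp (m := m) hχ hM0
  have hut : SolvesRadial (fun s => nonlin χ m (clamp M s)) (Ioc (R / 2) R) u := fun r hr => by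
    have := hu r (hsub (Ioc_subset_Icc_self hr))
    simpa only [clamp_of_mem (huM r (Ioc_subset_Icc_self hr))] using this
  have hex : ∀ b, R < b → ∃ w : ℝ → ℝ, SolvesRadial (nonlin χ m) (Ioo (R / 2) b) w ∧
      w R = u R ∧ deriv w R = deriv u R ∧ EqOn w u (Ioc (R / 2) R) := by
    intro b hb
    obtain ⟨w, hw, hw0, hw1⟩ := SolvesRadial.exists_of_bounded hK hB hR2
      (show R ∈ Ioo (R / 2) b from ⟨by linarith, hb⟩) (u R) (deriv u R)
    have heq : EqOn w u (Ioc (R / 2) R) :=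
      SolvesRadial.eqOn_left (isLocLipschitz_of_lipschitzWith hK) hR2.le
        (hw.mono fun x hx => ⟨hx.1, hx.2.trans_lt hb⟩) hut hw0 hw1
    refine ⟨w, ?_, hw0, hw1, heq⟩
    have hwM : ∀ r ∈ Ioo (R / 2) b, w r ∈ Icc (-M) M := by
      intro r hr
      rcases lt_or_ge r R with hrR | hrR
      · rw [heq ⟨hr.1, hrR.le⟩]
        exact huM r ⟨hr.1.le, hrR.le⟩
      have hanti := (hw.mono (show Ico R b ⊆ Ioo (R / 2) b from fun x hx =>
        ⟨by linarith [hx.1], hx.2⟩)).energy_antitoneOn (hasDerivAt_truncPotential hχ)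
        (convex_Ico R b) (fun x hx => hR.trans_le hx.1) ⟨le_rfl, hb⟩ ⟨hrR, hr.2⟩ hrR
      simp only [hw0, hw1, truncPotential_of_mem hχ hM0 (huM R hRm)] at hanti
      have h1 := potential_clamp_le (m := m) hχ hM2 (w r)
      have h2 : potential χ m (clamp M (w r)) ≤ E₀ := by
        have := sq_nonneg (deriv w r)
        linarith
      have h3 := sq_le_of_potential_le hχ hm h2
      by_contra hcon
      rw [mem_Icc, not_and_or, not_le, not_le] at hcon
      have h4 : clamp M (w r) ^ 2 = M ^ 2 := by
        rcases hcon with h | h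
        · rw [clamp, min_eq_left (by linarith), max_eq_left h.le, neg_sq]
        · rw [clamp, min_eq_right h.le, max_eq_right (by linarith)]
      linarith
    intro r hr
    have := hw r hr
    simpa only [clamp_of_mem (hwM r hr)] using this
  choose! w hw hw0 hw1 hwu using hex
  have hww : ∀ b b' r, R < b → R < b' → R / 2 < r → r < b → r < b' → w b r = w b' r := by
    intro b b' r hb hb' h1 h2 h3
    exact SolvesRadial.eqOn (isLocLipschitz_nonlin hχ hm) hR2.le
        (show R ∈ Ioo (R / 2) (min b b') from ⟨by linarith, lt_min hb hb'⟩)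
        ((hw b hb).mono (Ioo_subset_Ioo_right (min_le_left _ _)))
        ((hw b' hb').mono (Ioo_subset_Ioo_right (min_le_right _ _)))
        (by rw [hw0 b hb, hw0 b' hb']) (by rw [hw1 b hb, hw1 b' hb']) ⟨h1, lt_min h2 h3⟩
  refine ⟨fun r => if r ≤ R then u r else w (r + 1) r, fun r hr => if_pos hr.2, ?_⟩
  intro r hr
  rw [mem_Ioi] at hr
  rcases lt_or_ge r R with hrR | hrR
  · have h1 : SolvesRadial (nonlin χ m) (Ioo 0 R) u := hu.mono Ioo_subset_Ioc_self
    exact h1.congr isOpen_Ioo (fun x hx => if_pos hx.2.le) r ⟨hr, hrR⟩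
  · have hb : R < r + 1 := by linarith
    refine (hw (r + 1) hb).congr isOpen_Ioo (fun x hx => ?_) r ⟨by linarith, by linarith⟩
    by_cases hxR : x ≤ R
    · simp only [if_pos hxR]
      exact (hwu (r + 1) hb ⟨hx.1, hxR⟩).symm
    · simp only [if_neg hxR]
      exact hww _ _ _ (by linarith) hb hx.1 (by linarith) hx.2

/-! ### The profile near the singularity -/

/-- What the heat flow sees of a radial profile: positivity, the singularity at the origin measured
by `e^{φ²/2}`, and exponential decay at infinity. The value of `φ` at `0` is left free. -/
structure IsSingularProfile (φ : ℝ → ℝ) : Prop where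
  continuousOn : ContinuousOn φ (Ioi 0)
  pos : ∀ r, 0 < r → 0 < φ r
  singular : ∃ C δ : ℝ, 0 < C ∧ 0 < δ ∧ δ < 1 ∧
    ∀ r ∈ Ioo 0 δ, Real.exp (φ r ^ 2 / 2) ≤ C * (r * -Real.log r)⁻¹
  decay : ∃ C c R : ℝ, 0 < C ∧ 0 < c ∧ 0 < R ∧ ∀ r, R ≤ r → φ r ≤ C * Real.exp (-(c * r))

lemma tendsto_neg_log_nhdsGT_zero :
    Tendsto (fun r : ℝ => -Real.log r) (𝓝[>] 0) atTop :=
  tendsto_neg_atBot_atTop.comp Real.tendsto_log_nhdsGT_zero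

lemma singular_radicand_ge {L : ℝ} (hL : 0 < L) :
    L - 1 ≤ 2 * L - 2 * Real.log L - 2 * Real.log 2 := by
  have h1 := Real.log_le_sub_one_of_pos (show 0 < L / 2 by linarith)
  rw [Real.log_div hL.ne' (by norm_num)] at h1
  have := Real.log_two_lt_d9
  linarith

/-- The expansion at the origin required of a singular disk solution. -/
def HasSingularExpansion (u : ℝ → ℝ) : Prop :=
  (fun r => u r - Real.sqrt (-2 * Real.log r - 2 * Real.log (-Real.log r) - 2 * Real.log 2))
    =O[𝓝[>] 0] fun r => (-Real.log r) ^ (-(3 / 2) : ℝ) * Real.log (-Real.log r)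

namespace HasSingularExpansion

variable {u : ℝ → ℝ}

/-- The expansion of `u` at the origin, in terms of `L = -log r`. -/
lemma exists_abs_sub_sqrt_le (h : HasSingularExpansion u) :
    ∃ C : ℝ, 0 ≤ C ∧ ∀ᶠ r in 𝓝[>] (0 : ℝ), 1 ≤ -Real.log r ∧
      |u r - Real.sqrt (2 * (-Real.log r) - 2 * Real.log (-Real.log r) - 2 * Real.log 2)|
        ≤ C * (Real.sqrt (-Real.log r))⁻¹ := by
  obtain ⟨C, hC, hb⟩ := h.exists_pos
  refine ⟨C, hC.le, ?_⟩
  filter_upwards [hb.bound, tendsto_neg_log_nhdsGT_zero.eventually_ge_atTop 1] with r hr hL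
  refine ⟨hL, ?_⟩
  set L := -Real.log r with hLdef
  have hL0 : 0 < L := by linarith
  have h1 : -2 * Real.log r = 2 * L := by rw [hLdef]; ring
  rw [h1, Real.norm_eq_abs, Real.norm_eq_abs] at hr
  refine hr.trans (mul_le_mul_of_nonneg_left ?_ hC.le)
  have hlog0 : 0 ≤ Real.log L := Real.log_nonneg hL
  rw [abs_of_nonneg (mul_nonneg (Real.rpow_nonneg hL0.le _) hlog0)]
  have hlog : Real.log L ≤ L := (Real.log_le_sub_one_of_pos hL0).trans (by linarith)
  calc L ^ (-(3 / 2) : ℝ) * Real.log L ≤ L ^ (-(3 / 2) : ℝ) * L ^ (1 : ℝ) := by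
        rw [Real.rpow_one]
        exact mul_le_mul_of_nonneg_left hlog (Real.rpow_nonneg hL0.le _)
    _ = (Real.sqrt L)⁻¹ := by
        rw [← Real.rpow_add hL0, Real.sqrt_eq_rpow, ← Real.rpow_neg hL0.le]
        norm_num

lemma tendsto_atTop (h : HasSingularExpansion u) : Tendsto u (𝓝[>] 0) atTop := by
  obtain ⟨C, hC, hb⟩ := h.exists_abs_sub_sqrt_le
  have h1 : Tendsto (fun r : ℝ => Real.sqrt (-Real.log r - 1) - C) (𝓝[>] 0) atTop := by
    refine tendsto_atTop_add_const_right _ _ (Real.tendsto_sqrt_atTop.comp ?_)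
    exact tendsto_atTop_add_const_right _ _ tendsto_neg_log_nhdsGT_zero
  refine tendsto_atTop_mono' _ ?_ h1
  filter_upwards [hb] with r hr
  have h2 := (abs_le.1 hr.2).1
  have h3 := Real.sqrt_le_sqrt (singular_radicand_ge (show 0 < -Real.log r by linarith [hr.1]))
  have h4 : (Real.sqrt (-Real.log r))⁻¹ ≤ 1 := by
    refine inv_le_one_of_one_le₀ ?_
    rw [Real.one_le_sqrt]; exact hr.1
  nlinarith

lemma exists_exp_sq_le (h : HasSingularExpansion u) :
    ∃ C : ℝ, 0 < C ∧ ∀ᶠ r in 𝓝[>] (0 : ℝ),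
      Real.exp (u r ^ 2 / 2) ≤ C * (r * -Real.log r)⁻¹ := by
  obtain ⟨C, hC, hb⟩ := h.exists_abs_sub_sqrt_le
  refine ⟨Real.exp (2 * C + C ^ 2), Real.exp_pos _, ?_⟩
  filter_upwards [hb, h.tendsto_atTop.eventually_ge_atTop 0, self_mem_nhdsWithin]
    with r hr hu0 hr0
  rw [mem_Ioi] at hr0
  obtain ⟨hL, hr⟩ := hr
  set L := -Real.log r with hLdef
  have hL0 : 0 < L := by linarith
  set Q := 2 * L - 2 * Real.log L - 2 * Real.log 2 with hQ
  have hQ0 : 0 ≤ Q := (by linarith : (0:ℝ) ≤ L - 1).trans (singular_radicand_ge hL0)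
  have hQL : Q ≤ 2 * L := by
    have := Real.log_nonneg hL
    have := Real.log_nonneg (show (1:ℝ) ≤ 2 by norm_num)
    linarith
  set ε := (Real.sqrt L)⁻¹ with hε
  have hsL : 1 ≤ Real.sqrt L := by rw [Real.one_le_sqrt]; exact hL
  have hε0 : 0 ≤ ε := by positivity
  have hε1 : ε ≤ 1 := inv_le_one_of_one_le₀ hsL
  have hSε : Real.sqrt Q * ε ≤ 2 := by
    have : Real.sqrt Q ≤ 2 * Real.sqrt L := by
      rw [Real.sqrt_le_left (by positivity), mul_pow, Real.sq_sqrt hL0.le]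
      linarith
    rw [hε, ← div_eq_mul_inv, div_le_iff₀ (by linarith)]
    exact this
  have hu1 : u r ≤ Real.sqrt Q + C * ε := by linarith [(abs_le.1 hr).2]
  have hu2 : u r ^ 2 ≤ Q + (4 * C + C ^ 2) := by
    have h1 : u r ^ 2 ≤ (Real.sqrt Q + C * ε) ^ 2 := pow_le_pow_left₀ hu0 hu1 2
    have h2 := Real.sq_sqrt hQ0
    have h3 : C ^ 2 * ε ^ 2 ≤ C ^ 2 * 1 :=
      mul_le_mul_of_nonneg_left (pow_le_one₀ hε0 hε1) (sq_nonneg C)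
    nlinarith [mul_le_mul_of_nonneg_left hSε hC]
  have h5 : Real.exp (u r ^ 2 / 2) ≤ Real.exp (2 * C + C ^ 2 + (-Real.log r - Real.log L)) := by
    rw [Real.exp_le_exp]
    have := Real.log_nonneg (show (1:ℝ) ≤ 2 by norm_num)
    nlinarith [sq_nonneg C]
  refine h5.trans (le_of_eq ?_)
  rw [Real.exp_add, Real.exp_sub, Real.exp_neg, Real.exp_log hr0, Real.exp_log hL0, mul_inv,
    div_eq_mul_inv]

end HasSingularExpansion

/-- The function `r u'` is decreasing for positive solutions `u` of the massless equation. -/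
lemma SolvesRadial.strictAntiOn_mul_deriv {ρ : ℝ} {u : ℝ → ℝ}
    (h : SolvesRadial (fun s => s * (Real.exp (s ^ 2) - 1)) (Ioo 0 ρ) u)
    (hpos : ∀ r ∈ Ioo 0 ρ, 0 < u r) : StrictAntiOn (fun r => r * deriv u r) (Ioo 0 ρ) := by
  refine strictAntiOn_of_hasDerivWithinAt_neg (convex_Ioo 0 ρ)
    (f' := fun r => -(r * (u r * (Real.exp (u r ^ 2) - 1))))
    (fun x hx => (h.hasDerivAt_mul_deriv hx hx.1.ne').continuousAt.continuousWithinAt)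
    (fun x hx => (h.hasDerivAt_mul_deriv (interior_subset hx)
      (interior_subset hx).1.ne').hasDerivWithinAt) fun x hx => ?_
  have hx' := interior_subset hx
  have hu := hpos x hx'
  have : 1 < Real.exp (u x ^ 2) := Real.one_lt_exp_iff.2 (by positivity)
  have := mul_pos hx'.1 (mul_pos hu (sub_pos.2 this))
  linarith

/-- Singular positive solutions are decreasing. -/
lemma SolvesRadial.deriv_neg_of_tendsto_atTop {ρ : ℝ} {u : ℝ → ℝ}
    (h : SolvesRadial (fun s => s * (Real.exp (s ^ 2) - 1)) (Ioo 0 ρ) u)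
    (hpos : ∀ r ∈ Ioo 0 ρ, 0 < u r) (hlim : Tendsto u (𝓝[>] 0) atTop)
    {r : ℝ} (hr : r ∈ Ioo 0 ρ) : deriv u r < 0 := by
  by_contra! h0
  have hp := h.strictAntiOn_mul_deriv hpos
  have hmono : StrictMonoOn u (Ioc 0 r) := by
    refine strictMonoOn_of_deriv_pos (convex_Ioc 0 r)
      (h.continuousOn.mono fun x hx => ⟨hx.1, hx.2.trans_lt hr.2⟩) fun x hx => ?_
    rw [interior_Ioc] at hx
    have := hp ⟨hx.1, hx.2.trans hr.2⟩ hr hx.2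
    have h1 : 0 < x * deriv u x := (mul_nonneg hr.1.le h0).trans_lt this
    exact pos_of_mul_pos_right h1 hx.1.le
  have hlt : ∀ᶠ x in 𝓝[>] (0 : ℝ), x ∈ Ioo 0 r := Ioo_mem_nhdsGT hr.1
  obtain ⟨x, hx, hx'⟩ := (hlt.and (hlim.eventually_ge_atTop (u r))).exists
  exact absurd (hmono ⟨hx.1, hx.2.le⟩ ⟨hr.1, le_rfl⟩ hx.2) (not_lt.2 hx')

namespace IsSingularDiskSolution

variable {ρ : ℝ} {u : ℝ → ℝ}

lemma hasSingularExpansion (h : IsSingularDiskSolution ρ u) : HasSingularExpansion u := h.singular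

lemma tendsto_atTop (h : IsSingularDiskSolution ρ u) : Tendsto u (𝓝[>] 0) atTop :=
  h.hasSingularExpansion.tendsto_atTop

lemma deriv_neg (h : IsSingularDiskSolution ρ u) {r : ℝ} (hr : r ∈ Ioo 0 ρ) : deriv u r < 0 :=
  h.ode.deriv_neg_of_tendsto_atTop h.pos h.tendsto_atTop hr

lemma strictAntiOn (h : IsSingularDiskSolution ρ u) : StrictAntiOn u (Ioo 0 ρ) := by
  refine strictAntiOn_of_deriv_neg (convex_Ioo 0 ρ) h.ode.continuousOn fun x hx => ?_
  rw [interior_Ioo] at hx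
  exact h.deriv_neg hx

end IsSingularDiskSolution

/-! ### Shooting with the mass parameter -/

/-- The data of the shooting problem: a singular disk solution and the radius where it takes the
value `2`. -/
structure ShootingData (u : ℝ → ℝ) (R : ℝ) : Prop where
  exists_disk : ∃ ρ, IsSingularDiskSolution ρ u ∧ R ∈ Ioo 0 ρ
  value : u R = 2

namespace ShootingData

variable {χ u : ℝ → ℝ} {R : ℝ}

lemma radius_pos (h : ShootingData u R) : 0 < R := by
  obtain ⟨ρ, _, hR⟩ := h.exists_disk
  exact hR.1

lemma deriv_neg (h : ShootingData u R) : deriv u R < 0 := by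
  obtain ⟨ρ, hu, hR⟩ := h.exists_disk
  exact hu.deriv_neg hR

lemma two_le (h : ShootingData u R) {r : ℝ} (hr : r ∈ Ioc 0 R) : 2 ≤ u r := by
  obtain ⟨ρ, hu, hR⟩ := h.exists_disk
  rw [← h.value]
  exact hu.strictAntiOn.antitoneOn ⟨hr.1, hr.2.trans_lt hR.2⟩ hR hr.2

/-- The cut-off does not act where `u ≥ 2`, so `u` solves the equation with any mass there. -/
lemma solvesRadial (h : ShootingData u R) (hχ : IsCutoff χ) (m : ℝ) :
    SolvesRadial (nonlin χ m) (Ioc 0 R) u := by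
  obtain ⟨ρ, hu, hR⟩ := h.exists_disk
  intro r hr
  rw [nonlin_of_two_le hχ m (h.two_le hr)]
  exact hu.ode r ⟨hr.1, hr.2.trans_lt hR.2⟩

lemma exists_isShot (h : ShootingData u R) (hχ : IsCutoff χ) {m : ℝ} (hm : 0 ≤ m) :
    ∃ ψ, IsShot χ u R m ψ := by
  obtain ⟨ψ, h1, h2⟩ := exists_global_extension hχ hm h.radius_pos (h.solvesRadial hχ m)
  exact ⟨ψ, h1, h2⟩

lemma shot_value (h : ShootingData u R) {m : ℝ} {ψ : ℝ → ℝ} (hψ : IsShot χ u R m ψ) :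
    ψ R = 2 := by
  rw [hψ.eq_inner R ⟨h.radius_pos, le_rfl⟩, h.value]

lemma shot_deriv (h : ShootingData u R) (hχ : IsCutoff χ) {m : ℝ} {ψ : ℝ → ℝ}
    (hψ : IsShot χ u R m ψ) : deriv ψ R = deriv u R := by
  have hR := h.radius_pos
  have h1 : HasDerivWithinAt ψ (deriv ψ R) (Iic R) R := (hψ.ode.hasDerivAt hR).hasDerivWithinAt
  have h2 : HasDerivWithinAt u (deriv u R) (Iic R) R :=
    ((h.solvesRadial hχ m).hasDerivAt ⟨hR, le_rfl⟩).hasDerivWithinAt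
  have h3 : HasDerivWithinAt ψ (deriv u R) (Iic R) R := by
    refine h2.congr_of_eventuallyEq ?_ (hψ.eq_inner R ⟨hR, le_rfl⟩)
    filter_upwards [Ioc_mem_nhdsLE hR] with x hx using hψ.eq_inner x hx
  exact (uniqueDiffWithinAt_Iic R).eq_deriv _ h1 h3

/-- The energy of the shot with mass `m`. -/
def _root_.HeatExp.shotEnergy (χ : ℝ → ℝ) (m : ℝ) (ψ : ℝ → ℝ) (r : ℝ) : ℝ :=
  deriv ψ r ^ 2 / 2 + potential χ m (ψ r)

lemma shotEnergy_antitoneOn (hχ : IsCutoff χ) {m : ℝ} {ψ : ℝ → ℝ}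
    (hψ : SolvesRadial (nonlin χ m) (Ioi 0) ψ) : AntitoneOn (shotEnergy χ m ψ) (Ioi 0) :=
  hψ.energy_antitoneOn (hasDerivAt_potential hχ m) (convex_Ioi 0) fun _ hr => hr

lemma shotEnergy_le (h : ShootingData u R) (hχ : IsCutoff χ) {m : ℝ} (hm : 0 ≤ m) {ψ : ℝ → ℝ}
    (hψ : IsShot χ u R m ψ) {r : ℝ} (hr : R ≤ r) :
    shotEnergy χ m ψ r ≤ deriv u R ^ 2 / 2 + potential χ 0 2 := by
  have hR := h.radius_pos
  refine (shotEnergy_antitoneOn hχ hψ.ode hR (hR.trans_le hr) hr).trans ?_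
  rw [shotEnergy, h.shot_value hψ, h.shot_deriv hχ hψ]
  have := mul_nonneg hm (massPotential_nonneg hχ 2)
  simp only [potential]
  linarith

/-- Shots are bounded beyond `R`, uniformly for bounded masses. -/
lemma exists_shot_bound (h : ShootingData u R) (hχ : IsCutoff χ) (mbar : ℝ) :
    ∃ M : ℝ, 0 ≤ M ∧ ∀ m ψ, 0 ≤ m → m ≤ mbar → IsShot χ u R m ψ → ∀ r, R ≤ r → |ψ r| ≤ M := by
  set E := deriv u R ^ 2 / 2 + potential χ 0 2 with hE
  refine ⟨1 + 2 * |mbar| + 4 * |E|, by positivity, fun m ψ hm hmb hψ r hr => ?_⟩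
  have h1 := h.shotEnergy_le hχ hm hψ hr
  have h2 : potential χ m (ψ r) ≤ E := by
    have := sq_nonneg (deriv ψ r)
    rw [shotEnergy] at h1
    linarith
  have h3 := sq_le_of_potential_le hχ hm h2
  have h4 : m ≤ |mbar| := hmb.trans (le_abs_self _)
  have h5 := abs_nonneg E
  refine abs_le_of_sq_le_sq ?_ (by positivity)
  nlinarith

/-- Shots depend continuously on the mass. -/
lemma shot_continuity (h : ShootingData u R) (hχ : IsCutoff χ) {m : ℝ} (hm : 0 ≤ m) {φ : ℝ → ℝ}
    (hφ : IsShot χ u R m φ) {b ε : ℝ} (hb : R ≤ b) (hε : 0 < ε) :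
    ∃ δ > 0, ∀ m' ψ, 0 ≤ m' → |m' - m| < δ → IsShot χ u R m' ψ →
      ∀ r ∈ Icc R b, |φ r - ψ r| < ε ∧ |deriv φ r - deriv ψ r| < ε := by
  have hR := h.radius_pos
  obtain ⟨M, hM, hbound⟩ := h.exists_shot_bound hχ (m + 1)
  obtain ⟨K, hK⟩ := isLocLipschitz_nonlin hχ hm M
  set G : ℝ → ℝ := fun ε' => gronwallBound 0 (Real.toNNReal (R⁻¹ + b * K)) ε' (b - R) with hG
  have hG0 : Tendsto (fun d : ℝ => G (b * (d * M))) (𝓝 0) (𝓝 0) := by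
    have hc : Continuous fun d : ℝ => G (b * (d * M)) :=
      (gronwallBound_continuous_ε _ _ _).comp (by fun_prop)
    have := hc.tendsto 0
    simpa [hG, gronwallBound_ε0_δ0] using this
  have hmin : 0 < min ε (ε * R) := lt_min hε (by positivity)
  obtain ⟨δ, hδ, hGδ⟩ := Metric.eventually_nhds_iff.1 (hG0.eventually (gt_mem_nhds hmin))
  refine ⟨min δ 1, lt_min hδ one_pos, fun m' ψ hm' hmm hψ r hr => ?_⟩
  have h1 : m' ≤ m + 1 := by
    have := (abs_lt.1 (hmm.trans_le (min_le_right _ _))).2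
    linarith
  have hsub : Icc R b ⊆ Ioi 0 := fun x hx => hR.trans_le hx.1
  have key := SolvesRadial.abs_sub_le_gronwall hK hR (hφ.ode.mono hsub) (hψ.ode.mono hsub)
    (fun x hx => hbound m φ hm (by linarith) hφ x hx.1)
    (fun x hx => hbound m' ψ hm' h1 hψ x hx.1) (ε := |m' - m| * M)
    (fun s hs => by
      have : nonlin χ m' s - nonlin χ m s = -((m' - m) * (χ s * s)) := by
        simp only [nonlin]; ring
      rw [this, abs_neg, abs_mul, abs_mul, abs_of_nonneg (hχ.nonneg s)]
      refine mul_le_mul_of_nonneg_left ?_ (abs_nonneg _)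
      exact (mul_le_of_le_one_left (abs_nonneg s) (hχ.le_one s)).trans (abs_le.2 hs))
    (by rw [h.shot_value hφ, h.shot_value hψ]) (by rw [h.shot_deriv hχ hφ, h.shot_deriv hχ hψ]) hr
  have hmono : gronwallBound 0 (Real.toNNReal (R⁻¹ + b * K)) (b * (|m' - m| * M)) (r - R)
      ≤ G (b * (|m' - m| * M)) := by
    refine gronwallBound_mono le_rfl ?_ (NNReal.coe_nonneg _) (by linarith [hr.2])
    have : 0 ≤ b := hR.le.trans hb
    positivity
  have hlt : G (b * (|m' - m| * M)) < min ε (ε * R) := by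
    refine hGδ ?_
    rw [Real.dist_eq, sub_zero, abs_abs]
    exact hmm.trans_le (min_le_left _ _)
  refine ⟨key.1.trans_lt (hmono.trans_lt (hlt.trans_le (min_le_left _ _))), ?_⟩
  have h2 := key.2.trans_lt (hmono.trans_lt (hlt.trans_le (min_le_right _ _)))
  have hr0 : 0 < r := hR.trans_le hr.1
  rw [← mul_sub, abs_mul, abs_of_pos hr0] at h2
  by_contra! hcon
  have := mul_le_mul hr.1 hcon hε.le hr0.le
  linarith

/-- Negative energy prevents a solution from reaching zero later on. -/
lemma pos_of_energy_neg (hχ : IsCutoff χ) {m : ℝ} {ψ : ℝ → ℝ}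
    (hψ : SolvesRadial (nonlin χ m) (Ioi 0) ψ) {r₁ r : ℝ} (hr₁ : 0 < r₁) (h1 : 0 < ψ r₁)
    (hE : shotEnergy χ m ψ r₁ < 0) (hr : r₁ ≤ r) : 0 < ψ r := by
  by_contra! h0
  obtain ⟨x, hx, hx0⟩ := intermediate_value_Icc' hr
    (hψ.continuousOn.mono fun x hx => hr₁.trans_le hx.1) ⟨h0, h1.le⟩
  have h2 := shotEnergy_antitoneOn hχ hψ hr₁ (hr₁.trans_le hx.1) hx.1
  rw [shotEnergy, hx0, potential_zero] at h2
  have := sq_nonneg (deriv ψ x)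
  linarith

lemma positiveMasses_nonempty (h : ShootingData u R) (hχ : IsCutoff χ) :
    (positiveMasses χ u R).Nonempty := by
  obtain ⟨m, hm⟩ : ∃ m, m = deriv u R ^ 2 + Real.exp (2 ^ 2) := ⟨_, rfl⟩
  have hm0 : 0 < m := by rw [hm]; positivity
  obtain ⟨ψ, hψ⟩ := h.exists_isShot hχ hm0.le
  refine ⟨m, hm0, ψ, hψ, fun r hr => ?_⟩
  refine pos_of_energy_neg hχ hψ.ode h.radius_pos (by rw [h.shot_value hψ]; norm_num) ?_ hr.le
  rw [shotEnergy, h.shot_value hψ, h.shot_deriv hχ hψ, potential]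
  have := mul_le_mul_of_nonneg_left (half_le_massPotential_two hχ) hm0.le
  generalize Real.exp ((2 : ℝ) ^ 2) = e at *
  linarith

end ShootingData

/-! ### The critical mass -/

namespace ShootingData

variable {χ u φ : ℝ → ℝ} {R m : ℝ}

lemma critical_nonneg (hm : IsGLB (positiveMasses χ u R) m) : 0 ≤ m :=
  hm.2 fun _ hx => hx.1.le

lemma solvesRadial_zero (f : ℝ → ℝ) (hf : f 0 = 0) (I : Set ℝ) :
    SolvesRadial f I (fun _ => 0) := by
  intro r _
  have h : deriv (fun _ : ℝ => (0 : ℝ)) = fun _ => 0 := by funext x; simp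
  refine ⟨differentiableAt_const _, ?_⟩
  rw [h]
  simpa [hf] using hasDerivAt_const r (0 : ℝ)

/-- The critical shot is positive: otherwise it would become negative, as zeros are transversal,
and so would the shots of all nearby masses. -/
lemma critical_pos (h : ShootingData u R) (hχ : IsCutoff χ)
    (hm : IsGLB (positiveMasses χ u R) m) (hφ : IsShot χ u R m φ) {r : ℝ} (hr : 0 < r) :
    0 < φ r := by
  have hR := h.radius_pos
  have hm0 := critical_nonneg hm
  rcases le_or_gt r R with hrR | hrR
  · rw [hφ.eq_inner r ⟨hr, hrR⟩]
    linarith [h.two_le ⟨hr, hrR⟩]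
  by_contra! h0
  -- At a zero with `φ' = 0` uniqueness would give `φ = 0`, against `φ(R) = 2`.
  have hneg : ∃ r₂, R < r₂ ∧ φ r₂ < 0 := by
    rcases h0.lt_or_eq with h1 | h1
    · exact ⟨r, hrR, h1⟩
    have hd : deriv φ r ≠ 0 := fun hd => by
      have := SolvesRadial.eqOn_left (isLocLipschitz_nonlin hχ hm0) le_rfl
        (hφ.ode.mono fun x (hx : x ∈ Ioc 0 r) => hx.1)
        (solvesRadial_zero (nonlin χ m) (by simp [nonlin]) (Ioc 0 r)) h1 (by simp [hd])
        ⟨hR, hrR.le⟩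
      rw [h.shot_value hφ] at this
      norm_num at this
    by_contra! hcon
    refine hd (IsLocalMin.deriv_eq_zero ?_)
    filter_upwards [lt_mem_nhds hrR] with x hx
    rw [h1]
    exact hcon x hx
  obtain ⟨r₂, hr₂, hφ₂⟩ := hneg
  obtain ⟨δ, hδ, hcont⟩ := h.shot_continuity hχ hm0 hφ hr₂.le (neg_pos.2 hφ₂)
  obtain ⟨m', ⟨hm', ψ, hψ, hψpos⟩, hle, hlt⟩ := hm.exists_between (lt_add_of_pos_right m hδ)
  have := (hcont m' ψ hm'.le (abs_lt.2 ⟨by linarith, by linarith⟩) hψ r₂ ⟨hr₂.le, le_rfl⟩).1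
  have h2 := hψpos r₂ hr₂
  rw [abs_lt] at this
  linarith [this.1]

/-- With zero mass the shot is the disk solution, which vanishes on the boundary of the disk. -/
lemma critical_mass_pos (h : ShootingData u R) (hχ : IsCutoff χ)
    (hm : IsGLB (positiveMasses χ u R) m) (hφ : IsShot χ u R m φ) : 0 < m := by
  refine (critical_nonneg hm).lt_of_ne' fun h0 => ?_
  obtain ⟨ρ, hu, hR⟩ := h.exists_disk
  have hu' : SolvesRadial (nonlin χ 0) (Ioo 0 ρ) u := by
    rw [nonlin_zero_mass]; exact hu.ode
  have hφ0 : IsShot χ u R 0 φ := h0 ▸ hφ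
  have heq : EqOn φ u (Ioo 0 ρ) := by
    refine SolvesRadial.eqOn (isLocLipschitz_nonlin hχ le_rfl) le_rfl hR
      (hφ0.ode.mono fun x hx => hx.1) hu' (by rw [h.shot_value hφ, h.value])
      (h.shot_deriv hχ hφ0)
  have hρ := hu.radius_pos
  have h1 : Tendsto φ (𝓝[<] ρ) (𝓝 (φ ρ)) :=
    ((hφ.ode.hasDerivAt hρ).continuousAt).continuousWithinAt
  have h2 : Tendsto u (𝓝[<] ρ) (𝓝 (u ρ)) := by
    have := (hu.continuousOn ρ ⟨hρ, le_rfl⟩).mono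
      (show Ioo 0 ρ ⊆ Ioc 0 ρ from Ioo_subset_Ioc_self)
    rwa [ContinuousWithinAt, nhdsWithin_Ioo_eq_nhdsLT hρ] at this
  have h3 : φ =ᶠ[𝓝[<] ρ] u := by
    filter_upwards [Ioo_mem_nhdsLT hρ] with x hx using heq hx
  have h4 := tendsto_nhds_unique (h1.congr' h3) h2
  have := h.critical_pos hχ hm hφ hρ
  rw [h4, hu.boundary] at this
  exact lt_irrefl _ this

/-- The energy of the critical shot never becomes negative: otherwise slightly smaller masses
would also give positive solutions. -/
lemma critical_energy_nonneg (h : ShootingData u R) (hχ : IsCutoff χ)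
    (hm : IsGLB (positiveMasses χ u R) m) (hφ : IsShot χ u R m φ) {r : ℝ} (hr : R ≤ r) :
    0 ≤ shotEnergy χ m φ r := by
  by_contra! hE
  have hR := h.radius_pos
  have hm0 := h.critical_mass_pos hχ hm hφ
  obtain ⟨c, hc, hcφ⟩ : ∃ c > 0, ∀ x ∈ Icc R r, c ≤ φ x := by
    obtain ⟨x₀, hx₀, hmin⟩ := isCompact_Icc.exists_isMinOn (nonempty_Icc.2 hr)
      (hφ.ode.continuousOn.mono fun x (hx : x ∈ Icc R r) => hR.trans_le hx.1)
    exact ⟨φ x₀, h.critical_pos hχ hm hφ (hR.trans_le hx₀.1), fun x hx => hmin hx⟩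
  -- The energy at the fixed radius is a continuous function of the mass and the Cauchy data.
  have hcont : Continuous fun q : ℝ × ℝ × ℝ => q.2.2 ^ 2 / 2 + potential χ q.1 q.2.1 := by
    have hmp : Continuous (massPotential χ) :=
      continuous_iff_continuousAt.2 fun s => (hasDerivAt_massPotential hχ s).continuousAt
    simp only [potential]
    fun_prop
  have hnear := (hcont.tendsto (m, φ r, deriv φ r)).eventually (gt_mem_nhds hE)
  obtain ⟨η, hη, hnear⟩ := Metric.eventually_nhds_iff.1 hnear
  obtain ⟨δ, hδ, hδc⟩ := h.shot_continuity hχ hm0.le hφ hr (lt_min hη hc)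
  obtain ⟨m', hm'1, hm'2⟩ := exists_between (max_lt (sub_lt_self m (lt_min hδ hη)) hm0)
  have hm'0 : 0 < m' := (le_max_right _ _).trans_lt hm'1
  have hm'δ : m - min δ η < m' := (le_max_left _ _).trans_lt hm'1
  have habs : |m' - m| < min δ η := abs_lt.2 ⟨by linarith, by linarith [lt_min hδ hη]⟩
  obtain ⟨ψ, hψ⟩ := h.exists_isShot hχ hm'0.le
  have hclose := hδc m' ψ hm'0.le (habs.trans_le (min_le_left _ _)) hψ
  have hψpos : ∀ x ∈ Icc R r, 0 < ψ x := fun x hx => by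
    have h1 := (abs_lt.1 ((hclose x hx).1.trans_le (min_le_right _ _))).2
    linarith [hcφ x hx]
  have hψE : shotEnergy χ m' ψ r < 0 := by
    refine hnear (y := (m', ψ r, deriv ψ r)) ?_
    have h1 := hclose r ⟨hr, le_rfl⟩
    rw [Prod.dist_eq, Prod.dist_eq]
    refine max_lt ?_ (max_lt ?_ ?_)
    · exact habs.trans_le (min_le_right _ _)
    · rw [dist_comm]; exact h1.1.trans_le (min_le_left _ _)
    · rw [dist_comm]; exact h1.2.trans_le (min_le_left _ _)
  have hmem : m' ∈ positiveMasses χ u R := ⟨hm'0, ψ, hψ, fun x hx => by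
    rcases le_total x r with hxr | hxr
    · exact hψpos x ⟨hx.le, hxr⟩
    · exact pos_of_energy_neg hχ hψ.ode (hR.trans_le hr) (hψpos r ⟨hr, le_rfl⟩) hψE hxr⟩
  exact absurd (hm.1 hmem) (not_le.2 hm'2)

/-- The critical shot is decreasing beyond `R`: at a first critical point the energy would be
`F(φ) ≥ 0`, so that `f(φ) > 0` and the point would be a strict local maximum. -/
lemma critical_deriv_neg (h : ShootingData u R) (hχ : IsCutoff χ)
    (hm : IsGLB (positiveMasses χ u R) m) (hφ : IsShot χ u R m φ) {r : ℝ} (hr : R ≤ r) :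
    deriv φ r < 0 := by
  by_contra! h0
  have hR := h.radius_pos
  have hm0 := h.critical_mass_pos hχ hm hφ
  have hcd : ContinuousOn (deriv φ) (Icc R r) :=
    hφ.ode.continuousOn_deriv.mono fun x hx => hR.trans_le hx.1
  have hcomp : IsCompact (Icc R r ∩ deriv φ ⁻¹' Ici 0) :=
    isCompact_Icc.of_isClosed_subset (hcd.preimage_isClosed_of_isClosed isClosed_Icc isClosed_Ici)
      inter_subset_left
  obtain ⟨r₀, ⟨hr₀, hd₀⟩, hleast⟩ := hcomp.exists_isLeast ⟨r, ⟨hr, le_rfl⟩, h0⟩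
  have hd₀' : 0 ≤ deriv φ r₀ := hd₀
  have hRr₀ : R < r₀ := by
    refine hr₀.1.lt_of_ne fun he => ?_
    rw [← he, h.shot_deriv hχ hφ] at hd₀'
    exact absurd h.deriv_neg (not_lt.2 hd₀')
  have hr₀0 : 0 < r₀ := hR.trans hRr₀
  have hbefore : ∀ᶠ x in 𝓝[<] r₀, deriv φ x < 0 := by
    filter_upwards [Ioo_mem_nhdsLT hRr₀] with x hx
    by_contra! hx0
    exact absurd (hleast ⟨⟨hx.1.le, hx.2.le.trans hr₀.2⟩, hx0⟩) (not_le.2 hx.2)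
  have hder := (hφ.ode r₀ hr₀0).2
  have hzero : deriv φ r₀ = 0 := by
    refine le_antisymm ?_ hd₀'
    exact le_of_tendsto (hder.continuousAt.tendsto.mono_left nhdsWithin_le_nhds)
      (hbefore.mono fun x hx => hx.le)
  have hpos := h.critical_pos hχ hm hφ hr₀0
  have hE := h.critical_energy_nonneg hχ hm hφ hRr₀.le
  rw [shotEnergy, hzero] at hE
  have hf : 0 < nonlin χ m (φ r₀) := by
    rw [nonlin_eq]
    exact mul_pos hpos (growthFactor_pos_of_potential_nonneg hχ hm0.le hpos (by linarith))
  have hslope := (hasDerivWithinAt_iff_tendsto_slope' (self_notMem_Iio (a := r₀))).1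
    (hder.hasDerivWithinAt (s := Iio r₀))
  have hge : 0 ≤ -(deriv φ r₀ / r₀) - nonlin χ m (φ r₀) := by
    refine ge_of_tendsto hslope ?_
    filter_upwards [hbefore, self_mem_nhdsWithin] with x hx hxr
    rw [slope_def_field, hzero]
    exact (div_pos_of_neg_of_neg (by linarith) (sub_neg.2 hxr)).le
  rw [hzero, zero_div] at hge
  linarith

lemma _root_.HeatExp.exists_neg_of_deriv_le {g g' : ℝ → ℝ} {a c : ℝ} (hc : 0 < c)
    (hg : ∀ x, a ≤ x → HasDerivAt g (g' x) x) (hle : ∀ x, a ≤ x → g' x ≤ -c) :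
    ∃ x, a ≤ x ∧ g x < 0 := by
  set x := a + (|g a| + 1) / c with hx
  have hax : a ≤ x := by
    have : 0 ≤ (|g a| + 1) / c := by positivity
    linarith
  refine ⟨x, hax, ?_⟩
  have key := (convex_Ici a).image_sub_le_mul_sub_of_deriv_le (f := g) (C := -c)
    (fun y hy => (hg y hy).continuousAt.continuousWithinAt)
    (fun y hy => (hg y (interior_subset hy)).differentiableAt.differentiableWithinAt)
    (fun y hy => (hg y (interior_subset hy)).deriv ▸ hle y (interior_subset hy))
    a self_mem_Ici x hax hax
  have : c * (x - a) = |g a| + 1 := by rw [hx]; field_simp; ring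
  have := le_abs_self (g a)
  linarith

lemma critical_antitoneOn (h : ShootingData u R) (hχ : IsCutoff χ)
    (hm : IsGLB (positiveMasses χ u R) m) (hφ : IsShot χ u R m φ) : AntitoneOn φ (Ici R) := by
  have hR := h.radius_pos
  refine antitoneOn_of_deriv_nonpos (convex_Ici R)
    (hφ.ode.continuousOn.mono fun x hx => hR.trans_le hx)
    (fun x hx => (hφ.ode.hasDerivAt (hR.trans_le (interior_subset hx))).differentiableAt
      |>.differentiableWithinAt)
    fun x hx => (h.critical_deriv_neg hχ hm hφ (interior_subset hx)).le

/-- The critical shot converges to zero at infinity. -/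
lemma critical_tendsto_zero (h : ShootingData u R) (hχ : IsCutoff χ)
    (hm : IsGLB (positiveMasses χ u R) m) (hφ : IsShot χ u R m φ) : Tendsto φ atTop (𝓝 0) := by
  have hR := h.radius_pos
  have hm0 := h.critical_mass_pos hχ hm hφ
  have hanti := h.critical_antitoneOn hχ hm hφ
  have hA : Antitone fun r => φ (max R r) := fun x y hxy =>
    hanti (mem_Ici.2 (le_max_left R x)) (mem_Ici.2 (le_max_left R y)) (max_le_max le_rfl hxy)
  have hbdd : BddBelow (range fun r => φ (max R r)) := by
    refine ⟨0, ?_⟩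
    rintro _ ⟨r, rfl⟩
    exact (h.critical_pos hχ hm hφ (hR.trans_le (le_max_left _ _))).le
  set L := ⨅ r, φ (max R r) with hL
  have hlim : Tendsto φ atTop (𝓝 L) := by
    refine (tendsto_atTop_ciInf hA hbdd).congr' ?_
    filter_upwards [eventually_ge_atTop R] with x hx
    simp only [max_eq_right hx]
  have hLle : ∀ r, R ≤ r → L ≤ φ r := fun r hr => by
    have := ciInf_le hbdd r
    simpa only [max_eq_right hr] using this
  have hL0 : 0 ≤ L := le_ciInf fun r =>
    (h.critical_pos hχ hm hφ (hR.trans_le (le_max_left _ _))).le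
  rcases hL0.eq_or_lt with h0 | h0
  · rwa [← h0] at hlim
  exfalso
  rcases lt_or_ge (potential χ m L) 0 with hF | hF
  · -- The energy is nonnegative, so `φ'` stays away from zero.
    set c := -potential χ m L / 2 with hc
    have hc0 : 0 < c := by linarith
    have hev : ∀ᶠ r in atTop, potential χ m (φ r) < -c :=
      ((continuous_potential hχ m).tendsto L |>.comp hlim).eventually
        (gt_mem_nhds (by linarith))
    obtain ⟨r₁, hr₁⟩ := eventually_atTop.1 (hev.and (eventually_ge_atTop R))
    obtain ⟨x, hx, hxneg⟩ := exists_neg_of_deriv_le (g := φ) (g' := deriv φ) (a := r₁)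
      (c := Real.sqrt (2 * c)) (by positivity)
      (fun x hx => hφ.ode.hasDerivAt (hR.trans_le (hr₁ x hx).2)) (fun x hx => by
        have h1 := h.critical_energy_nonneg hχ hm hφ (hr₁ x hx).2
        have h2 := h.critical_deriv_neg hχ hm hφ (hr₁ x hx).2
        rw [shotEnergy] at h1
        have h3 : 2 * c ≤ (-deriv φ x) ^ 2 := by
          have := (hr₁ x hx).1
          rw [neg_sq]; linarith
        have := Real.sqrt_le_sqrt h3
        rw [Real.sqrt_sq (by linarith)] at this
        linarith)
    exact absurd hxneg (not_lt.2 (h0.le.trans (hLle x (hr₁ x hx).2)))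
  · -- The nonlinearity is bounded below, so `r φ'` decreases at least linearly.
    have hκ := growthFactor_pos_of_potential_nonneg hχ hm0.le h0 hF
    set c := L * growthFactor χ m L with hc
    have hc0 : 0 < c := mul_pos h0 hκ
    have hfc : ∀ x, R ≤ x → c ≤ nonlin χ m (φ x) := fun x hx => by
      rw [nonlin_eq]
      have hLx := hLle x hx
      exact mul_le_mul hLx ((growthFactor_strictMonoOn hχ hm0.le).monotoneOn h0.le
        (h0.le.trans hLx) hLx) hκ.le (h0.le.trans hLx)
    have hp : ∀ x, R ≤ x → x * deriv φ x ≤ -(R * c) * (x - R) := fun x hx => by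
      have key := (convex_Ici R).image_sub_le_mul_sub_of_deriv_le (C := -(R * c))
        (f := fun r => r * deriv φ r)
        (fun y hy => (hφ.ode.hasDerivAt_mul_deriv (hR.trans_le hy)
          (hR.trans_le hy).ne').continuousAt.continuousWithinAt)
        (fun y hy => (hφ.ode.hasDerivAt_mul_deriv (hR.trans_le (interior_subset hy))
          (hR.trans_le (interior_subset hy)).ne').differentiableAt.differentiableWithinAt)
        (fun y hy => by
          have hy' := interior_subset hy
          rw [(hφ.ode.hasDerivAt_mul_deriv (hR.trans_le hy') (hR.trans_le hy').ne').deriv]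
          have := mul_le_mul hy' (hfc y hy') hc0.le (hR.le.trans hy')
          linarith) R self_mem_Ici x hx hx
      have h2 := mul_pos hR (neg_pos.2 (h.critical_deriv_neg hχ hm hφ le_rfl))
      linarith
    obtain ⟨x, hx, hxneg⟩ := exists_neg_of_deriv_le (g := φ) (g' := deriv φ) (a := 2 * R)
      (c := R * c / 2) (by positivity)
      (fun x hx => hφ.ode.hasDerivAt (show 0 < x by linarith)) (fun x hx => by
        have h1 := hp x (by linarith)
        have hx0 : 0 < x := by linarith
        by_contra! h2
        have h3 := mul_lt_mul_of_pos_left h2 hx0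
        have h4 : R * c * (x / 2) ≤ R * c * (x - R) :=
          mul_le_mul_of_nonneg_left (by linarith) (by positivity)
        linarith)
    exact absurd hxneg (not_lt.2 (h0.le.trans (hLle x (by linarith))))

/-- The critical shot decays exponentially. -/
lemma critical_decay (h : ShootingData u R) (hχ : IsCutoff χ)
    (hm : IsGLB (positiveMasses χ u R) m) (hφ : IsShot χ u R m φ) :
    ∃ C c R : ℝ, 0 < C ∧ 0 < c ∧ 0 < R ∧ ∀ r, R ≤ r → φ r ≤ C * Real.exp (-(c * r)) := by
  have hR := h.radius_pos
  have hm0 := h.critical_mass_pos hχ hm hφ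
  have hlim := h.critical_tendsto_zero hχ hm hφ
  -- `κ(0) = -m`, so `f(φ) ≤ -(m/2) φ` where `φ` is small.
  have hκ0 : growthFactor χ m 0 < -(m / 2) := by
    simp only [growthFactor, hχ.eq_one 0 (by simp)]
    norm_num
    exact hm0
  have hκc : Continuous (growthFactor χ m) := by
    have := hχ.continuous
    unfold growthFactor
    fun_prop
  have hev : ∀ᶠ r in atTop, growthFactor χ m (φ r) < -(m / 2) :=
    ((hκc.tendsto 0).comp hlim).eventually (gt_mem_nhds hκ0)
  obtain ⟨r₁, hr₁⟩ := eventually_atTop.1 (hev.and (eventually_ge_atTop R))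
  have hr₁R := (hr₁ r₁ le_rfl).2
  have hr₁0 : 0 < r₁ := hR.trans_le hr₁R
  have hpos : ∀ x, r₁ ≤ x → 0 < φ x := fun x hx => h.critical_pos hχ hm hφ (hr₁0.trans_le hx)
  have hneg : ∀ x, r₁ ≤ x → deriv φ x < 0 := fun x hx =>
    h.critical_deriv_neg hχ hm hφ (hr₁ x hx).2
  have hDder : ∀ x, r₁ ≤ x → HasDerivAt (fun r => deriv φ r ^ 2 - m / 2 * φ r ^ 2)
      (2 * deriv φ x * (-(deriv φ x / x) - nonlin χ m (φ x) - m / 2 * φ x)) x := fun x hx => by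
    have hx0 : 0 < x := hr₁0.trans_le hx
    refine (((hφ.ode x hx0).2.pow 2).sub
      (((hφ.ode.hasDerivAt hx0).pow 2).const_mul (m / 2))).congr_deriv ?_
    simp only [Nat.cast_ofNat, Nat.add_one_sub_one, pow_one]
    ring
  have hDanti : AntitoneOn (fun r => deriv φ r ^ 2 - m / 2 * φ r ^ 2) (Ici r₁) := by
    refine antitoneOn_of_deriv_nonpos (convex_Ici r₁)
      (fun y hy => (hDder y hy).continuousAt.continuousWithinAt)
      (fun y hy => (hDder y (interior_subset hy)).differentiableAt.differentiableWithinAt)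
      fun y hy => ?_
    have hy' : r₁ ≤ y := interior_subset hy
    rw [(hDder y hy').deriv]
    have h1 := hneg y hy'
    have h2 : 0 ≤ -(deriv φ y / y) := by
      have : 0 < y := hr₁0.trans_le hy'
      have := div_neg_of_neg_of_pos h1 this
      linarith
    have h3 : nonlin χ m (φ y) ≤ -(m / 2) * φ y := by
      rw [nonlin_eq, mul_comm]
      exact mul_le_mul_of_nonneg_right (hr₁ y hy').1.le (hpos y hy').le
    exact mul_nonpos_of_nonpos_of_nonneg (by linarith) (by linarith)
  have hDnonneg : ∀ x, r₁ ≤ x → 0 ≤ deriv φ x ^ 2 - m / 2 * φ x ^ 2 := fun x hx => by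
    by_contra! hlt
    have hlim2 : Tendsto (fun r => -(m / 2 * φ r ^ 2)) atTop (𝓝 0) := by
      simpa using ((hlim.pow 2).const_mul (m / 2)).neg
    obtain ⟨y, hy1, hy2⟩ := ((hlim2.eventually (lt_mem_nhds hlt)).and
      (eventually_ge_atTop x)).exists
    have := hDanti hx (hx.trans hy2) hy2
    simp only at this
    have := sq_nonneg (deriv φ y)
    linarith
  set c := Real.sqrt (m / 2) with hc
  have hc0 : 0 < c := by positivity
  have hdc : ∀ x, r₁ ≤ x → deriv φ x ≤ -(c * φ x) := fun x hx => by
    have h1 := hDnonneg x hx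
    have h2 : c ^ 2 = m / 2 := Real.sq_sqrt (by linarith)
    have h3 : (c * φ x) ^ 2 ≤ (-deriv φ x) ^ 2 := by rw [neg_sq, mul_pow, h2]; linarith
    have := abs_le_of_sq_le_sq' h3 (by linarith [hneg x hx])
    linarith [this.2]
  have hexp : ∀ x, HasDerivAt (fun r => Real.exp (c * r)) (Real.exp (c * x) * c) x := fun x => by
    simpa using ((hasDerivAt_id x).const_mul c).exp
  have hder : ∀ x, r₁ ≤ x → HasDerivAt (fun r => φ r * Real.exp (c * r))
      (deriv φ x * Real.exp (c * x) + φ x * (Real.exp (c * x) * c)) x := fun x hx =>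
    (hφ.ode.hasDerivAt (hr₁0.trans_le hx)).mul (hexp x)
  have hanti : AntitoneOn (fun r => φ r * Real.exp (c * r)) (Ici r₁) := by
    refine antitoneOn_of_deriv_nonpos (convex_Ici r₁)
      (fun y hy => (hder y hy).continuousAt.continuousWithinAt)
      (fun y hy => (hder y (interior_subset hy)).differentiableAt.differentiableWithinAt)
      fun y hy => ?_
    rw [(hder y (interior_subset hy)).deriv]
    have := mul_le_mul_of_nonneg_right (hdc y (interior_subset hy)) (Real.exp_pos (c * y)).le
    linarith
  refine ⟨φ r₁ * Real.exp (c * r₁), c, r₁, mul_pos (hpos r₁ le_rfl) (Real.exp_pos _), hc0, hr₁0,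
    fun r hr => ?_⟩
  have := hanti self_mem_Ici hr hr
  simp only at this
  rw [Real.exp_neg, ← div_eq_mul_inv, le_div_iff₀ (Real.exp_pos _)]
  exact this

lemma isSingularProfile (h : ShootingData u R) (hχ : IsCutoff χ)
    (hm : IsGLB (positiveMasses χ u R) m) (hφ : IsShot χ u R m φ) : IsSingularProfile φ := by
  refine ⟨hφ.ode.continuousOn, fun r hr => h.critical_pos hχ hm hφ hr, ?_,
    h.critical_decay hχ hm hφ⟩
  obtain ⟨ρ, hu, hR⟩ := h.exists_disk
  obtain ⟨C, hC, hev⟩ := hu.hasSingularExpansion.exists_exp_sq_le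
  obtain ⟨δ, hδ, hδ'⟩ := (mem_nhdsGT_iff_exists_Ioo_subset' (show (0:ℝ) < min R 1 from
    lt_min hR.1 one_pos)).1 hev
  have hδ0 : 0 < δ := hδ
  refine ⟨C, min δ (min R 1) / 2, hC, ?_, ?_, fun r hr => ?_⟩
  · have := lt_min hδ0 (lt_min hR.1 one_pos)
    linarith
  · have := (min_le_right δ (min R 1)).trans (min_le_right _ _)
    linarith
  · have h0 := lt_min hδ0 (lt_min hR.1 one_pos)
    have h1 : r < δ := by linarith [hr.2, min_le_left δ (min R 1)]
    have h2 : r ≤ R := by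
      linarith [hr.2, (min_le_right δ (min R 1)).trans (min_le_left R 1)]
    rw [hφ.eq_inner r ⟨hr.1, h2⟩]
    exact hδ' ⟨hr.1, h1⟩

end ShootingData

lemma IsSingularSoliton.mass_nonneg_and_profile {χ φ : ℝ → ℝ} {m : ℝ} (hχ : IsCutoff χ)
    (h : IsSingularSoliton χ m φ) : 0 ≤ m ∧ IsSingularProfile φ := by
  obtain ⟨ρ, u, R, hu, hR, huR, hm, hφ⟩ := h
  have hS : ShootingData u R := ⟨⟨ρ, hu, hR⟩, huR⟩
  exact ⟨ShootingData.critical_nonneg hm, hS.isSingularProfile hχ hm hφ⟩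

/-- A singular disk solution gives rise to a singular soliton. -/
lemma exists_isSingularSoliton {χ u : ℝ → ℝ} {ρ : ℝ} (hχ : IsCutoff χ)
    (hu : IsSingularDiskSolution ρ u) : ∃ m φ, IsSingularSoliton χ m φ := by
  have hρ := hu.radius_pos
  obtain ⟨x, hx2, hx⟩ := ((hu.tendsto_atTop.eventually_gt_atTop 2).and
    (Ioo_mem_nhdsGT hρ)).exists
  obtain ⟨R, hR, huR⟩ := intermediate_value_Icc' hx.2.le
    (hu.continuousOn.mono fun y hy => ⟨hx.1.trans_le hy.1, hy.2⟩)
    (show (2:ℝ) ∈ Icc (u ρ) (u x) from ⟨by rw [hu.boundary]; norm_num, hx2.le⟩)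
  have hRρ : R < ρ := hR.2.lt_of_ne fun h => by
    rw [h, hu.boundary] at huR
    norm_num at huR
  have hR' : R ∈ Ioo 0 ρ := ⟨hx.1.trans_le hR.1, hRρ⟩
  have hS : ShootingData u R := ⟨⟨ρ, hu, hR'⟩, huR⟩
  have hglb : IsGLB (positiveMasses χ u R) (sInf (positiveMasses χ u R)) :=
    isGLB_csInf (hS.positiveMasses_nonempty hχ) ⟨0, fun m hm => hm.1.le⟩
  obtain ⟨φ, hφ⟩ := hS.exists_isShot hχ (ShootingData.critical_nonneg hglb)
  exact ⟨_, φ, ρ, u, R, hu, hR', huR, hglb, hφ⟩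

/-! ### Decaying solutions of perturbed oscillatory equations -/

/-- The function `s^{1/4} cos(2√s)`, one of the two standard solutions of
`z'' + (1/s + 3/(16 s²)) z = 0`. -/
def oscCos (s : ℝ) : ℝ := s ^ (1 / 4 : ℝ) * Real.cos (2 * √s)

/-- The function `s^{1/4} sin(2√s)`, the other standard solution of
`z'' + (1/s + 3/(16 s²)) z = 0`. -/
def oscSin (s : ℝ) : ℝ := s ^ (1 / 4 : ℝ) * Real.sin (2 * √s)

/-- The derivative of `oscCos`. -/
def oscCosDeriv (s : ℝ) : ℝ :=
  s ^ (1 / 4 : ℝ) * (Real.cos (2 * √s) / (4 * s) - Real.sin (2 * √s) / √s)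

/-- The derivative of `oscSin`. -/
def oscSinDeriv (s : ℝ) : ℝ :=
  s ^ (1 / 4 : ℝ) * (Real.sin (2 * √s) / (4 * s) + Real.cos (2 * √s) / √s)

lemma hasDerivAt_rpow_quarter {s : ℝ} (hs : 0 < s) :
    HasDerivAt (fun s : ℝ => s ^ (1 / 4 : ℝ)) (s ^ (1 / 4 : ℝ) / (4 * s)) s := by
  refine (Real.hasDerivAt_rpow_const (p := 1 / 4) (Or.inl hs.ne')).congr_deriv ?_
  rw [Real.rpow_sub_one hs.ne']
  field_simp

lemma hasDerivAt_two_sqrt {s : ℝ} (hs : 0 < s) : HasDerivAt (fun s => 2 * √s) (1 / √s) s := by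
  refine ((Real.hasDerivAt_sqrt hs.ne').const_mul 2).congr_deriv ?_
  field_simp

lemma hasDerivAt_inv_sqrt {s : ℝ} (hs : 0 < s) :
    HasDerivAt (fun s => (√s)⁻¹) (-(1 / (2 * s * √s))) s := by
  refine ((Real.hasDerivAt_sqrt hs.ne').inv (Real.sqrt_pos.2 hs).ne').congr_deriv ?_
  rw [Real.sq_sqrt hs.le]
  have := (Real.sqrt_pos.2 hs).ne'
  field_simp

lemma hasDerivAt_oscCos {s : ℝ} (hs : 0 < s) : HasDerivAt oscCos (oscCosDeriv s) s := by
  refine ((hasDerivAt_rpow_quarter hs).mul (hasDerivAt_two_sqrt hs).cos).congr_deriv ?_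
  simp only [oscCosDeriv]; ring

lemma hasDerivAt_oscSin {s : ℝ} (hs : 0 < s) : HasDerivAt oscSin (oscSinDeriv s) s := by
  refine ((hasDerivAt_rpow_quarter hs).mul (hasDerivAt_two_sqrt hs).sin).congr_deriv ?_
  simp only [oscSinDeriv]; ring

lemma hasDerivAt_inv_four_mul {s : ℝ} (hs : 0 < s) :
    HasDerivAt (fun s : ℝ => (4 * s)⁻¹) (-(1 / (4 * s ^ 2))) s := by
  refine (((hasDerivAt_id s).const_mul 4).inv (by simp; exact hs.ne')).congr_deriv ?_
  simp only [id]
  field_simp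

lemma hasDerivAt_oscCosDeriv {s : ℝ} (hs : 0 < s) :
    HasDerivAt oscCosDeriv (-(1 / s + 3 / (16 * s ^ 2)) * oscCos s) s := by
  have ht := Real.sqrt_pos.2 hs
  have h := (hasDerivAt_rpow_quarter hs).mul
    (((hasDerivAt_two_sqrt hs).cos.mul (hasDerivAt_inv_four_mul hs)).sub
      ((hasDerivAt_two_sqrt hs).sin.mul (hasDerivAt_inv_sqrt hs)))
  refine h.congr_deriv ?_
  simp only [oscCos, Pi.sub_apply, Pi.mul_apply]
  generalize s ^ (1 / 4 : ℝ) = h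
  have hst : s = √s ^ 2 := (Real.sq_sqrt hs.le).symm
  generalize √s = t at *
  subst hst
  field_simp
  ring

lemma hasDerivAt_oscSinDeriv {s : ℝ} (hs : 0 < s) :
    HasDerivAt oscSinDeriv (-(1 / s + 3 / (16 * s ^ 2)) * oscSin s) s := by
  have ht := Real.sqrt_pos.2 hs
  have h := (hasDerivAt_rpow_quarter hs).mul
    (((hasDerivAt_two_sqrt hs).sin.mul (hasDerivAt_inv_four_mul hs)).add
      ((hasDerivAt_two_sqrt hs).cos.mul (hasDerivAt_inv_sqrt hs)))
  refine h.congr_deriv ?_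
  simp only [oscSin, Pi.add_apply, Pi.mul_apply]
  generalize s ^ (1 / 4 : ℝ) = h
  have hst : s = √s ^ 2 := (Real.sq_sqrt hs.le).symm
  generalize √s = t at *
  subst hst
  field_simp
  ring

/-- The Wronskian of the two standard solutions. -/
lemma osc_wronskian {s : ℝ} (hs : 0 < s) :
    oscCos s * oscSinDeriv s - oscCosDeriv s * oscSin s = 1 := by
  have ht := Real.sqrt_pos.2 hs
  have hh : s ^ (1 / 4 : ℝ) * s ^ (1 / 4 : ℝ) = √s := by
    rw [← Real.rpow_add hs, Real.sqrt_eq_rpow]; norm_num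
  simp only [oscCos, oscSin, oscCosDeriv, oscSinDeriv]
  have h1 := Real.sin_sq_add_cos_sq (2 * √s)
  calc _ = (s ^ (1 / 4 : ℝ) * s ^ (1 / 4 : ℝ)) *
      ((Real.sin (2 * √s) ^ 2 + Real.cos (2 * √s) ^ 2) / √s) := by ring
    _ = 1 := by rw [hh, h1]; field_simp

lemma abs_oscCos_le {s : ℝ} (hs : 0 < s) : |oscCos s| ≤ s ^ (1 / 4 : ℝ) := by
  have h := Real.rpow_nonneg hs.le (1 / 4)
  rw [oscCos, abs_mul, abs_of_nonneg h]
  exact mul_le_of_le_one_right h (Real.abs_cos_le_one _)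

lemma abs_oscSin_le {s : ℝ} (hs : 0 < s) : |oscSin s| ≤ s ^ (1 / 4 : ℝ) := by
  have h := Real.rpow_nonneg hs.le (1 / 4)
  rw [oscSin, abs_mul, abs_of_nonneg h]
  exact mul_le_of_le_one_right h (Real.abs_sin_le_one _)

/-- The solution operator of `z'' + (1/s + 3/(16 s²)) z = g` with decay at infinity, given by
variation of constants. -/
def oscSolve (g : ℝ → ℝ) (s : ℝ) : ℝ :=
  oscCos s * (∫ σ in Ioi s, oscSin σ * g σ) - oscSin s * ∫ σ in Ioi s, oscCos σ * g σ

/-- The derivative of `oscSolve`. -/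
def oscSolveDeriv (g : ℝ → ℝ) (s : ℝ) : ℝ :=
  oscCosDeriv s * (∫ σ in Ioi s, oscSin σ * g σ) - oscSinDeriv s * ∫ σ in Ioi s, oscCos σ * g σ

section OscSolve

variable {g g₁ g₂ b : ℝ → ℝ} {δ s₀ s : ℝ}

lemma integrableOn_osc_majorant (hs : 0 < s) :
    IntegrableOn (fun σ : ℝ => δ * σ ^ (-(11 / 4) : ℝ)) (Ioi s) :=
  (integrableOn_Ioi_rpow_of_lt (by norm_num) hs).const_mul δ

lemma abs_osc_mul_le (hb : ∀ σ, 0 < σ → |b σ| ≤ σ ^ (1 / 4 : ℝ)) {σ : ℝ} (hσ : 0 < σ)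
    (hg : |g σ| ≤ δ * σ ^ (-3 : ℝ)) : ‖b σ * g σ‖ ≤ δ * σ ^ (-(11 / 4) : ℝ) := by
  have h1 : σ ^ (-(11 / 4) : ℝ) = σ ^ (1 / 4 : ℝ) * σ ^ (-3 : ℝ) := by
    rw [← Real.rpow_add hσ]; norm_num
  rw [Real.norm_eq_abs, abs_mul, h1, mul_left_comm]
  exact mul_le_mul (hb σ hσ) hg (abs_nonneg _) (Real.rpow_nonneg hσ.le _)

lemma abs_osc_integral_le (hb : ∀ σ, 0 < σ → |b σ| ≤ σ ^ (1 / 4 : ℝ)) (hs : 0 < s) (hδ : 0 ≤ δ)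
    (hg : ∀ σ, s < σ → |g σ| ≤ δ * σ ^ (-3 : ℝ)) :
    |∫ σ in Ioi s, b σ * g σ| ≤ δ * s ^ (-(7 / 4) : ℝ) := by
  have h := norm_integral_le_of_norm_le (μ := volume.restrict (Ioi s)) (f := fun σ => b σ * g σ)
    (integrableOn_osc_majorant (δ := δ) hs)
    ((ae_restrict_iff' measurableSet_Ioi).2 (Eventually.of_forall fun σ hσ =>
      abs_osc_mul_le hb (hs.trans hσ) (hg σ hσ)))
  rw [Real.norm_eq_abs, integral_const_mul, integral_Ioi_rpow_of_lt (by norm_num) hs] at h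
  refine h.trans (mul_le_mul_of_nonneg_left ?_ hδ)
  have h2 : (-(11 / 4) : ℝ) + 1 = -(7 / 4) := by norm_num
  rw [h2]
  have := Real.rpow_nonneg hs.le (-(7 / 4))
  rw [neg_div, div_neg, neg_neg, div_le_iff₀ (by norm_num)]
  linarith

lemma abs_oscSolve_le (hs : 0 < s) (hδ : 0 ≤ δ) (hg : ∀ σ, s < σ → |g σ| ≤ δ * σ ^ (-3 : ℝ)) :
    |oscSolve g s| ≤ 2 * δ * s ^ (-(3 / 2) : ℝ) := by
  have h1 := abs_osc_integral_le (b := oscSin) (fun σ hσ => abs_oscSin_le hσ) hs hδ hg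
  have h2 := abs_osc_integral_le (b := oscCos) (fun σ hσ => abs_oscCos_le hσ) hs hδ hg
  have h3 : s ^ (-(3 / 2) : ℝ) = s ^ (1 / 4 : ℝ) * s ^ (-(7 / 4) : ℝ) := by
    rw [← Real.rpow_add hs]; norm_num
  have hq := Real.rpow_nonneg hs.le (1 / 4)
  calc |oscSolve g s| ≤ |oscCos s| * |∫ σ in Ioi s, oscSin σ * g σ|
        + |oscSin s| * |∫ σ in Ioi s, oscCos σ * g σ| := by
        rw [oscSolve, ← abs_mul, ← abs_mul]; exact abs_sub _ _
    _ ≤ s ^ (1 / 4 : ℝ) * (δ * s ^ (-(7 / 4) : ℝ)) + s ^ (1 / 4 : ℝ) * (δ * s ^ (-(7 / 4) : ℝ)) :=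
        add_le_add (mul_le_mul (abs_oscCos_le hs) h1 (abs_nonneg _) hq)
          (mul_le_mul (abs_oscSin_le hs) h2 (abs_nonneg _) hq)
    _ = 2 * δ * s ^ (-(3 / 2) : ℝ) := by rw [h3]; ring

lemma continuousOn_osc_mul (hb : ∀ σ, 0 < σ → ContinuousAt b σ) (hs₀ : 0 < s₀)
    (hg : ContinuousOn g (Ioi s₀)) : ContinuousOn (fun σ => b σ * g σ) (Ioi s₀) :=
  ContinuousOn.mul (fun σ hσ => (hb σ (hs₀.trans hσ)).continuousWithinAt) hg

lemma integrableOn_osc_mul (hb : ∀ σ, 0 < σ → ContinuousAt b σ)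
    (hb' : ∀ σ, 0 < σ → |b σ| ≤ σ ^ (1 / 4 : ℝ)) (hs₀ : 0 < s₀)
    (hg : ContinuousOn g (Ioi s₀)) (hgδ : ∀ σ, s₀ < σ → |g σ| ≤ δ * σ ^ (-3 : ℝ)) :
    IntegrableOn (fun σ => b σ * g σ) (Ioi s₀) := by
  refine Integrable.mono' (integrableOn_osc_majorant (δ := δ) hs₀)
    ((continuousOn_osc_mul hb hs₀ hg).aestronglyMeasurable measurableSet_Ioi) ?_
  exact (ae_restrict_iff' measurableSet_Ioi).2 (Eventually.of_forall fun σ hσ =>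
    abs_osc_mul_le hb' (hs₀.trans hσ) (hgδ σ hσ))

lemma hasDerivAt_integral_Ioi {k : ℝ → ℝ} (hk : ContinuousOn k (Ioi s₀))
    (hki : IntegrableOn k (Ioi s₀)) (hs : s₀ < s) :
    HasDerivAt (fun s => ∫ σ in Ioi s, k σ) (-k s) s := by
  obtain ⟨a, ha, has⟩ := exists_between hs
  have h1 : HasDerivAt (fun s => ∫ σ in a..s, k σ) (k s) s := by
    refine intervalIntegral.integral_hasDerivAt_right ?_ ?_ (hk.continuousAt (Ioi_mem_nhds hs))
    · refine (hki.mono_set fun x hx => ?_).intervalIntegrable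
      rw [uIcc_of_le has.le] at hx
      exact ha.trans_le hx.1
    · exact ContinuousOn.stronglyMeasurableAtFilter isOpen_Ioi hk s hs
  refine (h1.const_sub (∫ σ in Ioi a, k σ)).congr_of_eventuallyEq ?_
  filter_upwards [lt_mem_nhds has] with x hx
  rw [← intervalIntegral.integral_Ioi_sub_Ioi (hki.mono_set (Ioi_subset_Ioi ha.le)) hx.le]
  ring

lemma hasDerivAt_osc_integrals (hs₀ : 0 < s₀) (hg : ContinuousOn g (Ioi s₀))
    (hgδ : ∀ σ, s₀ < σ → |g σ| ≤ δ * σ ^ (-3 : ℝ)) (hs : s₀ < s) :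
    HasDerivAt (fun s => ∫ σ in Ioi s, oscSin σ * g σ) (-(oscSin s * g s)) s ∧
    HasDerivAt (fun s => ∫ σ in Ioi s, oscCos σ * g σ) (-(oscCos s * g s)) s := by
  have h1 : ∀ σ, 0 < σ → ContinuousAt oscSin σ := fun σ hσ => (hasDerivAt_oscSin hσ).continuousAt
  have h2 : ∀ σ, 0 < σ → ContinuousAt oscCos σ := fun σ hσ => (hasDerivAt_oscCos hσ).continuousAt
  exact ⟨hasDerivAt_integral_Ioi (continuousOn_osc_mul h1 hs₀ hg)
      (integrableOn_osc_mul h1 (fun σ hσ => abs_oscSin_le hσ) hs₀ hg hgδ) hs,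
    hasDerivAt_integral_Ioi (continuousOn_osc_mul h2 hs₀ hg)
      (integrableOn_osc_mul h2 (fun σ hσ => abs_oscCos_le hσ) hs₀ hg hgδ) hs⟩

lemma hasDerivAt_oscSolve (hs₀ : 0 < s₀) (hg : ContinuousOn g (Ioi s₀))
    (hgδ : ∀ σ, s₀ < σ → |g σ| ≤ δ * σ ^ (-3 : ℝ)) (hs : s₀ < s) :
    HasDerivAt (oscSolve g) (oscSolveDeriv g s) s := by
  obtain ⟨h1, h2⟩ := hasDerivAt_osc_integrals hs₀ hg hgδ hs
  have hs' := hs₀.trans hs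
  refine (((hasDerivAt_oscCos hs').mul h1).sub ((hasDerivAt_oscSin hs').mul h2)).congr_deriv ?_
  simp only [oscSolveDeriv]
  ring

lemma hasDerivAt_oscSolveDeriv (hs₀ : 0 < s₀) (hg : ContinuousOn g (Ioi s₀))
    (hgδ : ∀ σ, s₀ < σ → |g σ| ≤ δ * σ ^ (-3 : ℝ)) (hs : s₀ < s) :
    HasDerivAt (oscSolveDeriv g) (-(1 / s + 3 / (16 * s ^ 2)) * oscSolve g s + g s) s := by
  obtain ⟨h1, h2⟩ := hasDerivAt_osc_integrals hs₀ hg hgδ hs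
  have hs' := hs₀.trans hs
  refine (((hasDerivAt_oscCosDeriv hs').mul h1).sub
    ((hasDerivAt_oscSinDeriv hs').mul h2)).congr_deriv ?_
  have := congrArg (· * g s) (osc_wronskian hs')
  simp only [oscSolve] at *
  linarith

lemma oscSolve_sub (hs₀ : 0 < s₀) (hg₁ : ContinuousOn g₁ (Ioi s₀)) (hg₂ : ContinuousOn g₂ (Ioi s₀))
    (h₁ : ∀ σ, s₀ < σ → |g₁ σ| ≤ δ * σ ^ (-3 : ℝ))
    (h₂ : ∀ σ, s₀ < σ → |g₂ σ| ≤ δ * σ ^ (-3 : ℝ)) (hs : s₀ < s) :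
    oscSolve g₁ s - oscSolve g₂ s = oscSolve (fun σ => g₁ σ - g₂ σ) s := by
  have c1 : ∀ σ, 0 < σ → ContinuousAt oscSin σ := fun σ hσ => (hasDerivAt_oscSin hσ).continuousAt
  have c2 : ∀ σ, 0 < σ → ContinuousAt oscCos σ := fun σ hσ => (hasDerivAt_oscCos hσ).continuousAt
  have key : ∀ {b : ℝ → ℝ}, (∀ σ, 0 < σ → ContinuousAt b σ) →
      (∀ σ, 0 < σ → |b σ| ≤ σ ^ (1 / 4 : ℝ)) →
      ∫ σ in Ioi s, b σ * (g₁ σ - g₂ σ) =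
        (∫ σ in Ioi s, b σ * g₁ σ) - ∫ σ in Ioi s, b σ * g₂ σ := fun hb hb' => by
    simp only [mul_sub]
    exact integral_sub
      ((integrableOn_osc_mul hb hb' hs₀ hg₁ h₁).mono_set (Ioi_subset_Ioi hs.le))
      ((integrableOn_osc_mul hb hb' hs₀ hg₂ h₂).mono_set (Ioi_subset_Ioi hs.le))
  simp only [oscSolve]
  rw [key c1 (fun σ hσ => abs_oscSin_le hσ), key c2 (fun σ hσ => abs_oscCos_le hσ)]
  ring

end OscSolve

/-- A decaying solution of `z'' + (1/s + 3/(16 s²)) z = N(s, s^{3/2} z)`, by the contraction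
principle for `s^{3/2} z`, if `N(s, 0)` and the Lipschitz constant of `N(s, ·)` are at most
`s^{-3} / 8`. -/
lemma exists_decaying_solution {N : ℝ → ℝ → ℝ} {s₀ : ℝ} (hs₀ : 0 < s₀)
    (hNc : ContinuousOn (fun q : ℝ × ℝ => N q.1 q.2) (Ioi s₀ ×ˢ univ))
    (hN0 : ∀ s, s₀ < s → |N s 0| ≤ 1 / 8 * s ^ (-3 : ℝ))
    (hNL : ∀ s, s₀ < s → ∀ e₁ ∈ Icc (-1 : ℝ) 1, ∀ e₂ ∈ Icc (-1 : ℝ) 1,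
      |N s e₁ - N s e₂| ≤ 1 / 8 * s ^ (-3 : ℝ) * |e₁ - e₂|) :
    ∃ z z' : ℝ → ℝ, ∀ s, s₀ + 1 < s → |z s| ≤ s ^ (-(3 / 2) : ℝ) ∧ HasDerivAt z (z' s) s ∧
      HasDerivAt z' (-(1 / s + 3 / (16 * s ^ 2)) * z s + N s (s ^ (3 / 2 : ℝ) * z s)) s := by
  -- Truncation at `1` makes the source globally Lipschitz; it is inactive at the fixed point.
  let G : BoundedContinuousFunction ℝ ℝ → ℝ → ℝ := fun ζ σ => N σ (clamp 1 (ζ σ))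
  have hcl : ∀ x, clamp 1 x ∈ Icc (-1 : ℝ) 1 := clamp_mem zero_le_one
  have hGc : ∀ ζ, ContinuousOn (G ζ) (Ioi s₀) := fun ζ =>
    hNc.comp (f := fun σ => (σ, clamp 1 (ζ σ)))
      (continuous_id.prodMk ((continuous_clamp 1).comp ζ.continuous)).continuousOn
      fun σ hσ => ⟨hσ, trivial⟩
  have hGb : ∀ ζ σ, s₀ < σ → |G ζ σ| ≤ 1 / 4 * σ ^ (-3 : ℝ) := fun ζ σ hσ => by
    have h1 := hNL σ hσ _ (hcl (ζ σ)) 0 (by norm_num)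
    have h2 := hN0 σ hσ
    have h3 : |clamp 1 (ζ σ) - 0| ≤ 1 := by rw [sub_zero]; exact abs_clamp_le zero_le_one _
    have h4 : 0 ≤ σ ^ (-3 : ℝ) := Real.rpow_nonneg (hs₀.trans hσ).le _
    have h5 : |N σ (clamp 1 (ζ σ))| ≤ |N σ (clamp 1 (ζ σ)) - N σ 0| + |N σ 0| := by
      have := abs_add_le (N σ (clamp 1 (ζ σ)) - N σ 0) (N σ 0)
      rwa [sub_add_cancel] at this
    have h6 := mul_le_mul_of_nonneg_left h3 (show 0 ≤ 1 / 8 * σ ^ (-3 : ℝ) by positivity)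
    simp only [G]
    linarith
  have hGd : ∀ ζ₁ ζ₂ σ, s₀ < σ →
      |G ζ₁ σ - G ζ₂ σ| ≤ 1 / 8 * dist ζ₁ ζ₂ * σ ^ (-3 : ℝ) := fun ζ₁ ζ₂ σ hσ => by
    refine (hNL σ hσ _ (hcl (ζ₁ σ)) _ (hcl (ζ₂ σ))).trans ?_
    have h4 : 0 ≤ σ ^ (-3 : ℝ) := Real.rpow_nonneg (hs₀.trans hσ).le _
    have h5 : |clamp 1 (ζ₁ σ) - clamp 1 (ζ₂ σ)| ≤ dist ζ₁ ζ₂ :=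
      (abs_clamp_sub_le 1 _ _).trans (by
        rw [← Real.dist_eq]; exact BoundedContinuousFunction.dist_coe_le_dist σ)
    have := mul_le_mul_of_nonneg_left h5 (show 0 ≤ 1 / 8 * σ ^ (-3 : ℝ) by positivity)
    linarith
  have hτ : ∀ s : ℝ, s₀ < max s (s₀ + 1) := fun s => (lt_add_one s₀).trans_le (le_max_right _ _)
  have hweight : ∀ {s δ : ℝ}, 0 < s → s ^ (3 / 2 : ℝ) * (2 * δ * s ^ (-(3 / 2) : ℝ)) = 2 * δ := by
    intro s δ hs
    rw [mul_left_comm, ← Real.rpow_add hs]; norm_num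
  let Tf : BoundedContinuousFunction ℝ ℝ → ℝ → ℝ := fun ζ s =>
    max s (s₀ + 1) ^ (3 / 2 : ℝ) * oscSolve (G ζ) (max s (s₀ + 1))
  have hTb : ∀ ζ s, ‖Tf ζ s‖ ≤ 1 / 2 := fun ζ s => by
    have h0 : 0 < max s (s₀ + 1) := hs₀.trans (hτ s)
    have h1 := abs_oscSolve_le h0 (by norm_num) (fun σ hσ => hGb ζ σ ((hτ s).trans hσ))
    have h2 := Real.rpow_nonneg h0.le (3 / 2)
    rw [Real.norm_eq_abs, abs_mul, abs_of_nonneg h2]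
    refine (mul_le_mul_of_nonneg_left h1 h2).trans ?_
    rw [hweight h0]; norm_num
  have hTc : ∀ ζ, Continuous (Tf ζ) := fun ζ => by
    refine continuous_iff_continuousAt.2 fun s => ?_
    have hm : ContinuousAt (fun s : ℝ => max s (s₀ + 1)) s := by fun_prop
    have h0 : max s (s₀ + 1) ≠ 0 := (hs₀.trans (hτ s)).ne'
    have h1 : ContinuousAt (fun s : ℝ => max s (s₀ + 1) ^ (3 / 2 : ℝ)) s :=
      hm.rpow_const (Or.inl h0)
    have h2 : ContinuousAt (oscSolve (G ζ)) (max s (s₀ + 1)) :=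
      (hasDerivAt_oscSolve hs₀ (hGc ζ) (hGb ζ) (hτ s)).continuousAt
    exact h1.mul (ContinuousAt.comp (f := fun s : ℝ => max s (s₀ + 1)) h2 hm)
  let T : BoundedContinuousFunction ℝ ℝ → BoundedContinuousFunction ℝ ℝ := fun ζ =>
    BoundedContinuousFunction.ofNormedAddCommGroup (Tf ζ) (hTc ζ) (1 / 2) (hTb ζ)
  have hT : ContractingWith (1 / 2) T := by
    refine ⟨by rw [← NNReal.coe_lt_coe]; norm_num, LipschitzWith.of_dist_le_mul fun ζ₁ ζ₂ => ?_⟩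
    rw [BoundedContinuousFunction.dist_le (by positivity)]
    intro s
    change dist (Tf ζ₁ s) (Tf ζ₂ s) ≤ _
    have h0 : 0 < max s (s₀ + 1) := hs₀.trans (hτ s)
    have h2 := Real.rpow_nonneg h0.le (3 / 2)
    rw [Real.dist_eq]
    simp only [Tf]
    rw [← mul_sub, oscSolve_sub hs₀ (hGc ζ₁) (hGc ζ₂) (hGb ζ₁) (hGb ζ₂) (hτ s), abs_mul,
      abs_of_nonneg h2]
    have h1 := abs_oscSolve_le h0 (by positivity : 0 ≤ 1 / 8 * dist ζ₁ ζ₂)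
      (fun σ hσ => hGd ζ₁ ζ₂ σ ((hτ s).trans hσ))
    refine (mul_le_mul_of_nonneg_left h1 h2).trans ?_
    rw [hweight h0]
    have := dist_nonneg (x := ζ₁) (y := ζ₂)
    push_cast
    linarith
  set ζ := hT.fixedPoint T with hζ
  have hfix : T ζ = ζ := hT.fixedPoint_isFixedPt
  have hval : ∀ s, s₀ + 1 < s → ζ s = s ^ (3 / 2 : ℝ) * oscSolve (G ζ) s := fun s hs => by
    have : ζ s = Tf ζ s := by
      conv_lhs => rw [← hfix]
      rfl
    rw [this]
    simp only [Tf, max_eq_left hs.le]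
  have hζ1 : ∀ s, ζ s ∈ Icc (-1 : ℝ) 1 := fun s => by
    have : ζ s = Tf ζ s := by
      conv_lhs => rw [← hfix]
      rfl
    have h := hTb ζ s
    rw [← this] at h
    exact abs_le.1 (h.trans (by norm_num))
  refine ⟨oscSolve (G ζ), oscSolveDeriv (G ζ), fun s hs => ?_⟩
  have hs' : s₀ < s := (lt_add_one s₀).trans hs
  have hs0 : 0 < s := hs₀.trans hs'
  refine ⟨?_, hasDerivAt_oscSolve hs₀ (hGc ζ) (hGb ζ) hs', ?_⟩
  · have h1 := abs_oscSolve_le hs0 (by norm_num) (fun σ hσ => hGb ζ σ (hs'.trans hσ))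
    have := Real.rpow_nonneg hs0.le (-(3 / 2))
    linarith
  · have h1 := hasDerivAt_oscSolveDeriv hs₀ (hGc ζ) (hGb ζ) hs'
    have h2 : G ζ s = N s (s ^ (3 / 2 : ℝ) * oscSolve (G ζ) s) := by
      rw [← hval s hs]
      simp only [G]
      rw [clamp_of_mem (hζ1 s)]
    rwa [h2] at h1

/-! ### The approximate singular solution

In the variable `s = -log r` the equation reads `y'' = -e^{-2s} y (e^{y²} - 1)`. -/

/-- The right-hand side `e^{-2s} y (e^{y²} - 1)` of the equation in the variable `s = -log r`. -/
def emdenForce (s y : ℝ) : ℝ := Real.exp (-2 * s) * (y * (Real.exp (y ^ 2) - 1))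

/-- The correction `Y² - 2s` of the approximate solution `Y`: two terms of its expansion, so that
the residual is `o(s^{-3})`. -/
def approxCorr (s : ℝ) : ℝ := -2 * Real.log (2 * s) + (2 * Real.log (2 * s) - 4) / s

/-- The derivative of `approxCorr`. -/
def approxCorrDeriv (s : ℝ) : ℝ := -2 / s + (6 - 2 * Real.log (2 * s)) / s ^ 2

/-- The second derivative of `approxCorr`. -/
def approxCorrDeriv2 (s : ℝ) : ℝ := 2 / s ^ 2 + (4 * Real.log (2 * s) - 14) / s ^ 3

/-- The approximate singular solution in the variable `s = -log r`. -/
def approxSol (s : ℝ) : ℝ := √(2 * s + approxCorr s)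

/-- The derivative of `approxSol`. -/
def approxSolDeriv (s : ℝ) : ℝ := (2 + approxCorrDeriv s) / (2 * approxSol s)

/-- The second derivative of `approxSol`. -/
def approxSolDeriv2 (s : ℝ) : ℝ :=
  approxCorrDeriv2 s / (2 * approxSol s) - (2 + approxCorrDeriv s) ^ 2 / (4 * approxSol s ^ 3)

lemma hasDerivAt_log_two_mul {s : ℝ} (hs : 0 < s) :
    HasDerivAt (fun s => Real.log (2 * s)) (1 / s) s := by
  refine (((hasDerivAt_id s).const_mul 2).log (by simp; exact hs.ne')).congr_deriv ?_
  simp only [id]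
  field_simp

lemma hasDerivAt_approxCorr {s : ℝ} (hs : 0 < s) :
    HasDerivAt approxCorr (approxCorrDeriv s) s := by
  have h := hasDerivAt_log_two_mul hs
  refine ((h.const_mul (-2)).add
    (((h.const_mul 2).sub_const 4).div (hasDerivAt_id s) hs.ne')).congr_deriv ?_
  simp only [approxCorrDeriv, id]
  field_simp
  ring

lemma hasDerivAt_approxCorrDeriv {s : ℝ} (hs : 0 < s) :
    HasDerivAt approxCorrDeriv (approxCorrDeriv2 s) s := by
  have h := hasDerivAt_log_two_mul hs
  refine (((hasDerivAt_const s (-2 : ℝ)).div (hasDerivAt_id s) hs.ne').add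
    (((h.const_mul 2).const_sub 6).div (hasDerivAt_pow 2 s) (by positivity))).congr_deriv ?_
  simp only [approxCorrDeriv2, id]
  field_simp
  ring

lemma hasDerivAt_approxSol {s : ℝ} (hs : 0 < s) (hQ : 0 < 2 * s + approxCorr s) :
    HasDerivAt approxSol (approxSolDeriv s) s := by
  refine ((((hasDerivAt_id s).const_mul 2).add (hasDerivAt_approxCorr hs)).sqrt
    hQ.ne').congr_deriv ?_
  simp [approxSolDeriv, approxSol]

lemma hasDerivAt_approxSolDeriv {s : ℝ} (hs : 0 < s) (hQ : 0 < 2 * s + approxCorr s) :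
    HasDerivAt approxSolDeriv (approxSolDeriv2 s) s := by
  have hY : 0 < approxSol s := Real.sqrt_pos.2 hQ
  refine (((hasDerivAt_approxCorrDeriv hs).const_add 2).div
    ((hasDerivAt_approxSol hs hQ).const_mul 2) (by positivity)).congr_deriv ?_
  simp only [approxSolDeriv2, approxSolDeriv]
  field_simp
  ring

lemma hasDerivAt_emdenForce (s y : ℝ) :
    HasDerivAt (emdenForce s)
      (Real.exp (-2 * s) * (Real.exp (y ^ 2) - 1 + y * (Real.exp (y ^ 2) * (2 * y)))) y := by
  have h := (((hasDerivAt_id y).mul (((hasDerivAt_pow 2 y).exp).sub_const 1)).const_mul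
    (Real.exp (-2 * s)))
  refine h.congr_deriv ?_
  simp

/-- The range of `s` in which the asymptotic estimates are valid, in terms of `q = s^{1/8}`. -/
structure IsLargeRadius (s q : ℝ) : Prop where
  eq_pow : s = q ^ 8
  ge : 100 ≤ q
  log_nonneg : 0 ≤ Real.log (2 * s)
  log_le : 2 * Real.log (2 * s) + 8 ≤ q
  exp_le : Real.exp (-2 * s) ≤ (q ^ 32)⁻¹

lemma eventually_isLargeRadius : ∀ᶠ s : ℝ in atTop, IsLargeRadius s (s ^ (1 / 8 : ℝ)) := by
  have h1 : ∀ᶠ s : ℝ in atTop, 100 ≤ s ^ (1 / 8 : ℝ) :=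
    (tendsto_rpow_atTop (by norm_num)).eventually_ge_atTop 100
  have h2 : ∀ᶠ s : ℝ in atTop, ‖Real.log s‖ ≤ 1 / 4 * ‖s ^ (1 / 8 : ℝ)‖ :=
    (isLittleO_log_rpow_atTop (by norm_num)).def (by norm_num)
  have h3 : ∀ᶠ s : ℝ in atTop, ‖Real.exp (-2 * s)‖ ≤ 1 * ‖s ^ (-4 : ℝ)‖ :=
    (isLittleO_exp_neg_mul_rpow_atTop (by norm_num) (-4)).def one_pos
  filter_upwards [h1, h2, h3, eventually_ge_atTop 1] with s h1 h2 h3 hs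
  have hs0 : 0 < s := by linarith
  have hq8 : (s ^ (1 / 8 : ℝ)) ^ 8 = s := by
    rw [← Real.rpow_natCast, ← Real.rpow_mul hs0.le]; norm_num
  rw [Real.norm_eq_abs, Real.norm_eq_abs, abs_of_nonneg (Real.log_nonneg hs),
    abs_of_nonneg (Real.rpow_nonneg hs0.le _)] at h2
  refine ⟨hq8.symm, h1, Real.log_nonneg (by linarith), ?_, ?_⟩
  · rw [Real.log_mul (by norm_num) hs0.ne']
    have := Real.log_two_lt_d9
    linarith
  · rw [one_mul, Real.norm_eq_abs, Real.norm_eq_abs, abs_of_pos (Real.exp_pos _),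
      abs_of_nonneg (Real.rpow_nonneg hs0.le _)] at h3
    refine h3.trans (le_of_eq ?_)
    have : (s ^ (1 / 8 : ℝ)) ^ 32 = s ^ 4 := by
      conv_rhs => rw [← hq8]
      ring
    rw [this, Real.rpow_neg hs0.le]
    norm_cast

namespace IsLargeRadius

variable {s q : ℝ}

lemma pos (h : IsLargeRadius s q) : 0 < s := by
  have := h.ge
  rw [h.eq_pow]; positivity

lemma one_le (h : IsLargeRadius s q) : 1 ≤ s := by
  rw [h.eq_pow]; exact one_le_pow₀ (by linarith [h.ge])

/-- The size of all relative corrections. -/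
lemma theta_le (h : IsLargeRadius s q) :
    (2 * Real.log (2 * s) + 8) / s ≤ (q ^ 7)⁻¹ := by
  have hq := h.ge
  rw [div_le_iff₀ h.pos, h.eq_pow]
  have : (q ^ 7)⁻¹ * q ^ 8 = q := by field_simp
  rw [this, ← h.eq_pow]
  exact h.log_le

lemma theta_le_quarter (h : IsLargeRadius s q) :
    (2 * Real.log (2 * s) + 8) / s ≤ 1 / 4 := by
  refine h.theta_le.trans ?_
  rw [one_div]
  refine inv_anti₀ (by norm_num) ?_
  have : q ^ 1 ≤ q ^ 7 := pow_le_pow_right₀ (by linarith [h.ge]) (by norm_num)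
  linarith [h.ge]

end IsLargeRadius

/-- Bounds for the corrections in terms of `θ = (2 log(2s) + 8)/s`. -/
lemma approx_bounds {s θ : ℝ} (hs : 1 ≤ s) (hℓ : 0 ≤ Real.log (2 * s))
    (hθ : θ = (2 * Real.log (2 * s) + 8) / s) (hθ4 : θ ≤ 1 / 4) :
    |(2 * Real.log (2 * s) - 4) / s| ≤ θ ∧ |approxCorr s / (2 * s)| ≤ θ ∧
    |approxCorrDeriv s / 2| ≤ θ := by
  have hs0 : 0 < s := by linarith
  have hp : |(2 * Real.log (2 * s) - 4) / s| ≤ θ := by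
    rw [abs_div, abs_of_pos hs0, hθ]
    refine div_le_div_of_nonneg_right (abs_le.2 ⟨?_, ?_⟩) hs0.le <;> linarith
  have hp' := abs_le.1 hp
  refine ⟨hp, ?_, ?_⟩
  · rw [abs_div, abs_of_pos (show 0 < 2 * s by linarith), div_le_iff₀ (by linarith)]
    have h1 : θ * (2 * s) = 2 * (2 * Real.log (2 * s) + 8) := by rw [hθ]; field_simp
    rw [h1, approxCorr, abs_le]
    constructor <;> linarith
  · have h1 : approxCorrDeriv s / 2 = (-1 + (3 - Real.log (2 * s)) / s) / s := by
      simp only [approxCorrDeriv]; field_simp; ring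
    rw [h1, hθ, abs_div, abs_of_pos hs0]
    refine div_le_div_of_nonneg_right ?_ hs0.le
    have h2 : |(3 - Real.log (2 * s)) / s| ≤ 3 + Real.log (2 * s) := by
      rw [abs_div, abs_of_pos hs0, div_le_iff₀ hs0]
      have h3 : |3 - Real.log (2 * s)| ≤ 3 + Real.log (2 * s) := abs_le.2 ⟨by linarith, by linarith⟩
      have h4 : (3 + Real.log (2 * s)) * 1 ≤ (3 + Real.log (2 * s)) * s :=
        mul_le_mul_of_nonneg_left hs (by linarith)
      linarith
    rw [abs_le] at h2 ⊢
    constructor <;> linarith [h2.1, h2.2]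

/-- The residual of the approximate solution, up to the factor `2 Y`. -/
lemma abs_residual_le {s θ : ℝ} (hs : 1 ≤ s) (hℓ : 0 ≤ Real.log (2 * s))
    (hθ : θ = (2 * Real.log (2 * s) + 8) / s) (hθ4 : θ ≤ 1 / 4) :
    |approxCorrDeriv2 s - (2 + approxCorrDeriv s) ^ 2 / (2 * (2 * s + approxCorr s))
      + 2 * (2 * s + approxCorr s) * (Real.exp (approxCorr s) - Real.exp (-2 * s))|
      ≤ 15 * θ ^ 2 / s + 8 * s * Real.exp (-2 * s) := by
  have hs0 : 0 < s := by linarith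
  obtain ⟨hp, hw, ha⟩ := approx_bounds hs hℓ hθ hθ4
  set ℓ := Real.log (2 * s) with hℓdef
  set p := (2 * ℓ - 4) / s with hpdef
  set w := approxCorr s / (2 * s) with hwdef
  set a := approxCorrDeriv s / 2 with hadef
  have hθ0 : 0 ≤ θ := (abs_nonneg _).trans hp
  have hQ : 2 * s + approxCorr s = 2 * s * (1 + w) := by rw [hwdef]; field_simp
  have hw' := abs_le.1 hw
  have h1w : 0 < 1 + w := by linarith
  have hexpQ : Real.exp (approxCorr s) = Real.exp p / (4 * s ^ 2) := by
    have : approxCorr s = p - (ℓ + ℓ) := by simp only [approxCorr, hpdef, hℓdef]; ring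
    rw [this, Real.exp_sub, Real.exp_add, hℓdef, Real.exp_log (by linarith)]
    congr 1; ring
  set e₁ := Real.exp p - 1 - p with he₁
  have he₁b : |e₁| ≤ θ ^ 2 := by
    have h1 := Real.abs_exp_sub_one_sub_id_le (show |p| ≤ 1 by linarith)
    refine h1.trans ?_
    rw [← sq_abs]
    exact pow_le_pow_left₀ (abs_nonneg _) hp 2
  set e₂ := w ^ 2 / (1 + w) with he₂
  have hwsq : w ^ 2 ≤ θ ^ 2 := by rw [← sq_abs]; exact pow_le_pow_left₀ (abs_nonneg _) hw 2
  have hasq : a ^ 2 ≤ θ ^ 2 := by rw [← sq_abs]; exact pow_le_pow_left₀ (abs_nonneg _) ha 2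
  have he₂b : |e₂| ≤ 2 * θ ^ 2 := by
    rw [he₂, abs_div, abs_of_pos h1w, abs_of_nonneg (sq_nonneg w), div_le_iff₀ h1w]
    nlinarith [sq_nonneg θ]
  have hlin : 2 * w + p - 2 * a + 2 / s = p / s - (6 - 2 * ℓ) / s ^ 2 := by
    rw [hwdef, hadef, approxCorr, approxCorrDeriv, hpdef, ← hℓdef]
    field_simp
    ring
  have hsθ : 1 / s ≤ θ := by
    rw [hθ]; exact div_le_div_of_nonneg_right (by linarith) hs0.le
  have hlinb : |p / s - (6 - 2 * ℓ) / s ^ 2| ≤ 2 * θ ^ 2 := by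
    have h1 : |p / s| ≤ θ ^ 2 := by
      rw [abs_div, abs_of_pos hs0, div_eq_mul_one_div, sq]
      exact mul_le_mul hp hsθ (by positivity) hθ0
    have h2 : |(6 - 2 * ℓ) / s ^ 2| ≤ θ ^ 2 := by
      have h3 : |(6 - 2 * ℓ) / s| ≤ θ := by
        rw [abs_div, abs_of_pos hs0, hθ]
        exact div_le_div_of_nonneg_right (abs_le.2 ⟨by linarith, by linarith⟩) hs0.le
      have h4 : (6 - 2 * ℓ) / s ^ 2 = (6 - 2 * ℓ) / s * (1 / s) := by field_simp
      rw [h4, abs_mul, abs_of_pos (show 0 < 1 / s by positivity), sq]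
      exact mul_le_mul h3 hsθ (by positivity) hθ0
    have := abs_sub (p / s) ((6 - 2 * ℓ) / s ^ 2)
    linarith
  have hkey : approxCorrDeriv2 s - (2 + approxCorrDeriv s) ^ 2 / (2 * (2 * s + approxCorr s))
      + 2 * (2 * s + approxCorr s) * (Real.exp (approxCorr s) - Real.exp (-2 * s))
      = ((p / s - (6 - 2 * ℓ) / s ^ 2) + w * p + (1 + w) * e₁ - a ^ 2 + 2 * (a * w) + a ^ 2 * w
          - (1 + a) ^ 2 * e₂) / s
        + (4 * ℓ - 14) / s / s ^ 2 - 4 * s * (1 + w) * Real.exp (-2 * s) := by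
    have h2 : approxCorrDeriv s = 2 * a := by rw [hadef]; ring
    have h3 : Real.exp p = 1 + p + e₁ := by rw [he₁]; ring
    have h4 : approxCorrDeriv2 s = 2 / s ^ 2 + (4 * ℓ - 14) / s / s ^ 2 := by
      simp only [approxCorrDeriv2, ← hℓdef]
      field_simp
    rw [← hlin, hQ, hexpQ, h2, h3, h4, he₂]
    field_simp
    ring
  rw [hkey]
  have ha' := abs_le.1 ha
  have b1 : |w * p| ≤ θ ^ 2 := by
    rw [abs_mul, sq]; exact mul_le_mul hw hp (abs_nonneg _) hθ0
  have b2 : |(1 + w) * e₁| ≤ 2 * θ ^ 2 := by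
    rw [abs_mul, abs_of_pos h1w]
    exact mul_le_mul (by linarith) he₁b (abs_nonneg _) (by norm_num)
  have b3 : |a * w| ≤ θ ^ 2 := by
    rw [abs_mul, sq]; exact mul_le_mul ha hw (abs_nonneg _) hθ0
  have b4 : |a ^ 2 * w| ≤ θ ^ 2 := by
    rw [abs_mul, abs_of_nonneg (sq_nonneg a)]
    exact (mul_le_mul hasq (show |w| ≤ 1 by linarith) (abs_nonneg _) (sq_nonneg θ)).trans
      (by linarith)
  have b5 : |(1 + a) ^ 2 * e₂| ≤ 4 * θ ^ 2 := by
    rw [abs_mul, abs_of_nonneg (sq_nonneg _)]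
    have : (1 + a) ^ 2 ≤ 2 := by nlinarith
    exact (mul_le_mul this he₂b (abs_nonneg _) (by norm_num)).trans (by linarith)
  have b6 : |(4 * ℓ - 14) / s / s ^ 2| ≤ 2 * θ ^ 2 / s := by
    have h3 : |(4 * ℓ - 14) / s| ≤ 2 * θ := by
      rw [abs_div, abs_of_pos hs0, hθ, mul_div_assoc']
      exact div_le_div_of_nonneg_right (abs_le.2 ⟨by linarith, by linarith⟩) hs0.le
    have h4 : (4 * ℓ - 14) / s / s ^ 2 = (4 * ℓ - 14) / s * (1 / s) / s := by field_simp
    rw [h4, abs_div, abs_of_pos hs0, abs_mul, abs_of_pos (show 0 < 1 / s by positivity)]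
    refine div_le_div_of_nonneg_right ?_ hs0.le
    refine (mul_le_mul h3 hsθ (by positivity) (by positivity)).trans (by rw [sq]; linarith)
  have b7 : |4 * s * (1 + w) * Real.exp (-2 * s)| ≤ 8 * s * Real.exp (-2 * s) := by
    rw [abs_mul, abs_of_pos (Real.exp_pos _), abs_mul, abs_of_pos h1w,
      abs_of_pos (show 0 < 4 * s by positivity)]
    refine mul_le_mul_of_nonneg_right ?_ (Real.exp_pos _).le
    have := mul_le_mul_of_nonneg_left (show 1 + w ≤ 2 by linarith) (show 0 ≤ 4 * s by positivity)
    linarith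
  have b8 : |((p / s - (6 - 2 * ℓ) / s ^ 2) + w * p + (1 + w) * e₁ - a ^ 2 + 2 * (a * w)
      + a ^ 2 * w - (1 + a) ^ 2 * e₂) / s| ≤ 13 * θ ^ 2 / s := by
    rw [abs_div, abs_of_pos hs0]
    refine div_le_div_of_nonneg_right ?_ hs0.le
    have := sq_nonneg a
    have c0 := abs_le.1 hlinb
    have c1 := abs_le.1 b1
    have c2 := abs_le.1 b2
    have c3 := abs_le.1 b3
    have c4 := abs_le.1 b4
    have c5 := abs_le.1 b5
    clear_value e₁ e₂ a w p
    exact abs_le.2 ⟨by linarith, by linarith⟩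
  have hsum : 15 * θ ^ 2 / s = 13 * θ ^ 2 / s + 2 * θ ^ 2 / s := by ring
  rw [hsum]
  refine (abs_sub _ _).trans (add_le_add ((abs_add_le _ _).trans (add_le_add b8 b6)) b7)

/-- The linearization of the equation at functions close to the approximate solution. -/
lemma abs_linearization_le {s θ y : ℝ} (hs : 1 ≤ s) (hℓ : 0 ≤ Real.log (2 * s))
    (hθ : θ = (2 * Real.log (2 * s) + 8) / s) (hθ4 : θ ≤ 1 / 4)
    (hy : |y ^ 2 - (2 * s + approxCorr s)| ≤ 5 / s) :
    |1 / s - Real.exp (-2 * s) * (Real.exp (y ^ 2) - 1 + y * (Real.exp (y ^ 2) * (2 * y)))|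
      ≤ 12 * θ / s + Real.exp (-2 * s) := by
  have hs0 : 0 < s := by linarith
  obtain ⟨hp, -, -⟩ := approx_bounds hs hℓ hθ hθ4
  set ℓ := Real.log (2 * s) with hℓdef
  set p := (2 * ℓ - 4) / s with hpdef
  set d := y ^ 2 - (2 * s + approxCorr s) with hd
  have h5 : 5 / s ≤ θ := by
    rw [hθ]; exact div_le_div_of_nonneg_right (by linarith) hs0.le
  have hdθ : |d| ≤ θ := hy.trans h5
  have hθ0 : 0 ≤ θ := (abs_nonneg _).trans hp
  have hysq : y ^ 2 = 2 * s - 2 * ℓ + p + d := by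
    simp only [hd, approxCorr, ← hℓdef, hpdef]; ring
  have hexp : Real.exp (-2 * s) * Real.exp (y ^ 2) = Real.exp (p + d) / (4 * s ^ 2) := by
    have : -2 * s + y ^ 2 = p + d - (ℓ + ℓ) := by rw [hysq]; ring
    rw [← Real.exp_add, this, Real.exp_sub, Real.exp_add ℓ, hℓdef, Real.exp_log (by linarith)]
    congr 1; ring
  have hpd : |p + d| ≤ 2 * θ := (abs_add_le p d).trans (by linarith)
  have he : |Real.exp (p + d) - 1| ≤ 4 * θ := by
    have := Real.abs_exp_sub_one_le (show |p + d| ≤ 1 by linarith)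
    linarith
  set b := (1 - 4 * ℓ + 2 * p + 2 * d) / (4 * s) with hb
  have hbθ : |b| ≤ θ := by
    rw [hb, abs_div, abs_of_pos (show 0 < 4 * s by positivity), div_le_iff₀ (by positivity)]
    have h1 : θ * (4 * s) = 4 * (2 * ℓ + 8) := by rw [hθ]; field_simp
    have c1 := abs_le.1 hp
    have c2 := abs_le.1 hdθ
    rw [h1]
    exact abs_le.2 ⟨by linarith, by linarith⟩
  have hkey : 1 / s - Real.exp (-2 * s) *
      (Real.exp (y ^ 2) - 1 + y * (Real.exp (y ^ 2) * (2 * y)))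
      = -(((Real.exp (p + d) - 1) + b * Real.exp (p + d)) / s) + Real.exp (-2 * s) := by
    have h1 : Real.exp (-2 * s) * (Real.exp (y ^ 2) - 1 + y * (Real.exp (y ^ 2) * (2 * y)))
        = (Real.exp (-2 * s) * Real.exp (y ^ 2)) * (1 + 2 * y ^ 2) - Real.exp (-2 * s) := by ring
    rw [h1, hexp, hysq, hb]
    field_simp
    ring
  rw [hkey]
  have h2 : |(Real.exp (p + d) - 1) + b * Real.exp (p + d)| ≤ 12 * θ := by
    have h3 : |Real.exp (p + d)| ≤ 2 := by
      have c1 := abs_le.1 he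
      exact abs_le.2 ⟨by linarith, by linarith⟩
    have h4 : |b * Real.exp (p + d)| ≤ θ * 2 := by
      rw [abs_mul]; exact mul_le_mul hbθ h3 (abs_nonneg _) hθ0
    refine (abs_add_le _ _).trans (by linarith)
  refine (abs_add_le _ _).trans (add_le_add ?_ (abs_of_pos (Real.exp_pos _)).le)
  rw [abs_neg, abs_div, abs_of_pos hs0]
  exact div_le_div_of_nonneg_right h2 hs0.le

/-! ### Existence of the singular disk solution -/

namespace IsLargeRadius

variable {s q : ℝ}

lemma q_pos (h : IsLargeRadius s q) : 0 < q := by linarith [h.ge]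

lemma rpow_eq (h : IsLargeRadius s q) (a : ℝ) : s ^ a = q ^ (8 * a) := by
  rw [h.eq_pow, ← Real.rpow_natCast, ← Real.rpow_mul h.q_pos.le]
  norm_num

lemma rpow_neg_three (h : IsLargeRadius s q) : s ^ (-3 : ℝ) = (q ^ 24)⁻¹ := by
  rw [h.rpow_eq, ← Real.rpow_natCast, ← Real.rpow_neg h.q_pos.le]
  norm_num

lemma rpow_neg_three_halves (h : IsLargeRadius s q) : s ^ (-(3 / 2) : ℝ) = (q ^ 12)⁻¹ := by
  rw [h.rpow_eq, ← Real.rpow_natCast, ← Real.rpow_neg h.q_pos.le]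
  norm_num

lemma radicand_mem (h : IsLargeRadius s q) :
    3 / 2 * s ≤ 2 * s + approxCorr s ∧ 2 * s + approxCorr s ≤ 5 / 2 * s := by
  have hs := h.pos
  obtain ⟨-, hw, -⟩ := approx_bounds h.one_le h.log_nonneg rfl h.theta_le_quarter
  have hw' := abs_le.1 (hw.trans h.theta_le_quarter)
  rw [le_div_iff₀ (by linarith), div_le_iff₀ (by linarith)] at hw'
  constructor <;> linarith

lemma radicand_pos (h : IsLargeRadius s q) : 0 < 2 * s + approxCorr s := by
  have := h.pos
  linarith [h.radicand_mem.1]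

lemma approxSol_sq (h : IsLargeRadius s q) : approxSol s ^ 2 = 2 * s + approxCorr s :=
  Real.sq_sqrt h.radicand_pos.le

lemma approxSol_pos (h : IsLargeRadius s q) : 0 < approxSol s := Real.sqrt_pos.2 h.radicand_pos

lemma le_approxSol (h : IsLargeRadius s q) : q ^ 4 ≤ approxSol s := by
  refine Real.le_sqrt_of_sq_le ?_
  have h1 : (q ^ 4) ^ 2 = s := by rw [h.eq_pow]; ring
  rw [h1]
  linarith [h.radicand_mem.1, h.pos]

lemma approxSol_le (h : IsLargeRadius s q) : approxSol s ≤ 2 * q ^ 4 := by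
  have hq := h.q_pos
  rw [approxSol, Real.sqrt_le_left (by positivity)]
  have h1 : (2 * q ^ 4) ^ 2 = 4 * s := by rw [h.eq_pow]; ring
  rw [h1]
  linarith [h.radicand_mem.2, h.pos]

lemma inv_pow_le (h : IsLargeRadius s q) {c : ℝ} {n k : ℕ} (hk : c ≤ 100 ^ k) :
    c * (q ^ (n + k))⁻¹ ≤ (q ^ n)⁻¹ := by
  have hq := h.q_pos
  have h1 : (100 : ℝ) ^ k ≤ q ^ k := pow_le_pow_left₀ (by norm_num) h.ge k
  rw [pow_add, mul_inv, ← mul_assoc, mul_right_comm]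
  refine mul_le_of_le_one_left (by positivity) ?_
  rw [← div_eq_mul_inv, div_le_one (by positivity)]
  linarith

/-- The residual of the approximate solution is at most `s^{-3} / 8`. -/
lemma abs_approx_residual_le (h : IsLargeRadius s q) :
    |emdenForce s (approxSol s) + approxSolDeriv2 s| ≤ 1 / 8 * (q ^ 24)⁻¹ := by
  have hq := h.q_pos
  have hs := h.pos
  have hY := h.approxSol_pos
  have hres := abs_residual_le h.one_le h.log_nonneg rfl h.theta_le_quarter
  have hid : approxCorrDeriv2 s - (2 + approxCorrDeriv s) ^ 2 / (2 * (2 * s + approxCorr s))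
      + 2 * (2 * s + approxCorr s) * (Real.exp (approxCorr s) - Real.exp (-2 * s))
      = 2 * approxSol s * (emdenForce s (approxSol s) + approxSolDeriv2 s) := by
    have h1 : Real.exp (approxCorr s) = Real.exp (-2 * s) * Real.exp (approxSol s ^ 2) := by
      rw [← Real.exp_add, h.approxSol_sq]; congr 1; ring
    rw [h1, ← h.approxSol_sq, emdenForce, approxSolDeriv2]
    field_simp
    ring
  rw [hid, abs_mul, abs_of_pos (by positivity : 0 < 2 * approxSol s)] at hres
  set r := |emdenForce s (approxSol s) + approxSolDeriv2 s|
  have hr0 : 0 ≤ r := abs_nonneg _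
  have h2 : 2 * q ^ 4 * r ≤ 2 * approxSol s * r :=
    mul_le_mul_of_nonneg_right (by linarith [h.le_approxSol]) hr0
  have hθ0 : 0 ≤ (2 * Real.log (2 * s) + 8) / s :=
    div_nonneg (by linarith [h.log_nonneg]) hs.le
  have h3 : 15 * ((2 * Real.log (2 * s) + 8) / s) ^ 2 / s ≤ 15 * (q ^ 22)⁻¹ := by
    have := pow_le_pow_left₀ hθ0 h.theta_le 2
    rw [div_le_iff₀ hs]
    have h4 : 15 * (q ^ 22)⁻¹ * s = 15 * ((q ^ 7)⁻¹) ^ 2 := by rw [h.eq_pow]; field_simp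
    rw [h4]
    linarith
  have h5 : 8 * s * Real.exp (-2 * s) ≤ 8 * (q ^ 24)⁻¹ := by
    have := mul_le_mul_of_nonneg_left h.exp_le (show 0 ≤ 8 * s by positivity)
    refine this.trans (le_of_eq ?_)
    rw [h.eq_pow]; field_simp
  have h6 : 8 * (q ^ (22 + 2))⁻¹ ≤ (q ^ 22)⁻¹ := h.inv_pow_le (by norm_num)
  have h7 : 2 * q ^ 4 * r ≤ 16 * (q ^ 22)⁻¹ := by norm_num at h6; linarith
  have h8 : r ≤ 8 * (q ^ 26)⁻¹ := by
    have h9 : 16 * (q ^ 22)⁻¹ = 2 * q ^ 4 * (8 * (q ^ 26)⁻¹) := by field_simp; norm_num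
    rw [h9] at h7
    exact le_of_mul_le_mul_left h7 (by positivity)
  have h10 : 64 * (q ^ (24 + 2))⁻¹ ≤ (q ^ 24)⁻¹ := h.inv_pow_le (by norm_num)
  norm_num at h10
  linarith

/-- At distance `s^{-3/2}` from the approximate solution, the linearization of the equation has the
coefficient `1/s + 3/(16 s²)` up to `s^{-3/2} / 8`. -/
lemma abs_linear_perturbation_le (h : IsLargeRadius s q) {e : ℝ} (he : |e| ≤ 1) :
    |1 / s + 3 / (16 * s ^ 2) - Real.exp (-2 * s) *
      (Real.exp ((approxSol s + (q ^ 12)⁻¹ * e) ^ 2) - 1 + (approxSol s + (q ^ 12)⁻¹ * e) *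
        (Real.exp ((approxSol s + (q ^ 12)⁻¹ * e) ^ 2) * (2 * (approxSol s + (q ^ 12)⁻¹ * e))))|
      ≤ 1 / 8 * (q ^ 12)⁻¹ := by
  have hq := h.q_pos
  have hs := h.pos
  have hY := h.approxSol_pos
  set x := (q ^ 12)⁻¹ * e with hx
  have hxb : |x| ≤ (q ^ 12)⁻¹ := by
    rw [hx, abs_mul, abs_of_pos (by positivity : 0 < (q ^ 12)⁻¹)]
    exact mul_le_of_le_one_right (by positivity) he
  have hclose : |(approxSol s + x) ^ 2 - (2 * s + approxCorr s)| ≤ 5 / s := by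
    have h1 : (approxSol s + x) ^ 2 - (2 * s + approxCorr s) = 2 * approxSol s * x + x ^ 2 := by
      rw [← h.approxSol_sq]; ring
    have h2 : |2 * approxSol s * x| ≤ 4 * (q ^ 8)⁻¹ := by
      rw [abs_mul, abs_of_pos (by positivity : 0 < 2 * approxSol s)]
      have h3 : 4 * (q ^ 8)⁻¹ = 2 * (2 * q ^ 4) * (q ^ 12)⁻¹ := by field_simp; norm_num
      rw [h3]
      exact mul_le_mul (by linarith [h.approxSol_le]) hxb (abs_nonneg _) (by positivity)
    have h4 : |x ^ 2| ≤ (q ^ 8)⁻¹ := by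
      rw [abs_pow]
      refine (pow_le_pow_left₀ (abs_nonneg x) hxb 2).trans ?_
      have h10 : 1 * (q ^ (8 + 16))⁻¹ ≤ (q ^ 8)⁻¹ := h.inv_pow_le (by norm_num)
      rw [← inv_pow, ← pow_mul, inv_pow]
      norm_num at h10 ⊢
      exact h10
    have h5 : 5 / s = 5 * (q ^ 8)⁻¹ := by rw [h.eq_pow]; ring
    rw [h1, h5]
    refine (abs_add_le _ _).trans (by linarith)
  have hlin := abs_linearization_le h.one_le h.log_nonneg rfl h.theta_le_quarter hclose
  have h6 : 12 * ((2 * Real.log (2 * s) + 8) / s) / s ≤ 12 * (q ^ 15)⁻¹ := by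
    rw [div_le_iff₀ hs]
    have h4 : 12 * (q ^ 15)⁻¹ * s = 12 * (q ^ 7)⁻¹ := by rw [h.eq_pow]; field_simp
    rw [h4]
    linarith [h.theta_le]
  have h7 : |3 / (16 * s ^ 2)| ≤ (q ^ 16)⁻¹ := by
    rw [abs_of_pos (by positivity), h.eq_pow, ← pow_mul, div_le_iff₀ (by positivity)]
    norm_num
    field_simp
    norm_num
  have h8 : 1 * (q ^ (15 + 1))⁻¹ ≤ (q ^ 15)⁻¹ := h.inv_pow_le (by norm_num)
  have h9 : 1 * (q ^ (15 + 17))⁻¹ ≤ (q ^ 15)⁻¹ := h.inv_pow_le (by norm_num)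
  have h10 : 112 * (q ^ (12 + 3))⁻¹ ≤ (q ^ 12)⁻¹ := h.inv_pow_le (by norm_num)
  norm_num at h8 h9 h10
  have h11 := h.exp_le
  rw [add_sub_right_comm]
  refine (abs_add_le _ _).trans ?_
  linarith

end IsLargeRadius

/-- The singular solution in the variable `s = -log r`. -/
lemma exists_emden_solution : ∃ (s₁ C : ℝ) (y y' : ℝ → ℝ), 1 ≤ s₁ ∧ ∀ s, s₁ < s →
    0 < y s ∧ HasDerivAt y (y' s) s ∧ HasDerivAt y' (-emdenForce s (y s)) s ∧
    |y s - √(2 * s - 2 * Real.log s - 2 * Real.log 2)|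
      ≤ C * (s ^ (-(3 / 2) : ℝ) * Real.log s) := by
  obtain ⟨s₀, hs₀⟩ := eventually_atTop.1 eventually_isLargeRadius
  set s₁ := max s₀ 3 with hs₁
  have hs₁3 : 3 ≤ s₁ := le_max_right _ _
  have hs₁0 : 0 < s₁ := by linarith
  have hL : ∀ s, s₁ < s → IsLargeRadius s (s ^ (1 / 8 : ℝ)) := fun s hs =>
    hs₀ s ((le_max_left _ _).trans hs.le)
  -- The equation for `z` in `y = Y + z`, in terms of `e = s^{3/2} z`.
  let N : ℝ → ℝ → ℝ := fun s e => (1 / s + 3 / (16 * s ^ 2)) * (s ^ (-(3 / 2) : ℝ) * e)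
    - emdenForce s (approxSol s + s ^ (-(3 / 2) : ℝ) * e) - approxSolDeriv2 s
  have hYc : ContinuousOn approxSol (Ioi s₁) := fun s hs =>
    (hasDerivAt_approxSol (hL s hs).pos (hL s hs).radicand_pos).continuousAt.continuousWithinAt
  have hNc : ContinuousOn (fun q : ℝ × ℝ => N q.1 q.2) (Ioi s₁ ×ˢ univ) := by
    have hid : ContinuousOn (fun s : ℝ => s) (Ioi s₁) := continuousOn_id
    have hne : ∀ s ∈ Ioi s₁, s ≠ 0 := fun s hs => (hL s hs).pos.ne'
    have hlog : ContinuousOn (fun s : ℝ => Real.log (2 * s)) (Ioi s₁) := fun s hs =>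
      (hasDerivAt_log_two_mul (hL s hs).pos).continuousAt.continuousWithinAt
    have hQ1 : ContinuousOn approxCorrDeriv (Ioi s₁) := fun s hs =>
      (hasDerivAt_approxCorrDeriv (hL s hs).pos).continuousAt.continuousWithinAt
    have hQ2 : ContinuousOn approxCorrDeriv2 (Ioi s₁) :=
      (continuousOn_const.div (hid.pow 2) fun s hs => pow_ne_zero 2 (hne s hs)).add
        (((continuousOn_const.mul hlog).sub continuousOn_const).div (hid.pow 3)
          fun s hs => pow_ne_zero 3 (hne s hs))
    have hY2 : ContinuousOn approxSolDeriv2 (Ioi s₁) :=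
      (hQ2.div (continuousOn_const.mul hYc) fun s hs =>
        mul_ne_zero two_ne_zero (hL s hs).approxSol_pos.ne').sub
      (((continuousOn_const.add hQ1).pow 2).div (continuousOn_const.mul (hYc.pow 3)) fun s hs =>
        mul_ne_zero four_ne_zero (pow_ne_zero 3 (hL s hs).approxSol_pos.ne'))
    have hpow : ContinuousOn (fun s : ℝ => s ^ (-(3 / 2) : ℝ)) (Ioi s₁) :=
      hid.rpow_const fun s hs => Or.inl (hne s hs)
    have hcoef : ContinuousOn (fun s : ℝ => 1 / s + 3 / (16 * s ^ 2)) (Ioi s₁) :=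
      (continuousOn_const.div hid hne).add (continuousOn_const.div
        (continuousOn_const.mul (hid.pow 2)) fun s hs =>
          mul_ne_zero (by norm_num) (pow_ne_zero 2 (hne s hs)))
    have hmap : MapsTo (Prod.fst : ℝ × ℝ → ℝ) (Ioi s₁ ×ˢ univ) (Ioi s₁) := fun q hq => hq.1
    have hz : ContinuousOn (fun q : ℝ × ℝ => q.1 ^ (-(3 / 2) : ℝ) * q.2) (Ioi s₁ ×ˢ univ) :=
      (hpow.comp continuousOn_fst hmap).mul continuousOn_snd
    have hy := (hYc.comp continuousOn_fst hmap).add hz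
    have hexp : ContinuousOn (fun q : ℝ × ℝ => Real.exp (-2 * q.1)) (Ioi s₁ ×ˢ univ) := by
      fun_prop
    exact ((((hcoef.comp continuousOn_fst hmap).mul hz).sub
      (hexp.mul (hy.mul ((hy.pow 2).rexp.sub continuousOn_const)))).sub
      (hY2.comp continuousOn_fst hmap))
  have hN0 : ∀ s, s₁ < s → |N s 0| ≤ 1 / 8 * s ^ (-3 : ℝ) := fun s hs => by
    have h1 : N s 0 = -(emdenForce s (approxSol s) + approxSolDeriv2 s) := by
      simp only [N, mul_zero, add_zero]; ring
    rw [h1, abs_neg, (hL s hs).rpow_neg_three]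
    exact (hL s hs).abs_approx_residual_le
  have hNL : ∀ s, s₁ < s → ∀ e₁ ∈ Icc (-1 : ℝ) 1, ∀ e₂ ∈ Icc (-1 : ℝ) 1,
      |N s e₁ - N s e₂| ≤ 1 / 8 * s ^ (-3 : ℝ) * |e₁ - e₂| := fun s hs e₁ he₁ e₂ he₂ => by
    have hl := hL s hs
    set q := s ^ (1 / 8 : ℝ) with hq
    have hq0 := hl.q_pos
    have h32 := hl.rpow_neg_three_halves
    refine (convex_Icc (-1 : ℝ) 1).norm_image_sub_le_of_norm_hasDerivWithin_le (f := N s)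
      (f' := fun e => s ^ (-(3 / 2) : ℝ) * (1 / s + 3 / (16 * s ^ 2) - Real.exp (-2 * s) *
      (Real.exp ((approxSol s + s ^ (-(3 / 2) : ℝ) * e) ^ 2) - 1
        + (approxSol s + s ^ (-(3 / 2) : ℝ) * e) *
        (Real.exp ((approxSol s + s ^ (-(3 / 2) : ℝ) * e) ^ 2)
          * (2 * (approxSol s + s ^ (-(3 / 2) : ℝ) * e))))))
      (fun e _ => HasDerivAt.hasDerivWithinAt ?_) (fun e he => ?_) he₂ he₁
    · have hin : HasDerivAt (fun e => s ^ (-(3 / 2) : ℝ) * e) (s ^ (-(3 / 2) : ℝ)) e := by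
        simpa using (hasDerivAt_id e).const_mul (s ^ (-(3 / 2) : ℝ))
      have := ((hin.const_mul (1 / s + 3 / (16 * s ^ 2))).sub
        ((hasDerivAt_emdenForce s _).comp e (hin.const_add (approxSol s)))).sub_const
        (approxSolDeriv2 s)
      refine this.congr_deriv ?_
      ring
    · have := hl.abs_linear_perturbation_le (abs_le.2 he)
      rw [← h32] at this
      rw [Real.norm_eq_abs, abs_mul, abs_of_pos (by rw [h32]; positivity)]
      refine (mul_le_mul_of_nonneg_left this (by rw [h32]; positivity)).trans (le_of_eq ?_)
      rw [h32, hl.rpow_neg_three]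
      field_simp
  obtain ⟨z, z', hz⟩ := exists_decaying_solution hs₁0 hNc hN0 hNL
  refine ⟨s₁ + 1, 7, fun s => approxSol s + z s, fun s => approxSolDeriv s + z' s, by linarith,
    fun s hs => ?_⟩
  obtain ⟨hzb, hzd, hzd'⟩ := hz s hs
  have hs' : s₁ < s := by linarith
  have hl := hL s hs'
  have hs0 := hl.pos
  set q := s ^ (1 / 8 : ℝ) with hq
  have hq0 := hl.q_pos
  refine ⟨?_, (hasDerivAt_approxSol hs0 hl.radicand_pos).add hzd, ?_, ?_⟩
  · rw [hl.rpow_neg_three_halves] at hzb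
    have h1 := hl.le_approxSol
    have h2 : 1 ≤ q ^ 4 := one_le_pow₀ (by linarith [hl.ge])
    have h3 : (q ^ 12)⁻¹ < 1 :=
      inv_lt_one_of_one_lt₀ (one_lt_pow₀ (by linarith [hl.ge]) (by norm_num))
    linarith [(abs_le.1 hzb).1]
  · refine ((hasDerivAt_approxSolDeriv hs0 hl.radicand_pos).add hzd').congr_deriv ?_
    have hpow : s ^ (-(3 / 2) : ℝ) * (s ^ (3 / 2 : ℝ) * z s) = z s := by
      rw [← mul_assoc, ← Real.rpow_add hs0]; norm_num
    simp only [N]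
    rw [hpow]
    ring
  · have hlogs : 1 ≤ Real.log s := by
      rw [Real.le_log_iff_exp_le hs0]
      linarith [Real.exp_one_lt_d9]
    have hlog2 : Real.log (2 * s) = Real.log 2 + Real.log s := Real.log_mul two_ne_zero hs0.ne'
    have h2 := Real.log_two_lt_d9
    have h2' := Real.log_two_gt_d9
    have hs32 := Real.rpow_nonneg hs0.le (-(3 / 2))
    have hrad : 2 * s - 2 * Real.log s - 2 * Real.log 2 =
        (2 * s + approxCorr s) - (2 * Real.log (2 * s) - 4) / s := by
      simp only [approxCorr]; rw [hlog2]; ring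
    have hp := (approx_bounds hl.one_le hl.log_nonneg rfl hl.theta_le_quarter).1.trans
      hl.theta_le_quarter
    have hrad0 : 0 ≤ 2 * s - 2 * Real.log s - 2 * Real.log 2 := by
      rw [hrad]
      linarith [hl.radicand_mem.1, (abs_le.1 hp).2, hl.one_le]
    set S := √(2 * s - 2 * Real.log s - 2 * Real.log 2) with hS
    have hS0 : 0 ≤ S := Real.sqrt_nonneg _
    have hdiff : |approxSol s - S| ≤ 6 * (s ^ (-(3 / 2) : ℝ) * Real.log s) := by
      have h3 : (approxSol s - S) * (approxSol s + S) = (2 * Real.log (2 * s) - 4) / s := by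
        have : (approxSol s - S) * (approxSol s + S) = approxSol s ^ 2 - S ^ 2 := by ring
        rw [this, hl.approxSol_sq, hS, Real.sq_sqrt hrad0, hrad]; ring
      have h4 : q ^ 4 ≤ approxSol s + S := by linarith [hl.le_approxSol]
      have h5 : |approxSol s - S| * q ^ 4 ≤ |(2 * Real.log (2 * s) - 4) / s| := by
        rw [← h3, abs_mul, abs_of_pos (lt_of_lt_of_le (by positivity) h4)]
        exact mul_le_mul_of_nonneg_left h4 (abs_nonneg _)
      have h6 : |(2 * Real.log (2 * s) - 4) / s| ≤ 6 * Real.log s / s := by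
        rw [abs_div, abs_of_pos hs0]
        refine div_le_div_of_nonneg_right (abs_le.2 ⟨?_, ?_⟩) hs0.le <;>
          rw [hlog2] <;> linarith
      have h7 : 6 * Real.log s / s = 6 * (s ^ (-(3 / 2) : ℝ) * Real.log s) * q ^ 4 := by
        rw [hl.rpow_neg_three_halves]
        have : s = q ^ 8 := hl.eq_pow
        generalize Real.log s = ℓ
        rw [this]
        field_simp
      exact le_of_mul_le_mul_right (h5.trans (h6.trans h7.le)) (by positivity)
    have hz1 : |z s| ≤ s ^ (-(3 / 2) : ℝ) * Real.log s :=
      hzb.trans (le_mul_of_one_le_right hs32 hlogs)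
    have h8 : approxSol s + z s - S = (approxSol s - S) + z s := by ring
    rw [h8]
    refine (abs_add_le _ _).trans (by linarith)

lemma solvesRadial_of_emden {s₁ : ℝ} {y y' : ℝ → ℝ} (hy : ∀ s, s₁ < s →
    HasDerivAt y (y' s) s ∧ HasDerivAt y' (-emdenForce s (y s)) s) :
    SolvesRadial (fun s => s * (Real.exp (s ^ 2) - 1)) (Ioo 0 (Real.exp (-s₁)))
      (fun r => y (-Real.log r)) := by
  have hlt : ∀ r ∈ Ioo 0 (Real.exp (-s₁)), s₁ < -Real.log r := fun r hr => by
    have := Real.log_lt_log hr.1 hr.2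
    rw [Real.log_exp] at this
    linarith
  have hlog : ∀ r ∈ Ioo 0 (Real.exp (-s₁)), HasDerivAt (fun r => -Real.log r) (-r⁻¹) r :=
    fun r hr => (Real.hasDerivAt_log hr.1.ne').neg
  refine SolvesRadial.of_system (p := fun r => -y' (-Real.log r)) isOpen_Ioo (fun r hr => hr.1)
    (fun r hr => ?_) (fun r hr => ?_)
  · refine ((hy _ (hlt r hr)).1.comp r (hlog r hr)).congr_deriv ?_
    rw [div_eq_mul_inv]; ring
  · refine (((hy _ (hlt r hr)).2.comp r (hlog r hr)).neg).congr_deriv ?_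
    have h1 : Real.exp (-2 * -Real.log r) = r ^ 2 := by
      have : -2 * -Real.log r = Real.log r + Real.log r := by ring
      rw [this, Real.exp_add, Real.exp_log hr.1, sq]
    have := hr.1.ne'
    rw [emdenForce, h1]
    field_simp

/-- Existence of the singular disk solution. -/
lemma exists_isSingularDiskSolution {χ : ℝ → ℝ} (hχ : IsCutoff χ) :
    ∃ ρ u, IsSingularDiskSolution ρ u := by
  obtain ⟨s₁, C, y, y', hs₁, hy⟩ := exists_emden_solution
  set a := Real.exp (-s₁) with ha
  have ha0 : 0 < a := Real.exp_pos _
  have hsolve := solvesRadial_of_emden fun s hs => ⟨(hy s hs).2.1, (hy s hs).2.2.1⟩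
  have hlt : ∀ r ∈ Ioo 0 a, s₁ < -Real.log r := fun r hr => by
    have := Real.log_lt_log hr.1 hr.2
    rw [ha, Real.log_exp] at this
    linarith
  have hR : 0 < a / 2 := by linarith
  obtain ⟨ψ, hψu, hψ⟩ := exists_global_extension (u := fun r => y (-Real.log r)) hχ le_rfl hR (by
    rw [nonlin_zero_mass]
    exact hsolve.mono fun r hr => ⟨hr.1, hr.2.trans_lt (by linarith)⟩)
  have hψpos : ∀ r ∈ Ioc 0 (a / 2), 0 < ψ r := fun r hr => by
    rw [hψu r hr]
    exact (hy _ (hlt r ⟨hr.1, hr.2.trans_lt (by linarith)⟩)).1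
  have hnear : ∀ᶠ r in 𝓝[>] (0 : ℝ), r ∈ Ioc 0 (a / 2) := Ioc_mem_nhdsGT hR
  have hsing : HasSingularExpansion ψ := by
    refine Asymptotics.IsBigO.of_bound C ?_
    filter_upwards [hnear] with r hr
    have hs := hlt r ⟨hr.1, hr.2.trans_lt (by linarith)⟩
    have h := (hy _ hs).2.2.2
    have h1 : 2 * -Real.log r = -2 * Real.log r := by ring
    rw [h1] at h
    have h2 : 0 ≤ (-Real.log r) ^ (-(3 / 2) : ℝ) * Real.log (-Real.log r) :=
      mul_nonneg (Real.rpow_nonneg (by linarith) _) (Real.log_nonneg (by linarith))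
    rw [hψu r hr, Real.norm_eq_abs, Real.norm_eq_abs, abs_of_nonneg h2]
    exact h
  -- The continued solution has a zero, because `r ψ'` is negative and decreasing.
  have hzero : ∃ r, 0 < r ∧ ψ r ≤ 0 := by
    by_contra! hpos
    have hode : SolvesRadial (fun s => s * (Real.exp (s ^ 2) - 1)) (Ioi 0) ψ := by
      rw [← nonlin_zero_mass χ]; exact hψ
    have hode' : ∀ ρ, SolvesRadial (fun s => s * (Real.exp (s ^ 2) - 1)) (Ioo 0 ρ) ψ := fun ρ =>
      hode.mono fun x hx => hx.1
    set c := -(a / 2 * deriv ψ (a / 2)) with hc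
    have hc0 : 0 < c := by
      have := (hode' a).deriv_neg_of_tendsto_atTop (fun r hr => hpos r hr.1)
        hsing.tendsto_atTop ⟨hR, by linarith⟩
      have := mul_pos hR (neg_pos.2 this)
      linarith
    obtain ⟨x, -, hx⟩ := exists_neg_of_deriv_le (g := fun x => ψ (Real.exp x))
      (g' := fun x => deriv ψ (Real.exp x) * Real.exp x) (a := Real.log (a / 2)) hc0
      (fun x _ => (hode.hasDerivAt (Real.exp_pos x)).comp x (Real.hasDerivAt_exp x))
      (fun x hx => by
        have hx' : a / 2 ≤ Real.exp x := by rwa [Real.log_le_iff_le_exp hR] at hx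
        have := ((hode' (Real.exp x + 1)).strictAntiOn_mul_deriv
          fun r hr => hpos r hr.1).antitoneOn ⟨hR, by linarith⟩
          ⟨Real.exp_pos x, by linarith⟩ hx'
        linarith)
    exact absurd (hpos _ (Real.exp_pos x)) (not_lt.2 hx.le)
  obtain ⟨r₁, hr₁0, hr₁⟩ := hzero
  have hr₁a : a / 2 < r₁ := by
    by_contra! h
    exact absurd (hψpos r₁ ⟨hr₁0, h⟩) (not_lt.2 hr₁)
  have hcont : ContinuousOn ψ (Icc (a / 2) r₁) :=
    hψ.continuousOn.mono fun x hx => hR.trans_le hx.1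
  have hcomp : IsCompact (Icc (a / 2) r₁ ∩ ψ ⁻¹' Iic 0) :=
    isCompact_Icc.of_isClosed_subset (hcont.preimage_isClosed_of_isClosed isClosed_Icc isClosed_Iic)
      inter_subset_left
  obtain ⟨ρ, ⟨hρ, hψρ⟩, hleast⟩ := hcomp.exists_isLeast ⟨r₁, ⟨hr₁a.le, le_rfl⟩, hr₁⟩
  have hρ0 : 0 < ρ := hR.trans_le hρ.1
  have hpos : ∀ r ∈ Ioo 0 ρ, 0 < ψ r := fun r hr => by
    rcases le_or_gt r (a / 2) with h | h
    · exact hψpos r ⟨hr.1, h⟩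
    · by_contra! hneg
      exact absurd (hleast ⟨⟨h.le, hr.2.le.trans hρ.2⟩, hneg⟩) (not_le.2 hr.2)
  refine ⟨ρ, ψ, hρ0, ?_, hpos, hψ.continuousOn.mono fun x hx => hx.1, ?_, hsing⟩
  · rw [← nonlin_zero_mass χ]
    exact hψ.mono fun x hx => hx.1
  · refine le_antisymm hψρ ?_
    have h1 : Tendsto ψ (𝓝[<] ρ) (𝓝 (ψ ρ)) :=
      ((hψ.hasDerivAt hρ0).continuousAt).continuousWithinAt
    refine ge_of_tendsto h1 ?_
    filter_upwards [Ioo_mem_nhdsLT hρ0] with x hx using (hpos x hx).le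

/-! ### The heat kernel and the heat semigroup -/

lemma heatKernel_pos {t : ℝ} (ht : 0 < t) (x : Plane) : 0 < heatKernel t x := by
  unfold heatKernel; positivity

lemma heatKernel_le {t : ℝ} (ht : 0 < t) (x : Plane) :
    heatKernel t x ≤ (4 * Real.pi * t)⁻¹ := by
  unfold heatKernel
  have h : Real.exp (-‖x‖ ^ 2 / (4 * t)) ≤ 1 :=
    Real.exp_le_one_iff.2 (div_nonpos_of_nonpos_of_nonneg (by nlinarith [sq_nonneg ‖x‖])
      (by positivity))
  exact mul_le_of_le_one_right (by positivity) h

lemma continuousOn_heatKernel :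
    ContinuousOn (fun q : ℝ × Plane => heatKernel q.1 q.2) (Ioi 0 ×ˢ univ) := by
  unfold heatKernel
  have h : ∀ q ∈ (Ioi 0 ×ˢ univ : Set (ℝ × Plane)), 4 * Real.pi * q.1 ≠ 0 ∧ 4 * q.1 ≠ 0 := by
    rintro ⟨s, x⟩ ⟨hs, -⟩
    have hs : 0 < s := hs
    constructor <;> simp only <;> positivity
  exact ((by fun_prop : ContinuousOn (fun q : ℝ × Plane => 4 * Real.pi * q.1) _).inv₀
    fun q hq => (h q hq).1).mul (Real.continuous_exp.comp_continuousOn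
      ((by fun_prop : ContinuousOn (fun q : ℝ × Plane => -‖q.2‖ ^ 2) _).div (by fun_prop)
        fun q hq => (h q hq).2))

lemma measurable_heatKernel : Measurable fun q : ℝ × Plane => heatKernel q.1 q.2 := by
  unfold heatKernel; fun_prop

lemma continuous_heatKernel (t : ℝ) : Continuous (heatKernel t) := by
  unfold heatKernel; fun_prop

lemma integral_heatKernel {t : ℝ} (ht : 0 < t) : ∫ x, heatKernel t x = 1 := by
  have h := GaussianFourier.integral_rexp_neg_mul_sq_norm (V := Plane)
    (b := 1 / (4 * t)) (by positivity)
  rw [show (fun x : Plane => heatKernel t x) =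
    fun x => (4 * Real.pi * t)⁻¹ * Real.exp (-(1 / (4 * t)) * ‖x‖ ^ 2) by
      ext x; unfold heatKernel; congr 2; ring, integral_const_mul, h]
  simp only [finrank_euclideanSpace, Fintype.card_fin]
  norm_num
  have := Real.pi_pos
  field_simp

lemma integrable_heatKernel {t : ℝ} (ht : 0 < t) : Integrable (heatKernel t) :=
  integrable_of_integral_eq_one (integral_heatKernel ht)

lemma integrable_heatKernel_sub {t : ℝ} (ht : 0 < t) (x : Plane) :
    Integrable fun y => heatKernel t (x - y) :=
  (integrable_heatKernel ht).comp_sub_left x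

lemma integral_heatKernel_sub {t : ℝ} (ht : 0 < t) (x : Plane) :
    ∫ y, heatKernel t (x - y) = 1 := by
  rw [integral_sub_left_eq_self (heatKernel t), integral_heatKernel ht]

lemma heatKernel_le_mul {t t' : ℝ} (ht : 0 < t) (htt : t ≤ t') (x : Plane) :
    heatKernel t x ≤ t' / t * heatKernel t' x := by
  unfold heatKernel
  have ht' : 0 < t' := ht.trans_le htt
  have h1 : t' / t * ((4 * Real.pi * t')⁻¹ * Real.exp (-‖x‖ ^ 2 / (4 * t'))) =
      (4 * Real.pi * t)⁻¹ * Real.exp (-‖x‖ ^ 2 / (4 * t')) := by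
    field_simp
  rw [h1]
  refine mul_le_mul_of_nonneg_left (Real.exp_le_exp.2 ?_) (by positivity)
  rw [neg_div, neg_div]
  exact neg_le_neg (div_le_div_of_nonneg_left (sq_nonneg _) (by positivity) (by linarith))

/-- Completing the square in the product of two heat kernels. -/
lemma heatKernel_mul_heatKernel {t s : ℝ} (ht : 0 < t) (hs : 0 < s) (x y z : Plane) :
    heatKernel t (x - y) * heatKernel s (y - z) = heatKernel (t + s) (x - z) *
      heatKernel (t * s / (t + s)) ((t + s)⁻¹ • (s • x + t • z) - y) := by
  have hpi := Real.pi_pos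
  have hts : 0 < t + s := by positivity
  unfold heatKernel
  rw [mul_mul_mul_comm (4 * Real.pi * t)⁻¹, mul_mul_mul_comm (4 * Real.pi * (t + s))⁻¹,
    ← Real.exp_add, ← Real.exp_add]
  congr 1
  · field_simp
  · congr 1
    simp only [EuclideanSpace.real_norm_sq_eq, Fin.sum_univ_two, PiLp.sub_apply, PiLp.smul_apply,
      PiLp.add_apply, smul_eq_mul]
    field_simp
    ring

lemma integrable_heatKernel_mul_heatKernel {t s : ℝ} (ht : 0 < t) (hs : 0 < s) (x z : Plane) :
    Integrable fun y => heatKernel t (x - y) * heatKernel s (y - z) := by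
  simp_rw [heatKernel_mul_heatKernel ht hs]
  exact (integrable_heatKernel_sub (by positivity) _).const_mul _

lemma integral_heatKernel_mul_heatKernel {t s : ℝ} (ht : 0 < t) (hs : 0 < s) (x z : Plane) :
    ∫ y, heatKernel t (x - y) * heatKernel s (y - z) = heatKernel (t + s) (x - z) := by
  simp_rw [heatKernel_mul_heatKernel ht hs]
  rw [integral_const_mul, integral_heatKernel_sub (by positivity), mul_one]

/-- Measurable data for which the integral defining the heat flow converges absolutely at all
points and all positive times. -/
structure HeatAdmissible (g : Plane → ℝ) : Prop where
  aesm : AEStronglyMeasurable g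
  integrable : ∀ t, 0 < t → ∀ x, Integrable fun y => heatKernel t (x - y) * g y

lemma heat_eq {t : ℝ} (ht : 0 < t) (g : Plane → ℝ) (x : Plane) :
    heat t g x = ∫ y, heatKernel t (x - y) * g y := by
  rw [heat, if_neg ht.ne']

lemma aestronglyMeasurable_heatKernel_sub (t : ℝ) (x : Plane) :
    AEStronglyMeasurable fun y => heatKernel t (x - y) :=
  ((continuous_heatKernel t).comp (continuous_const.sub continuous_id)).aestronglyMeasurable

lemma HeatAdmissible.of_integrable {g : Plane → ℝ} (hg : Integrable g) : HeatAdmissible g where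
  aesm := hg.1
  integrable t ht x := by
    refine hg.bdd_mul (aestronglyMeasurable_heatKernel_sub t x) (c := (4 * Real.pi * t)⁻¹) ?_
    filter_upwards with y
    rw [Real.norm_of_nonneg (heatKernel_pos ht _).le]
    exact heatKernel_le ht _

lemma HeatAdmissible.const (c : ℝ) : HeatAdmissible fun _ => c where
  aesm := aestronglyMeasurable_const
  integrable _ ht x := (integrable_heatKernel_sub ht x).mul_const c

lemma HeatAdmissible.add {g h : Plane → ℝ} (hg : HeatAdmissible g) (hh : HeatAdmissible h) :
    HeatAdmissible fun x => g x + h x where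
  aesm := hg.aesm.add hh.aesm
  integrable t ht x := by
    simp_rw [mul_add]; exact (hg.integrable t ht x).add (hh.integrable t ht x)

lemma HeatAdmissible.mono {g h : Plane → ℝ} (hg : HeatAdmissible g)
    (hh : AEStronglyMeasurable h) (hle : ∀ᵐ y, |h y| ≤ g y) : HeatAdmissible h where
  aesm := hh
  integrable t ht x := by
    refine (hg.integrable t ht x).mono' ((aestronglyMeasurable_heatKernel_sub t x).mul hh) ?_
    filter_upwards [hle] with y hy
    rw [norm_mul, Real.norm_of_nonneg (heatKernel_pos ht _).le]
    exact mul_le_mul_of_nonneg_left hy (heatKernel_pos ht _).le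

lemma HeatAdmissible.const_mul {g : Plane → ℝ} (hg : HeatAdmissible g) (c : ℝ) :
    HeatAdmissible fun x => c * g x where
  aesm := hg.aesm.const_mul c
  integrable t ht x := by
    simp_rw [mul_left_comm _ c]; exact (hg.integrable t ht x).const_mul c

lemma heat_add {t : ℝ} (ht : 0 < t) {g h : Plane → ℝ} (hg : HeatAdmissible g)
    (hh : HeatAdmissible h) (x : Plane) :
    heat t (fun y => g y + h y) x = heat t g x + heat t h x := by
  simp_rw [heat_eq ht, mul_add]
  exact integral_add (hg.integrable t ht x) (hh.integrable t ht x)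

lemma heat_sub {t : ℝ} (ht : 0 < t) {g h : Plane → ℝ} (hg : HeatAdmissible g)
    (hh : HeatAdmissible h) (x : Plane) :
    heat t (fun y => g y - h y) x = heat t g x - heat t h x := by
  simp_rw [heat_eq ht, mul_sub]
  exact integral_sub (hg.integrable t ht x) (hh.integrable t ht x)

lemma heat_const_mul {t : ℝ} (ht : 0 < t) (c : ℝ) (g : Plane → ℝ) (x : Plane) :
    heat t (fun y => c * g y) x = c * heat t g x := by
  simp_rw [heat_eq ht, mul_left_comm _ c, integral_const_mul]

lemma heat_const {t : ℝ} (ht : 0 < t) (c : ℝ) (x : Plane) : heat t (fun _ => c) x = c := by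
  rw [heat_eq ht, integral_mul_const, integral_heatKernel_sub ht, one_mul]

/-- Comparison principle for the heat flow, with no hypothesis on the dominated function. -/
lemma abs_heat_le {t : ℝ} (ht : 0 < t) {g h : Plane → ℝ} (hg : HeatAdmissible g)
    (hle : ∀ᵐ y, |h y| ≤ g y) (x : Plane) : |heat t h x| ≤ heat t g x := by
  rw [heat_eq ht, heat_eq ht, ← Real.norm_eq_abs]
  refine norm_integral_le_of_norm_le (hg.integrable t ht x) ?_
  filter_upwards [hle] with y hy
  rw [norm_mul, Real.norm_of_nonneg (heatKernel_pos ht _).le]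
  exact mul_le_mul_of_nonneg_left hy (heatKernel_pos ht _).le

lemma heat_mono {t : ℝ} (ht : 0 < t) {g h : Plane → ℝ} (hg : HeatAdmissible g)
    (hh : HeatAdmissible h) (hle : ∀ᵐ y, g y ≤ h y) (x : Plane) : heat t g x ≤ heat t h x := by
  rw [heat_eq ht, heat_eq ht]
  refine integral_mono_ae (hg.integrable t ht x) (hh.integrable t ht x) ?_
  filter_upwards [hle] with y hy
  exact mul_le_mul_of_nonneg_left hy (heatKernel_pos ht _).le

lemma heat_nonneg {t : ℝ} (ht : 0 < t) {g : Plane → ℝ} (hg : ∀ᵐ y, 0 ≤ g y) (x : Plane) :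
    0 ≤ heat t g x := by
  rw [heat_eq ht]
  refine integral_nonneg_of_ae ?_
  filter_upwards [hg] with y hy
  exact mul_nonneg (heatKernel_pos ht _).le hy

lemma heat_le_integral {t : ℝ} (ht : 0 < t) {g : Plane → ℝ} (hg : Integrable g)
    (h0 : ∀ᵐ y, 0 ≤ g y) (x : Plane) : heat t g x ≤ (4 * Real.pi * t)⁻¹ * ∫ y, g y := by
  rw [heat_eq ht, ← integral_const_mul]
  refine integral_mono_ae ((HeatAdmissible.of_integrable hg).integrable t ht x)
    (hg.const_mul _) ?_
  filter_upwards [h0] with y hy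
  exact mul_le_mul_of_nonneg_right (heatKernel_le ht _) hy

lemma heat_le_mul_heat {t t' : ℝ} (ht : 0 < t) (htt : t ≤ t') {g : Plane → ℝ}
    (hg : HeatAdmissible g) (h0 : ∀ᵐ y, 0 ≤ g y) (x : Plane) :
    heat t g x ≤ t' / t * heat t' g x := by
  have ht' := ht.trans_le htt
  rw [heat_eq ht, heat_eq ht', ← integral_const_mul]
  refine integral_mono_ae (hg.integrable t ht x) ((hg.integrable t' ht' x).const_mul _) ?_
  filter_upwards [h0] with y hy
  rw [← mul_assoc]
  exact mul_le_mul_of_nonneg_right (heatKernel_le_mul ht htt _) hy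

lemma HeatAdmissible.integrable_prod {g : Plane → ℝ} (hg : HeatAdmissible g) {t s : ℝ}
    (ht : 0 < t) (hs : 0 < s) (x : Plane) :
    Integrable (fun q : Plane × Plane =>
      heatKernel t (x - q.1) * (heatKernel s (q.1 - q.2) * g q.2)) := by
  have hm : AEStronglyMeasurable (fun q : Plane × Plane =>
      heatKernel t (x - q.1) * (heatKernel s (q.1 - q.2) * g q.2)) (volume.prod volume) :=
    (((continuous_heatKernel t).comp (by fun_prop)).aestronglyMeasurable).mul
      ((((continuous_heatKernel s).comp (by fun_prop)).aestronglyMeasurable).mul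
        hg.aesm.comp_snd)
  rw [Measure.volume_eq_prod, integrable_prod_iff' hm]
  have key : ∀ y z, heatKernel t (x - y) * (heatKernel s (y - z) * g z) =
      heatKernel t (x - y) * heatKernel s (y - z) * g z := fun y z => by ring
  constructor
  · filter_upwards with z
    simp_rw [key]
    exact (integrable_heatKernel_mul_heatKernel ht hs x z).mul_const _
  · have : ∀ z, ∫ y, ‖heatKernel t (x - y) * (heatKernel s (y - z) * g z)‖ =
        ‖heatKernel (t + s) (x - z) * g z‖ := fun z => by
      simp_rw [key, norm_mul, Real.norm_of_nonneg (heatKernel_pos ht _).le,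
        Real.norm_of_nonneg (heatKernel_pos hs _).le]
      rw [integral_mul_const, integral_heatKernel_mul_heatKernel ht hs,
        Real.norm_of_nonneg (heatKernel_pos (by positivity) _).le]
    simp_rw [this]
    exact (hg.integrable _ (by positivity) x).norm

/-- The semigroup property of the heat flow. -/
lemma heat_heat {g : Plane → ℝ} (hg : HeatAdmissible g) {t s : ℝ}
    (ht : 0 < t) (hs : 0 < s) (x : Plane) : heat t (heat s g) x = heat (t + s) g x := by
  rw [heat_eq ht, heat_eq (by positivity)]
  have h1 : ∀ y, heatKernel t (x - y) * heat s g y =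
      ∫ z, heatKernel t (x - y) * (heatKernel s (y - z) * g z) := fun y => by
    rw [heat_eq hs, integral_const_mul]
  simp_rw [h1]
  rw [integral_integral_swap (hg.integrable_prod ht hs x)]
  refine integral_congr_ae (Eventually.of_forall fun z => ?_)
  simp only
  rw [← integral_heatKernel_mul_heatKernel ht hs, ← integral_mul_const]
  simp_rw [mul_assoc]

lemma HeatAdmissible.integrable_mul_heat {g : Plane → ℝ} (hg : HeatAdmissible g) {t s : ℝ}
    (ht : 0 < t) (hs : 0 < s) (x : Plane) :
    Integrable fun y => heatKernel t (x - y) * heat s g y := by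
  have h := (hg.integrable_prod ht hs x).integral_prod_left
  simp_rw [integral_const_mul] at h
  simpa only [heat_eq hs] using h

lemma integrable_prod_heat {g : Plane → ℝ} (hg : Integrable g) {t : ℝ} (ht : 0 < t) :
    Integrable (fun q : Plane × Plane => heatKernel t (q.1 - q.2) * g q.2) := by
  have hm : AEStronglyMeasurable (fun q : Plane × Plane =>
      heatKernel t (q.1 - q.2) * g q.2) (volume.prod volume) :=
    (((continuous_heatKernel t).comp (by fun_prop)).aestronglyMeasurable).mul hg.1.comp_snd
  rw [Measure.volume_eq_prod, integrable_prod_iff' hm]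
  constructor
  · filter_upwards with z
    exact ((integrable_heatKernel ht).comp_sub_right z).mul_const _
  · simp_rw [norm_mul, Real.norm_of_nonneg (heatKernel_pos ht _).le, integral_mul_const,
      integral_sub_right_eq_self (heatKernel t), integral_heatKernel ht, one_mul]
    exact hg.norm

lemma integrable_heat {g : Plane → ℝ} (hg : Integrable g) {t : ℝ} (ht : 0 < t) :
    Integrable (heat t g) := by
  have h := (integrable_prod_heat hg ht).integral_prod_left
  exact h.congr (Eventually.of_forall fun x => (heat_eq ht g x).symm)

lemma integral_heat {g : Plane → ℝ} (hg : Integrable g) {t : ℝ} (ht : 0 < t) :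
    ∫ x, heat t g x = ∫ x, g x := by
  simp_rw [heat_eq ht]
  rw [integral_integral_swap (integrable_prod_heat hg ht)]
  simp_rw [integral_mul_const, integral_sub_right_eq_self (heatKernel t), integral_heatKernel ht,
    one_mul]

/-! ### Joint continuity, Jensen's inequality and the initial trace of the heat flow -/

/-- A Gaussian majorant of the heat kernels near a point of space-time, which dominates the integrals
in the proof of joint continuity. -/
lemma heatKernel_le_of_near {t₀ t : ℝ} (ht₀ : 0 < t₀) (h1 : t₀ / 2 ≤ t) (h2 : t ≤ 2 * t₀)
    {x₀ x : Plane} (hx : ‖x - x₀‖ ^ 2 ≤ t₀) (y : Plane) :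
    heatKernel t (x - y) ≤ 8 * Real.exp (1 / 8) * heatKernel (4 * t₀) (x₀ - y) := by
  have hpi := Real.pi_pos
  have ht : 0 < t := by linarith
  unfold heatKernel
  have hc : (4 * Real.pi * t)⁻¹ ≤ 8 * (4 * Real.pi * (4 * t₀))⁻¹ := by
    rw [← div_eq_mul_inv, inv_eq_one_div, div_le_div_iff₀ (by positivity) (by positivity)]
    nlinarith [mul_le_mul_of_nonneg_left h1 hpi.le]
  have hn : ‖x₀ - y‖ ^ 2 ≤ 2 * ‖x - y‖ ^ 2 + 2 * ‖x - x₀‖ ^ 2 := by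
    have h3 : ‖x₀ - y‖ ≤ ‖x - y‖ + ‖x - x₀‖ := by
      have := norm_sub_le (x - y) (x - x₀)
      rwa [sub_sub_sub_cancel_left] at this
    nlinarith [norm_nonneg (x₀ - y), sq_nonneg (‖x - y‖ - ‖x - x₀‖)]
  have he : -‖x - y‖ ^ 2 / (4 * t) ≤ 1 / 8 + -‖x₀ - y‖ ^ 2 / (4 * (4 * t₀)) := by
    have h4 : -‖x - y‖ ^ 2 / (4 * t) ≤ -‖x - y‖ ^ 2 / (4 * (2 * t₀)) := by
      rw [neg_div, neg_div]
      exact neg_le_neg (div_le_div_of_nonneg_left (sq_nonneg _) (by positivity) (by linarith))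
    refine h4.trans ?_
    rw [div_add_div _ _ (by norm_num) (by positivity), div_le_div_iff₀ (by positivity)
      (by positivity)]
    nlinarith [mul_le_mul_of_nonneg_right hn (sq_nonneg t₀),
      mul_le_mul_of_nonneg_right hx (sq_nonneg t₀)]
  calc (4 * Real.pi * t)⁻¹ * Real.exp (-‖x - y‖ ^ 2 / (4 * t))
      ≤ (8 * (4 * Real.pi * (4 * t₀))⁻¹) *
          Real.exp (1 / 8 + -‖x₀ - y‖ ^ 2 / (4 * (4 * t₀))) :=
        mul_le_mul hc (Real.exp_le_exp.2 he) (Real.exp_pos _).le (by positivity)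
    _ = _ := by rw [Real.exp_add]; ring

lemma HeatAdmissible.continuousOn_heat {g : Plane → ℝ} (hg : HeatAdmissible g) :
    ContinuousOn (fun q : ℝ × Plane => heat q.1 g q.2) (Ioi 0 ×ˢ univ) := by
  rintro ⟨t₀, x₀⟩ ⟨ht₀, -⟩
  have ht₀ : 0 < t₀ := ht₀
  refine ContinuousAt.continuousWithinAt ?_
  have hnear : ∀ᶠ q : ℝ × Plane in 𝓝 (t₀, x₀),
      (t₀ / 2 ≤ q.1 ∧ q.1 ≤ 2 * t₀) ∧ ‖q.2 - x₀‖ ^ 2 ≤ t₀ := by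
    refine ((continuousAt_fst.eventually (Icc_mem_nhds (a := t₀ / 2) (b := 2 * t₀) ?_ ?_)).and ?_)
    · simp only; linarith
    · simp only; linarith
    · have : ContinuousAt (fun q : ℝ × Plane => ‖q.2 - x₀‖ ^ 2) (t₀, x₀) := by fun_prop
      refine this.eventually (Iic_mem_nhds ?_)
      simpa using ht₀
  have hlim : Tendsto (fun q : ℝ × Plane => ∫ y, heatKernel q.1 (q.2 - y) * g y) (𝓝 (t₀, x₀))
      (𝓝 (∫ y, heatKernel t₀ (x₀ - y) * g y)) := by
    refine tendsto_integral_filter_of_dominated_convergence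
      (fun y => 8 * Real.exp (1 / 8) * |heatKernel (4 * t₀) (x₀ - y) * g y|) ?_ ?_ ?_ ?_
    · exact Eventually.of_forall fun q => (aestronglyMeasurable_heatKernel_sub _ _).mul hg.aesm
    · filter_upwards [hnear] with q hq
      filter_upwards with y
      have hq0 : 0 < q.1 := by linarith [hq.1.1]
      rw [norm_mul, abs_mul, Real.norm_of_nonneg (heatKernel_pos hq0 _).le,
        abs_of_nonneg (heatKernel_pos (by positivity) _).le, ← mul_assoc]
      exact mul_le_mul_of_nonneg_right (heatKernel_le_of_near ht₀ hq.1.1 hq.1.2 hq.2 y)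
        (norm_nonneg _)
    · exact (hg.integrable _ (by positivity) x₀).abs.const_mul _
    · filter_upwards with y
      have hk : ContinuousAt (fun q : ℝ × Plane => heatKernel q.1 q.2) (t₀, x₀ - y) :=
        continuousOn_heatKernel.continuousAt
          ((isOpen_Ioi.prod isOpen_univ).mem_nhds ⟨ht₀, mem_univ _⟩)
      have hk2 : ContinuousAt (fun q : ℝ × Plane => (q.1, q.2 - y)) (t₀, x₀) := by fun_prop
      exact (ContinuousAt.comp (f := fun q : ℝ × Plane => (q.1, q.2 - y)) hk hk2).tendsto.mul_const
        (g y)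
  unfold ContinuousAt
  simp only
  rw [heat_eq ht₀]
  refine hlim.congr' ?_
  filter_upwards [hnear] with q hq
  rw [heat_eq (by linarith [hq.1.1])]

lemma HeatAdmissible.continuous_heat {g : Plane → ℝ} (hg : HeatAdmissible g) {t : ℝ}
    (ht : 0 < t) : Continuous (heat t g) :=
  continuous_iff_continuousAt.2 fun x =>
    ContinuousAt.comp (f := fun x : Plane => (t, x)) (g := fun q : ℝ × Plane => heat q.1 g q.2)
      (hg.continuousOn_heat.continuousAt
        ((isOpen_Ioi.prod isOpen_univ).mem_nhds ⟨ht, mem_univ _⟩)) (by fun_prop)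

/-- Iterating the heat flow of admissible data gives admissible data. -/
lemma HeatAdmissible.heat_flow {g : Plane → ℝ} (hg : HeatAdmissible g) {s : ℝ} (hs : 0 < s) :
    HeatAdmissible (heat s g) where
  aesm := (hg.continuous_heat hs).aestronglyMeasurable
  integrable _ ht x := hg.integrable_mul_heat ht hs x

/-- Jensen's inequality for the heat flow; convexity of `h` on `[0, ∞)` enters as the existence
of supporting lines. -/
lemma comp_heat_le_heat_comp {h : ℝ → ℝ}
    (hconv : ∀ b, 0 ≤ b → ∃ k, ∀ a, 0 ≤ a → h b + k * (a - b) ≤ h a) {g : Plane → ℝ}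
    (hg : HeatAdmissible g) (h0 : ∀ᵐ y, 0 ≤ g y) (hh : HeatAdmissible fun y => h (g y))
    {t : ℝ} (ht : 0 < t) (x : Plane) : h (heat t g x) ≤ heat t (fun y => h (g y)) x := by
  set b := heat t g x with hb
  obtain ⟨k, hk⟩ := hconv b (heat_nonneg ht h0 x)
  have h1 : heat t (fun y => (h b - k * b) + k * g y) x = h b := by
    rw [heat_add ht (HeatAdmissible.const _) (hg.const_mul k), heat_const ht,
      heat_const_mul ht, ← hb]
    ring
  rw [← h1]
  refine heat_mono ht ((HeatAdmissible.const _).add (hg.const_mul k)) hh ?_ x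
  filter_upwards [h0] with y hy
  linarith [hk _ hy]

lemma exists_support_exp_half_sq (b : ℝ) :
    ∃ k, ∀ a, 0 ≤ a → Real.exp (b ^ 2 / 2) + k * (a - b) ≤ Real.exp (a ^ 2 / 2) := by
  refine ⟨b * Real.exp (b ^ 2 / 2), fun a ha => ?_⟩
  have h1 : Real.exp (a ^ 2 / 2) = Real.exp (b ^ 2 / 2) * Real.exp (a ^ 2 / 2 - b ^ 2 / 2) := by
    rw [← Real.exp_add]; ring_nf
  have h2 := Real.add_one_le_exp (a ^ 2 / 2 - b ^ 2 / 2)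
  have h3 : 1 + b * (a - b) ≤ Real.exp (a ^ 2 / 2 - b ^ 2 / 2) := by
    nlinarith [sq_nonneg (a - b)]
  rw [h1]
  nlinarith [mul_le_mul_of_nonneg_left h3 (Real.exp_pos (b ^ 2 / 2)).le]

lemma exists_support_mul_exp_half_sq {b : ℝ} (hb : 0 ≤ b) :
    ∃ k, ∀ a, 0 ≤ a → b * Real.exp (b ^ 2 / 2) + k * (a - b) ≤ a * Real.exp (a ^ 2 / 2) := by
  refine ⟨(1 + b ^ 2) * Real.exp (b ^ 2 / 2), fun a ha => ?_⟩
  have h1 : Real.exp (a ^ 2 / 2) = Real.exp (b ^ 2 / 2) * Real.exp (a ^ 2 / 2 - b ^ 2 / 2) := by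
    rw [← Real.exp_add]; ring_nf
  have h2 := Real.add_one_le_exp (a ^ 2 / 2 - b ^ 2 / 2)
  have h3 : 1 + b * (a - b) ≤ Real.exp (a ^ 2 / 2 - b ^ 2 / 2) := by
    nlinarith [sq_nonneg (a - b)]
  have h4 : b + (1 + b ^ 2) * (a - b) ≤ a * Real.exp (a ^ 2 / 2 - b ^ 2 / 2) := by
    nlinarith [mul_le_mul_of_nonneg_left h3 ha, mul_nonneg hb (sq_nonneg (a - b))]
  rw [h1]
  nlinarith [mul_le_mul_of_nonneg_left h4 (Real.exp_pos (b ^ 2 / 2)).le]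

lemma exists_support_rpow {q : ℝ} (hq : 1 ≤ q) {b : ℝ} (hb : 0 ≤ b) :
    ∃ k, ∀ a, 0 ≤ a → b ^ q + k * (a - b) ≤ a ^ q := by
  rcases hb.eq_or_lt with rfl | hb
  · refine ⟨0, fun a ha => ?_⟩
    rw [Real.zero_rpow (by linarith)]
    simpa using Real.rpow_nonneg ha q
  · refine ⟨b ^ q * (q / b), fun a ha => ?_⟩
    have h1 := one_add_mul_self_le_rpow_one_add (s := a / b - 1)
      (by linarith [div_nonneg ha hb.le]) hq
    have h2 : a ^ q = b ^ q * (a / b) ^ q := by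
      rw [← Real.mul_rpow hb.le (by positivity), mul_div_cancel₀ _ hb.ne']
    rw [add_sub_cancel] at h1
    rw [h2]
    calc b ^ q + b ^ q * (q / b) * (a - b) = b ^ q * (1 + q * (a / b - 1)) := by
          field_simp
      _ ≤ _ := mul_le_mul_of_nonneg_left h1 (by positivity)

lemma tendsto_sq_mul_heatKernel_one :
    Tendsto (fun x : Plane => ‖x‖ ^ 2 * heatKernel 1 x) (Bornology.cobounded Plane) (𝓝 0) := by
  have h1 := (Real.tendsto_pow_mul_exp_neg_atTop_nhds_zero 1).comp
    (((tendsto_pow_atTop (α := ℝ) two_ne_zero).comp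
      (tendsto_norm_cobounded_atTop (E := Plane))).atTop_div_const (by norm_num : (0 : ℝ) < 4))
  have h2 := h1.const_mul (Real.pi⁻¹)
  rw [mul_zero] at h2
  refine h2.congr fun x => ?_
  have := Real.pi_pos
  simp only [Function.comp, heatKernel, pow_one]
  rw [neg_div, mul_one, mul_one]
  field_simp

/-- Pointwise initial trace at continuity points, as a peak function argument for
`heatKernel t z = t⁻¹ heatKernel 1 (z / √t)`. -/
lemma tendsto_heat {g : Plane → ℝ} (hg : Integrable g) {x : Plane} (hx : ContinuousAt g x) :
    Tendsto (fun t => heat t g x) (𝓝[>] 0) (𝓝 (g x)) := by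
  have hfin : Module.finrank ℝ Plane = 2 := by simp
  have h1 := tendsto_integral_comp_smul_smul_of_integrable' (μ := (volume : Measure Plane))
    (φ := heatKernel 1) (fun x => (heatKernel_pos one_pos x).le) (integral_heatKernel one_pos)
    (by rw [hfin]; exact tendsto_sq_mul_heatKernel_one) hg hx
  have h2 : Tendsto (fun t : ℝ => (Real.sqrt t)⁻¹) (𝓝[>] 0) atTop := by
    refine tendsto_inv_nhdsGT_zero.comp (tendsto_nhdsWithin_iff.2 ⟨?_, ?_⟩)
    · have := (Real.continuous_sqrt.tendsto 0).mono_left (nhdsWithin_le_nhds (s := Ioi 0))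
      rwa [Real.sqrt_zero] at this
    · filter_upwards [self_mem_nhdsWithin] with t ht using Real.sqrt_pos.2 ht
  refine (h1.comp h2).congr' ?_
  filter_upwards [self_mem_nhdsWithin] with t (ht : 0 < t)
  rw [heat_eq ht]
  refine integral_congr_ae (Eventually.of_forall fun y => ?_)
  have := Real.pi_pos
  simp only [hfin, heatKernel, norm_smul, smul_eq_mul, norm_inv, inv_pow, mul_pow,
    Real.norm_of_nonneg (Real.sqrt_nonneg t), Real.sq_sqrt ht.le]
  rw [← mul_assoc]
  congr 2
  · field_simp
  · congr 1
    field_simp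

/-- Scheffé's argument: the heat flow of a nonnegative function conserves the integral, so that
pointwise convergence at time zero implies convergence in `L¹`. -/
lemma tendsto_integral_abs_heat_sub {g : Plane → ℝ} (hg : Integrable g) (h0 : ∀ᵐ y, 0 ≤ g y)
    (hc : ∀ᵐ y, ContinuousAt g y) :
    Tendsto (fun t => ∫ x, |heat t g x - g x|) (𝓝[>] 0) (𝓝 0) := by
  have h1 : Tendsto (fun t => ∫ x, max (g x - heat t g x) 0) (𝓝[>] 0) (𝓝 (∫ _ : Plane, 0)) := by
    refine tendsto_integral_filter_of_dominated_convergence g ?_ ?_ hg ?_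
    · filter_upwards [self_mem_nhdsWithin] with t (ht : 0 < t)
      exact (hg.sub (integrable_heat hg ht)).pos_part.1
    · filter_upwards [self_mem_nhdsWithin] with t (ht : 0 < t)
      filter_upwards [h0] with y hy
      rw [Real.norm_of_nonneg (le_max_right _ _)]
      exact max_le (by linarith [heat_nonneg ht h0 y]) hy
    · filter_upwards [hc] with y hy
      have := ((tendsto_heat hg hy).const_sub (g y)).max (tendsto_const_nhds (x := (0 : ℝ)))
      simpa using this
  rw [integral_zero] at h1
  have h2 := h1.const_mul 2
  rw [mul_zero] at h2
  refine h2.congr' ?_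
  filter_upwards [self_mem_nhdsWithin] with t (ht : 0 < t)
  have hi := integrable_heat hg ht
  have h3 : ∀ x, |heat t g x - g x| = (heat t g x - g x) + 2 * max (g x - heat t g x) 0 := by
    intro x
    rcases le_total (g x) (heat t g x) with h | h
    · rw [abs_of_nonneg (by linarith), max_eq_right (by linarith)]; ring
    · rw [abs_of_nonpos (by linarith), max_eq_left (by linarith)]; ring
  simp_rw [h3]
  have h4 : Integrable fun x => heat t g x - g x := hi.sub hg
  have h5 : Integrable fun x => 2 * max (g x - heat t g x) 0 := (hg.sub hi).pos_part.const_mul 2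
  rw [integral_add h4 h5, integral_sub hi hg, integral_heat hg ht, sub_self, zero_add,
    integral_const_mul]

lemma tendsto_eLpNorm_zero_of_le {ι : Type*} {l : Filter ι} {F h : ι → Plane → ℝ} {p : ℝ≥0∞}
    (hp : 1 ≤ p) (hp' : p ≠ ⊤) (hi : ∀ᶠ i in l, Integrable (h i))
    (hle : ∀ᶠ i in l, ∀ᵐ x, |F i x| ^ p.toReal ≤ h i x)
    (hlim : Tendsto (fun i => ∫ x, h i x) l (𝓝 0)) :
    Tendsto (fun i => eLpNorm (F i) p volume) l (𝓝 0) := by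
  have hp0 : p ≠ 0 := (one_pos.trans_le hp).ne'
  have hq : 0 < p.toReal := ENNReal.toReal_pos hp0 hp'
  have h1 : Tendsto (fun i => (ENNReal.ofReal (∫ x, h i x)) ^ (1 / p.toReal)) l (𝓝 0) := by
    have h2 := (ENNReal.continuous_rpow_const (y := 1 / p.toReal)).tendsto 0
    rw [ENNReal.zero_rpow_of_pos (by positivity)] at h2
    refine h2.comp ?_
    have := ENNReal.tendsto_ofReal hlim
    rwa [ENNReal.ofReal_zero] at this
  refine tendsto_of_tendsto_of_tendsto_of_le_of_le' tendsto_const_nhds h1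
    (Eventually.of_forall fun _ => bot_le) ?_
  filter_upwards [hi, hle] with i hi hle
  rw [eLpNorm_eq_lintegral_rpow_enorm_toReal hp0 hp']
  refine ENNReal.rpow_le_rpow ?_ (by positivity)
  have h3 : 0 ≤ᵐ[volume] h i := by
    filter_upwards [hle] with x hx using (Real.rpow_nonneg (abs_nonneg _) _).trans hx
  rw [ofReal_integral_eq_lintegral_ofReal hi h3]
  refine lintegral_mono_ae ?_
  filter_upwards [hle] with x hx
  rw [← ofReal_norm, ENNReal.ofReal_rpow_of_nonneg (norm_nonneg _) hq.le]
  exact ENNReal.ofReal_le_ofReal hx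

lemma memLp_of_rpow_le {F h : Plane → ℝ} {p : ℝ≥0∞} (hp : 1 ≤ p) (hp' : p ≠ ⊤)
    (hF : AEStronglyMeasurable F) (hi : Integrable h)
    (hle : ∀ᵐ x, |F x| ^ p.toReal ≤ h x) : MemLp F p volume := by
  have hp0 : p ≠ 0 := (one_pos.trans_le hp).ne'
  rw [← integrable_norm_rpow_iff hF hp0 hp']
  refine hi.mono' (hF.norm.aemeasurable.pow_const _).aestronglyMeasurable ?_
  filter_upwards [hle] with x hx
  rwa [Real.norm_of_nonneg (Real.rpow_nonneg (norm_nonneg _) _)]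

lemma abs_sub_rpow_le {q a b c : ℝ} (hq : 1 ≤ q) (ha : 0 ≤ a) (hb : 0 ≤ b) (hac : a ^ q ≤ c) :
    |a - b| ^ q ≤ |c - b ^ q| + max (b ^ q - a ^ q) 0 := by
  rcases le_total b a with h | h
  · have h1 := Real.add_rpow_le_rpow_add (sub_nonneg.2 h) hb hq
    rw [sub_add_cancel] at h1
    rw [abs_of_nonneg (sub_nonneg.2 h)]
    linarith [le_abs_self (c - b ^ q), le_max_right (b ^ q - a ^ q) 0]
  · have h1 := Real.add_rpow_le_rpow_add (sub_nonneg.2 h) ha hq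
    rw [sub_add_cancel] at h1
    rw [abs_sub_comm, abs_of_nonneg (sub_nonneg.2 h)]
    linarith [abs_nonneg (c - b ^ q), le_max_left (b ^ q - a ^ q) 0]

/-- Continuity of the heat flow in `L^p` at time zero, from the case `p = 1` applied to `g ^ p`
and the inequalities `|a - b|^p ≤ |a^p - b^p|` and `(e^{tΔ} g)^p ≤ e^{tΔ} g^p`. -/
lemma tendsto_eLpNorm_heat_sub {g : Plane → ℝ} (hg : Integrable g) (h0 : ∀ᵐ y, 0 ≤ g y)
    (hc : ∀ᵐ y, ContinuousAt g y) {p : ℝ≥0∞} (hp : 1 ≤ p) (hp' : p ≠ ⊤)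
    (hgp : Integrable fun x => g x ^ p.toReal) :
    Tendsto (fun t => eLpNorm (fun x => heat t g x - g x) p volume) (𝓝[>] 0) (𝓝 0) := by
  have hq : 1 ≤ p.toReal := by
    rw [← ENNReal.toReal_one]; exact ENNReal.toReal_mono hp' hp
  set q := p.toReal
  have hq0 : 0 < q := by linarith
  have h0q : ∀ᵐ y, 0 ≤ g y ^ q := by filter_upwards [h0] with y hy using Real.rpow_nonneg hy q
  have hmeas : ∀ t, 0 < t → AEStronglyMeasurable fun x => g x ^ q - heat t g x ^ q := by
    intro t ht
    exact hgp.1.sub (((integrable_heat hg ht).1.aemeasurable.pow_const q).aestronglyMeasurable)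
  have hbound : ∀ t, 0 < t → ∀ᵐ x, ‖max (g x ^ q - heat t g x ^ q) 0‖ ≤ g x ^ q := by
    intro t ht
    filter_upwards [h0q] with y hy
    rw [Real.norm_of_nonneg (le_max_right _ _)]
    exact max_le (by linarith [Real.rpow_nonneg (heat_nonneg ht h0 y) q]) hy
  have hint : ∀ t, 0 < t → Integrable fun x => max (g x ^ q - heat t g x ^ q) 0 := fun t ht =>
    hgp.mono' ((hmeas t ht).sup aestronglyMeasurable_const) (hbound t ht)
  have h1 : Tendsto (fun t => ∫ x, max (g x ^ q - heat t g x ^ q) 0) (𝓝[>] 0)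
      (𝓝 (∫ _ : Plane, 0)) := by
    refine tendsto_integral_filter_of_dominated_convergence (fun x => g x ^ q) ?_ ?_ hgp ?_
    · filter_upwards [self_mem_nhdsWithin] with t (ht : 0 < t)
      exact (hint t ht).1
    · filter_upwards [self_mem_nhdsWithin] with t (ht : 0 < t) using hbound t ht
    · filter_upwards [hc] with y hy
      have := (((tendsto_heat hg hy).rpow_const (Or.inr hq0.le)).const_sub (g y ^ q)).max (tendsto_const_nhds (x := (0 : ℝ)))
      simpa using this
  rw [integral_zero] at h1
  have hcq : ∀ᵐ y, ContinuousAt (fun x => g x ^ q) y := by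
    filter_upwards [hc] with y hy using hy.rpow_const (Or.inr hq0.le)
  have h2 := (tendsto_integral_abs_heat_sub hgp h0q hcq).add h1
  rw [add_zero] at h2
  refine tendsto_eLpNorm_zero_of_le (F := fun t x => heat t g x - g x)
    (h := fun t x => |heat t (fun x => g x ^ q) x - g x ^ q| +
      max (g x ^ q - heat t g x ^ q) 0) hp hp' ?_ ?_ (h2.congr' ?_)
  · filter_upwards [self_mem_nhdsWithin] with t (ht : 0 < t)
    exact ((integrable_heat hgp ht).sub hgp).abs.add (hint t ht)
  · filter_upwards [self_mem_nhdsWithin] with t (ht : 0 < t)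
    filter_upwards [h0] with x hx
    exact abs_sub_rpow_le hq (heat_nonneg ht h0 x) hx
      (comp_heat_le_heat_comp (h := fun s => s ^ q) (fun b hb => exists_support_rpow hq hb)
        (HeatAdmissible.of_integrable hg) h0 (HeatAdmissible.of_integrable hgp) ht x)
  · filter_upwards [self_mem_nhdsWithin] with t (ht : 0 < t)
    exact (integral_add ((integrable_heat hgp ht).sub hgp).abs (hint t ht)).symm

/-! ### The Duhamel integral of a dominated source -/

/-- The Duhamel integral `∫₀ᵗ e^{(t-s)Δ} F(s) ds`. -/
def duhamelIntegral (F : ℝ → Plane → ℝ) (t : ℝ) (x : Plane) : ℝ :=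
  ∫ s in (0 : ℝ)..t, heat (t - s) (F s) x

/-- A continuous source on `(0, T)` dominated by `b(s) e^{sΔ} h` with an integrable weight `b`.
By the semigroup property `e^{(t-s)Δ} e^{sΔ} h = e^{tΔ} h`, such a source has a Duhamel integral
dominated by `(∫₀ᵗ b) e^{tΔ} h`. -/
structure IsDominatedSource (T : ℝ) (b : ℝ → ℝ) (h : Plane → ℝ) (F : ℝ → Plane → ℝ) : Prop where
  continuousOn : ContinuousOn (fun q : ℝ × Plane => F q.1 q.2) (Ioo 0 T ×ˢ univ)
  weight_integrable : IntegrableOn b (Ioo 0 T)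
  weight_nonneg : ∀ s ∈ Ioo 0 T, 0 ≤ b s
  admissible : HeatAdmissible h
  abs_le : ∀ s ∈ Ioo 0 T, ∀ y, |F s y| ≤ b s * heat s h y

lemma continuous_slice {T : ℝ} {F : ℝ → Plane → ℝ}
    (hF : ContinuousOn (fun q : ℝ × Plane => F q.1 q.2) (Ioo 0 T ×ˢ univ)) {s : ℝ}
    (hs : s ∈ Ioo 0 T) : Continuous (F s) :=
  continuous_iff_continuousAt.2 fun x =>
    ContinuousAt.comp (f := fun x : Plane => (s, x)) (g := fun q : ℝ × Plane => F q.1 q.2)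
      (hF.continuousAt ((isOpen_Ioo.prod isOpen_univ).mem_nhds ⟨hs, mem_univ _⟩)) (by fun_prop)

lemma duhamelIntegral_eq_setIntegral (F : ℝ → Plane → ℝ) {t : ℝ} (ht : 0 ≤ t) (x : Plane) :
    duhamelIntegral F t x = ∫ s in Ioo 0 t, heat (t - s) (F s) x := by
  rw [duhamelIntegral, intervalIntegral.integral_of_le ht, integral_Ioc_eq_integral_Ioo]

namespace IsDominatedSource

variable {T : ℝ} {b : ℝ → ℝ} {h : Plane → ℝ} {F : ℝ → Plane → ℝ}

lemma slice_admissible (H : IsDominatedSource T b h F) {s : ℝ} (hs : s ∈ Ioo 0 T) :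
    HeatAdmissible (F s) :=
  ((H.admissible.heat_flow hs.1).const_mul (b s)).mono
    (continuous_slice H.continuousOn hs).aestronglyMeasurable
    (Eventually.of_forall fun y => H.abs_le s hs y)

lemma heat_weight (H : IsDominatedSource T b h F) {s t : ℝ} (hs : 0 < s) (hst : s < t)
    (x : Plane) : heat (t - s) (fun y => b s * heat s h y) x = b s * heat t h x := by
  rw [heat_const_mul (sub_pos.2 hst), heat_heat H.admissible (sub_pos.2 hst) hs, sub_add_cancel]

lemma abs_heat_slice_le (H : IsDominatedSource T b h F) {s t : ℝ} (hs : s ∈ Ioo 0 T)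
    (hst : s < t) (x : Plane) : |heat (t - s) (F s) x| ≤ b s * heat t h x := by
  rw [← H.heat_weight hs.1 hst]
  exact abs_heat_le (sub_pos.2 hst) ((H.admissible.heat_flow hs.1).const_mul (b s))
    (Eventually.of_forall fun y => H.abs_le s hs y) x

lemma integrable_prod (H : IsDominatedSource T b h F) {t : ℝ} (ht : t ∈ Ioo 0 T) (x : Plane) :
    Integrable (fun q : ℝ × Plane => heatKernel (t - q.1) (x - q.2) * F q.1 q.2)
      ((volume.restrict (Ioo 0 t)).prod volume) := by
  have hsub : Ioo 0 t ⊆ Ioo 0 T := Ioo_subset_Ioo_right ht.2.le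
  have hm : AEStronglyMeasurable
      (fun q : ℝ × Plane => heatKernel (t - q.1) (x - q.2) * F q.1 q.2)
      ((volume.restrict (Ioo 0 t)).prod volume) := by
    refine AEStronglyMeasurable.mul ?_ ?_
    · exact (measurable_heatKernel.comp (by fun_prop :
        Measurable fun q : ℝ × Plane => (t - q.1, x - q.2))).aestronglyMeasurable
    · have h1 := (H.continuousOn.mono (prod_mono_left hsub)).aestronglyMeasurable
        (μ := volume.prod volume) (measurableSet_Ioo.prod MeasurableSet.univ)
      rwa [← Measure.prod_restrict, Measure.restrict_univ] at h1
  rw [integrable_prod_iff hm]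
  constructor
  · refine (ae_restrict_iff' measurableSet_Ioo).2 (Eventually.of_forall fun s hs => ?_)
    exact (H.slice_admissible (hsub hs)).integrable _ (sub_pos.2 hs.2) x
  · refine Integrable.mono' ((H.weight_integrable.mono_set hsub).mul_const (heat t h x))
      hm.norm.integral_prod_right' ?_
    refine (ae_restrict_iff' measurableSet_Ioo).2 (Eventually.of_forall fun s hs => ?_)
    have hs' := hsub hs
    have hts := sub_pos.2 hs.2
    rw [Real.norm_of_nonneg (integral_nonneg fun _ => norm_nonneg _),
      ← H.heat_weight hs.1 hs.2, heat_eq hts]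
    refine integral_mono ((H.slice_admissible hs').integrable _ hts x).norm
      (((H.admissible.heat_flow hs.1).const_mul (b s)).integrable _ hts x) fun y => ?_
    simp only
    rw [norm_mul, Real.norm_of_nonneg (heatKernel_pos hts _).le]
    exact mul_le_mul_of_nonneg_left (H.abs_le s hs' y) (heatKernel_pos hts _).le

lemma integrableOn_prod (H : IsDominatedSource T b h F) {t : ℝ} (ht : t ∈ Ioo 0 T) (x : Plane) :
    IntegrableOn (fun q : ℝ × Plane => heatKernel (t - q.1) (x - q.2) * F q.1 q.2)
      (Ioo 0 t ×ˢ univ) volume := by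
  have h1 := H.integrable_prod ht x
  rw [IntegrableOn, Measure.volume_eq_prod, ← Measure.prod_restrict, Measure.restrict_univ]
  exact h1

lemma integrableOn_heat_slice (H : IsDominatedSource T b h F) {t : ℝ} (ht : t ∈ Ioo 0 T)
    (x : Plane) : IntegrableOn (fun s => heat (t - s) (F s) x) (Ioo 0 t) := by
  refine (H.integrable_prod ht x).integral_prod_left.congr ?_
  refine (ae_restrict_iff' measurableSet_Ioo).2 (Eventually.of_forall fun s hs => ?_)
  exact (heat_eq (sub_pos.2 hs.2) _ _).symm

lemma abs_duhamelIntegral_le (H : IsDominatedSource T b h F) {t : ℝ} (ht : t ∈ Ioo 0 T)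
    (x : Plane) : |duhamelIntegral F t x| ≤ (∫ s in Ioo 0 t, b s) * heat t h x := by
  rw [duhamelIntegral_eq_setIntegral F ht.1.le, ← integral_mul_const, ← Real.norm_eq_abs]
  refine norm_integral_le_of_norm_le
    ((H.weight_integrable.mono_set (Ioo_subset_Ioo_right ht.2.le)).mul_const _) ?_
  refine (ae_restrict_iff' measurableSet_Ioo).2 (Eventually.of_forall fun s hs => ?_)
  exact H.abs_heat_slice_le ⟨hs.1, hs.2.trans ht.2⟩ hs.2 x

lemma continuousOn_duhamelIntegral (H : IsDominatedSource T b h F) :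
    ContinuousOn (fun q : ℝ × Plane => duhamelIntegral F q.1 q.2) (Ioo 0 T ×ˢ univ) := by
  rintro ⟨t₀, x₀⟩ ⟨ht₀, -⟩
  have ht₀ : t₀ ∈ Ioo 0 T := ht₀
  refine ContinuousAt.continuousWithinAt ?_
  have hD : ∀ t ∈ Ioo 0 T, ∀ x, duhamelIntegral F t x =
      ∫ s in Ioo 0 T, (Iio t).indicator (fun s => heat (t - s) (F s) x) s := by
    intro t ht x
    rw [setIntegral_indicator measurableSet_Iio, duhamelIntegral_eq_setIntegral F ht.1.le,
      Ioo_inter_Iio, min_eq_right ht.2.le]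
  have hcont : ContinuousAt (fun q : ℝ × Plane => heat q.1 h q.2) (t₀, x₀) :=
    H.admissible.continuousOn_heat.continuousAt
      ((isOpen_Ioi.prod isOpen_univ).mem_nhds ⟨ht₀.1, mem_univ _⟩)
  have hnear : ∀ᶠ q : ℝ × Plane in 𝓝 (t₀, x₀), q.1 ∈ Ioo 0 T ∧
      heat q.1 h q.2 ≤ heat t₀ h x₀ + 1 :=
    (continuousAt_fst.eventually (Ioo_mem_nhds ht₀.1 ht₀.2)).and
      (hcont.eventually (Iic_mem_nhds (lt_add_one _)))
  unfold ContinuousAt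
  simp only
  rw [hD t₀ ht₀]
  refine Tendsto.congr' (f₁ := fun q : ℝ × Plane =>
    ∫ s in Ioo 0 T, (Iio q.1).indicator (fun s => heat (q.1 - s) (F s) q.2) s) ?_ ?_
  · filter_upwards [hnear] with q hq using (hD _ hq.1 _).symm
  refine tendsto_integral_filter_of_dominated_convergence
    (fun s => b s * |heat t₀ h x₀ + 1|) ?_ ?_ (H.weight_integrable.mul_const _) ?_
  · filter_upwards [hnear] with q hq
    rw [aestronglyMeasurable_indicator_iff measurableSet_Iio,
      Measure.restrict_restrict measurableSet_Iio, inter_comm, Ioo_inter_Iio,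
      min_eq_right hq.1.2.le]
    exact (H.integrableOn_heat_slice hq.1 _).1
  · filter_upwards [hnear] with q hq
    refine (ae_restrict_iff' measurableSet_Ioo).2 (Eventually.of_forall fun s hs => ?_)
    have hbs := H.weight_nonneg s hs
    by_cases hst : s < q.1
    · rw [indicator_of_mem (mem_Iio.2 hst)]
      exact (H.abs_heat_slice_le hs hst _).trans
        (mul_le_mul_of_nonneg_left (hq.2.trans (le_abs_self _)) hbs)
    · rw [indicator_of_notMem (by simpa using hst), norm_zero]
      positivity
  -- The integrand is continuous at `t₀` for `s < t₀` and vanishes near `t₀` for `s > t₀`.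
  · have hne : ∀ᵐ s ∂(volume.restrict (Ioo 0 T)), s ≠ t₀ :=
      ae_restrict_of_ae (Measure.ae_ne volume t₀)
    filter_upwards [hne, ae_restrict_mem measurableSet_Ioo] with s hs hsT
    rcases hs.lt_or_gt with hlt | hgt
    · rw [indicator_of_mem (mem_Iio.2 hlt)]
      have hc : ContinuousAt (fun q : ℝ × Plane => heat q.1 (F s) q.2) (t₀ - s, x₀) :=
        (H.slice_admissible hsT).continuousOn_heat.continuousAt
          ((isOpen_Ioi.prod isOpen_univ).mem_nhds ⟨sub_pos.2 hlt, mem_univ _⟩)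
      have hc2 : ContinuousAt (fun q : ℝ × Plane => (q.1 - s, q.2)) (t₀, x₀) := by fun_prop
      refine (ContinuousAt.comp (f := fun q : ℝ × Plane => (q.1 - s, q.2)) hc hc2).tendsto.congr' ?_
      filter_upwards [continuousAt_fst.eventually (Ioi_mem_nhds hlt)] with q hq
      rw [indicator_of_mem (mem_Iio.2 hq)]
      rfl
    · rw [indicator_of_notMem (by simpa using hgt.le)]
      refine tendsto_const_nhds.congr' ?_
      filter_upwards [continuousAt_fst.eventually (Iio_mem_nhds hgt)] with q hq
      have hq : q.1 < s := hq
      rw [indicator_of_notMem (by simpa using hq.le)]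

end IsDominatedSource

/-! ### Picard iteration in a weighted ball -/

/-- The functions `v`, continuous on `S`, with `w |v| ≤ 1` on `S`. -/
def weightedBall {α : Type*} [TopologicalSpace α] (S : Set α) (w : α → ℝ) : Set (α → ℝ) :=
  {v | ContinuousOn v S ∧ ∀ q ∈ S, w q * |v q| ≤ 1}

/-- The contraction principle in a weighted ball of functions on `S`, for a map `Γ` that halves
weighted distances. Functions are defined on the whole space and are compared on `S` only. The
fixed point is the limit of the iterates of `0`, so it inherits each bound `|v| ≤ β` that `Γ`
preserves. -/
lemma exists_fixedPoint_weightedBall {α : Type*} [TopologicalSpace α] {S : Set α} {w : α → ℝ}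
    (hw : ContinuousOn w S) (hw0 : ∀ q ∈ S, 0 < w q) {Γ : (α → ℝ) → α → ℝ}
    (hmaps : ∀ v ∈ weightedBall S w, Γ v ∈ weightedBall S w)
    (hcontr : ∀ v₁ ∈ weightedBall S w, ∀ v₂ ∈ weightedBall S w, ∀ d, 0 ≤ d →
      (∀ q ∈ S, w q * |v₁ q - v₂ q| ≤ d) → ∀ q ∈ S, w q * |Γ v₁ q - Γ v₂ q| ≤ d / 2)
    {β : α → ℝ} (hβ0 : ∀ q ∈ S, 0 ≤ β q)
    (hβ : ∀ v ∈ weightedBall S w, (∀ q ∈ S, |v q| ≤ β q) → ∀ q ∈ S, |Γ v q| ≤ β q) :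
    ∃ v ∈ weightedBall S w, (∀ q ∈ S, Γ v q = v q) ∧ (∀ q ∈ S, |v q| ≤ β q) ∧
      ∀ v' ∈ weightedBall S w, (∀ q ∈ S, Γ v' q = v' q) → ∀ q ∈ S, v' q = v q := by
  have hdist : ∀ v₁ ∈ weightedBall S w, ∀ v₂ ∈ weightedBall S w, ∀ q ∈ S,
      w q * |v₁ q - v₂ q| ≤ 2 := by
    intro v₁ h₁ v₂ h₂ q hq
    calc w q * |v₁ q - v₂ q| ≤ w q * (|v₁ q| + |v₂ q|) :=
          mul_le_mul_of_nonneg_left (abs_sub _ _) (hw0 q hq).le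
      _ ≤ 2 := by linarith [h₁.2 q hq, h₂.2 q hq]
  set a : ℕ → α → ℝ := fun n => Γ^[n] 0 with ha
  have hsucc : ∀ n, a (n + 1) = Γ (a n) := fun n => Function.iterate_succ_apply' Γ n 0
  have hball : ∀ n, a n ∈ weightedBall S w := by
    intro n
    induction n with
    | zero =>
      exact ⟨continuousOn_const, fun q _ => by simp [ha]⟩
    | succ n ih => rw [hsucc]; exact hmaps _ ih
  have habeta : ∀ n, ∀ q ∈ S, |a n q| ≤ β q := by
    intro n
    induction n with
    | zero => intro q hq; simpa [ha] using hβ0 q hq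
    | succ n ih => rw [hsucc]; exact hβ _ (hball n) ih
  have hstep : ∀ n, ∀ q ∈ S, w q * |a n q - a (n + 1) q| ≤ 2 / 2 ^ n := by
    intro n
    induction n with
    | zero => intro q hq; simpa using hdist _ (hball 0) _ (hball 1) q hq
    | succ n ih =>
      intro q hq
      rw [hsucc n, hsucc (n + 1)]
      refine (hcontr _ (hball n) _ (hball (n + 1)) _ (by positivity) ih q hq).trans_eq ?_
      rw [pow_succ]; field_simp
  have hstep' : ∀ q ∈ S, ∀ n, dist (w q * a n q) (w q * a (n + 1) q) ≤ 2 * (1 / 2) ^ n := by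
    intro q hq n
    rw [Real.dist_eq, ← mul_sub, abs_mul, abs_of_pos (hw0 q hq), one_div, inv_pow,
      ← div_eq_mul_inv]
    exact hstep n q hq
  have hex : ∀ q, ∃ l, q ∈ S → Tendsto (fun n => w q * a n q) atTop (𝓝 l) := by
    intro q
    by_cases hq : q ∈ S
    · obtain ⟨l, hl⟩ := cauchySeq_tendsto_of_complete
        (cauchySeq_of_le_geometric _ _ (by norm_num) (hstep' q hq))
      exact ⟨l, fun _ => hl⟩
    · exact ⟨0, fun h => absurd h hq⟩
  choose l hl using hex
  have hlim : ∀ q ∈ S, Tendsto (fun n => a n q) atTop (𝓝 (l q / w q)) := by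
    intro q hq
    refine ((hl q hq).div_const (w q)).congr fun n => ?_
    rw [mul_div_cancel_left₀ _ (hw0 q hq).ne']
  have hrate : ∀ n, ∀ q ∈ S, |w q * a n q - l q| ≤ 4 / 2 ^ n := by
    intro n q hq
    have := dist_le_of_le_geometric_of_tendsto _ _ (by norm_num) (hstep' q hq) (hl q hq) n
    rw [Real.dist_eq] at this
    refine this.trans_eq ?_
    rw [one_div, inv_pow]; ring
  have hgeom : Tendsto (fun n : ℕ => (4 : ℝ) / 2 ^ n) atTop (𝓝 0) :=
    tendsto_const_nhds.div_atTop (tendsto_pow_atTop_atTop_of_one_lt one_lt_two)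
  have hlcont : ContinuousOn l S := by
    refine TendstoUniformlyOn.continuousOn (F := fun n q => w q * a n q) (p := atTop) ?_
      (Eventually.of_forall fun n => hw.mul (hball n).1).frequently
    rw [Metric.tendstoUniformlyOn_iff]
    intro ε hε
    filter_upwards [hgeom.eventually (gt_mem_nhds hε)] with n hn q hq
    rw [dist_comm, Real.dist_eq]
    exact (hrate n q hq).trans_lt hn
  set v : α → ℝ := fun q => l q / w q with hv
  have hvball : v ∈ weightedBall S w := by
    refine ⟨hlcont.div hw fun q hq => (hw0 q hq).ne', fun q hq => ?_⟩
    exact le_of_tendsto ((hlim q hq).abs.const_mul (w q))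
      (Eventually.of_forall fun n => (hball n).2 q hq)
  have hvrate : ∀ n, ∀ q ∈ S, w q * |a n q - v q| ≤ 4 / 2 ^ n := by
    intro n q hq
    have h1 : w q * (a n q - v q) = w q * a n q - l q := by
      rw [mul_sub, hv, mul_div_cancel₀ _ (hw0 q hq).ne']
    calc w q * |a n q - v q| = |w q * (a n q - v q)| := by rw [abs_mul, abs_of_pos (hw0 q hq)]
      _ ≤ _ := by rw [h1]; exact hrate n q hq
  have hunique : ∀ v₁ ∈ weightedBall S w, ∀ v₂ ∈ weightedBall S w,
      (∀ q ∈ S, Γ v₁ q = v₁ q) → (∀ q ∈ S, Γ v₂ q = v₂ q) → ∀ q ∈ S, v₁ q = v₂ q := by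
    intro v₁ h₁ v₂ h₂ e₁ e₂
    have hn : ∀ n : ℕ, ∀ q ∈ S, w q * |v₁ q - v₂ q| ≤ 4 / 2 ^ n := by
      intro n
      induction n with
      | zero => intro q hq; linarith [hdist _ h₁ _ h₂ q hq]
      | succ n ih =>
        intro q hq
        rw [← e₁ q hq, ← e₂ q hq]
        refine (hcontr _ h₁ _ h₂ _ (by positivity) ih q hq).trans_eq ?_
        rw [pow_succ]; field_simp
    intro q hq
    have h3 : w q * |v₁ q - v₂ q| ≤ 0 :=
      ge_of_tendsto hgeom (Eventually.of_forall fun n => hn n q hq)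
    have h4 : |v₁ q - v₂ q| ≤ 0 := nonpos_of_mul_nonpos_right h3 (hw0 q hq)
    exact sub_eq_zero.1 (abs_nonpos_iff.1 h4)
  have hfix : ∀ q ∈ S, Γ v q = v q := by
    intro q hq
    have h1 : Tendsto (fun n => a (n + 1) q) atTop (𝓝 (Γ v q)) := by
      rw [tendsto_iff_dist_tendsto_zero]
      have h2 : Tendsto (fun n : ℕ => (4 : ℝ) / 2 ^ n / 2 / w q) atTop (𝓝 0) := by
        simpa using (hgeom.div_const 2).div_const (w q)
      refine squeeze_zero (fun _ => dist_nonneg) (fun n => ?_) h2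
      rw [Real.dist_eq, hsucc, le_div_iff₀ (hw0 q hq), mul_comm]
      exact hcontr _ (hball n) _ hvball _ (by positivity) (hvrate n) q hq
    exact tendsto_nhds_unique h1 ((hlim q hq).comp (tendsto_add_atTop_nat 1))
  exact ⟨v, hvball, hfix, fun q hq => le_of_tendsto (hlim q hq).abs
    (Eventually.of_forall fun n => habeta n q hq), fun v' h' e' =>
      hunique v' h' v hvball e' hfix⟩

/-! ### Pointwise bounds for the nonlinearity along the perturbed heat flow -/

/-- The bounds available for the heat flow `U` of the datum at a point `(σ², y)` of space-time,
with `q² = |log σ²|`: here `P` and `G` are the values there of the heat flows of `e^{g²/2}` and of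
`g e^{g²/2}`. -/
structure FlowBounds (A σ q U P G : ℝ) : Prop where
  one_le_const : 1 ≤ A
  pos : 0 < σ
  one_le : 1 ≤ q
  sq_eq : q ^ 2 = -2 * Real.log σ
  nonneg : 0 ≤ U
  exp_le : Real.exp (U ^ 2 / 2) ≤ P
  mul_exp_le : U * Real.exp (U ^ 2 / 2) ≤ G
  le : P ≤ A * (σ * q ^ 2)⁻¹

namespace FlowBounds

variable {A σ q U P G : ℝ}

/-- Taking logarithms in `e^{U²/2} ≤ P ≤ A / σ` gives `U = O(|log σ|^{1/2})`. -/
lemma flow_le (h : FlowBounds A σ q U P G) : U ≤ 2 * A * q := by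
  have hA := h.one_le_const
  have hq := h.one_le
  have hσ := h.pos
  have h1 : Real.exp (U ^ 2 / 2) ≤ A * σ⁻¹ := by
    refine (h.exp_le.trans h.le).trans (mul_le_mul_of_nonneg_left ?_ (by linarith))
    exact inv_anti₀ hσ (le_mul_of_one_le_right hσ.le (by nlinarith))
  have h2 : U ^ 2 / 2 ≤ Real.log A - Real.log σ := by
    rw [← Real.log_exp (U ^ 2 / 2), sub_eq_add_neg, ← Real.log_inv,
      ← Real.log_mul (by positivity) (by positivity)]
    exact Real.log_le_log (Real.exp_pos _) h1
  have h3 := Real.log_le_sub_one_of_pos (by linarith : 0 < A)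
  have hq2 : 1 ≤ q ^ 2 := one_le_pow₀ hq
  have h4 : U ^ 2 ≤ (2 * A * q) ^ 2 := by
    calc U ^ 2 ≤ 2 * (A - 1) * 1 + q ^ 2 := by linarith [h.sq_eq]
      _ ≤ 2 * (A - 1) * q ^ 2 + q ^ 2 := by nlinarith
      _ ≤ (2 * A * q) ^ 2 := by nlinarith
  exact (sq_le_sq₀ h.nonneg (by positivity)).1 h4

lemma add_inv_le (h : FlowBounds A σ q U P G) : U + q⁻¹ ≤ 3 * A * q := by
  have hq := h.one_le
  have : q⁻¹ ≤ 1 := inv_le_one_of_one_le₀ hq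
  nlinarith [h.flow_le, h.one_le_const]

/-- A perturbation of size `1/q` changes `U²` by `O(1)`, as `U = O(q)`. -/
lemma exp_sq_le (h : FlowBounds A σ q U P G) :
    Real.exp ((U + q⁻¹) ^ 2) ≤ Real.exp (4 * A + 1) * Real.exp (U ^ 2 / 2) ^ 2 := by
  have hq : 0 < q := by linarith [h.one_le]
  rw [sq (Real.exp _), ← Real.exp_add, ← Real.exp_add]
  refine Real.exp_le_exp.2 ?_
  have h1 : U * q⁻¹ ≤ 2 * A := by
    rw [← div_eq_mul_inv, div_le_iff₀ hq]; exact h.flow_le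
  have h2 : q⁻¹ ≤ 1 := inv_le_one_of_one_le₀ h.one_le
  nlinarith [inv_pos.2 hq]

lemma exp_sq_le_mul (h : FlowBounds A σ q U P G) :
    Real.exp ((U + q⁻¹) ^ 2) ≤ Real.exp (4 * A + 1) * (A * (σ * q ^ 2)⁻¹) * P := by
  have h1 : Real.exp (U ^ 2 / 2) ^ 2 ≤ A * (σ * q ^ 2)⁻¹ * P := by
    rw [sq]
    exact mul_le_mul (h.exp_le.trans h.le) h.exp_le (Real.exp_pos _).le
      ((Real.exp_pos _).le.trans (h.exp_le.trans h.le))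
  rw [mul_assoc]
  exact h.exp_sq_le.trans (mul_le_mul_of_nonneg_left h1 (Real.exp_pos _).le)

lemma abs_add_le (h : FlowBounds A σ q U P G) {v : ℝ} (hv : q * |v| ≤ 1) :
    |U + v| ≤ U + q⁻¹ := by
  have hq : 0 < q := by linarith [h.one_le]
  have h1 : |v| ≤ q⁻¹ := by
    rw [inv_eq_one_div, le_div_iff₀ hq, mul_comm]; exact hv
  calc |U + v| ≤ |U| + |v| := _root_.abs_add_le _ _
    _ ≤ _ := by rw [abs_of_nonneg h.nonneg]; linarith

variable {χ : ℝ → ℝ} {m : ℝ}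

/-- The nonlinearity is bounded by `P` times the weight `s^{-1/2} |log s|^{-1/2}`, at `s = σ²`. -/
lemma abs_nonlin_add_le (h : FlowBounds A σ q U P G) (hχ : IsCutoff χ) (hm : 0 ≤ m) {v : ℝ}
    (hv : q * |v| ≤ 1) : |nonlin χ m (U + v)| ≤
      (1 + m) * (3 * A ^ 2 * Real.exp (4 * A + 1)) * (σ * q)⁻¹ * P := by
  have hq : 0 < q := by linarith [h.one_le]
  have hA : 0 < A := by linarith [h.one_le_const]
  have hσ := h.pos
  have h1 := h.abs_add_le hv
  have hP : 0 < P := (Real.exp_pos _).trans_le h.exp_le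
  have h2 : Real.exp ((U + v) ^ 2) ≤ Real.exp ((U + q⁻¹) ^ 2) := by
    refine Real.exp_le_exp.2 ?_
    rw [← sq_abs (U + v)]
    exact pow_le_pow_left₀ (abs_nonneg _) h1 2
  calc |nonlin χ m (U + v)| ≤ (1 + m) * |U + v| * Real.exp ((U + v) ^ 2) :=
        abs_nonlin_le hχ hm _
    _ ≤ (1 + m) * (3 * A * q) * (Real.exp (4 * A + 1) * (A * (σ * q ^ 2)⁻¹) * P) := by
        refine mul_le_mul (mul_le_mul_of_nonneg_left (h1.trans h.add_inv_le) (by linarith))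
          (h2.trans h.exp_sq_le_mul) (Real.exp_pos _).le (by positivity)
    _ = _ := by field_simp

/-- For perturbations bounded by `σ G`, the nonlinearity is bounded by `G` times the weight
`s^{-1/2} |log s|^{-1}`: in `(U + |v|) e^{U²}` one of the two factors `e^{U²/2}` is absorbed by `G`
through `U e^{U²/2} ≤ G`, and by `σ e^{U²/2} ≤ A` in the term with `v`. -/
lemma abs_nonlin_add_le_of_le (h : FlowBounds A σ q U P G) (hχ : IsCutoff χ) (hm : 0 ≤ m)
    {v : ℝ} (hv : q * |v| ≤ 1) (hvG : |v| ≤ σ * G) : |nonlin χ m (U + v)| ≤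
      (1 + m) * (2 * A ^ 2 * Real.exp (4 * A + 1)) * (σ * q ^ 2)⁻¹ * G := by
  have hq := h.one_le
  have hA := h.one_le_const
  have hσ := h.pos
  have h1 := h.abs_add_le hv
  have hP : 0 < P := (Real.exp_pos _).trans_le h.exp_le
  have hG : 0 ≤ G := (mul_nonneg h.nonneg (Real.exp_pos _).le).trans h.mul_exp_le
  set a := Real.exp (U ^ 2 / 2) with ha
  have ha0 : 0 < a := Real.exp_pos _
  set B := Real.exp (4 * A + 1)
  have hB : 0 < B := Real.exp_pos _
  have h2 : Real.exp ((U + v) ^ 2) ≤ B * a ^ 2 := by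
    refine le_trans (Real.exp_le_exp.2 ?_) h.exp_sq_le
    rw [← sq_abs (U + v)]
    exact pow_le_pow_left₀ (abs_nonneg _) h1 2
  have h3 : |U + v| ≤ U + σ * G := by
    calc |U + v| ≤ |U| + |v| := _root_.abs_add_le _ _
      _ ≤ _ := by rw [abs_of_nonneg h.nonneg]; linarith
  have haA : a ≤ A * (σ * q ^ 2)⁻¹ := h.exp_le.trans h.le
  have hσa : σ * a ≤ A := by
    calc σ * a ≤ σ * (A * (σ * q ^ 2)⁻¹) := mul_le_mul_of_nonneg_left haA hσ.le
      _ = A * (q ^ 2)⁻¹ := by field_simp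
      _ ≤ A := mul_le_of_le_one_right (by linarith) (inv_le_one_of_one_le₀ (by nlinarith))
  have h4 : (U + σ * G) * a ^ 2 ≤ (1 + A) * G * (A * (σ * q ^ 2)⁻¹) := by
    calc (U + σ * G) * a ^ 2 = (U * a + σ * a * G) * a := by ring
      _ ≤ (G + A * G) * (A * (σ * q ^ 2)⁻¹) := by
        refine mul_le_mul (add_le_add h.mul_exp_le (mul_le_mul_of_nonneg_right hσa hG)) haA
          ha0.le (by positivity)
      _ = _ := by ring
  calc |nonlin χ m (U + v)| ≤ (1 + m) * |U + v| * Real.exp ((U + v) ^ 2) :=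
        abs_nonlin_le hχ hm _
    _ ≤ (1 + m) * (U + σ * G) * (B * a ^ 2) :=
        mul_le_mul (mul_le_mul_of_nonneg_left h3 (by linarith)) h2 (Real.exp_pos _).le
          (mul_nonneg (by linarith) (add_nonneg h.nonneg (by positivity)))
    _ = (1 + m) * B * ((U + σ * G) * a ^ 2) := by ring
    _ ≤ (1 + m) * B * ((1 + A) * G * (A * (σ * q ^ 2)⁻¹)) :=
        mul_le_mul_of_nonneg_left h4 (by positivity)
    _ = (1 + m) * ((1 + A) * A * B) * (σ * q ^ 2)⁻¹ * G := by ring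
    _ ≤ _ := by
        have h5 : (1 + A) * A ≤ 2 * A ^ 2 := by nlinarith
        gcongr

/-- The Lipschitz constant `O(q² e^{U²})` loses `q²` against the distance, where the bound on the
nonlinearity itself loses `q`; the distance carries a factor `q⁻¹`, so that the weight is the
same. -/
lemma abs_nonlin_sub_le (h : FlowBounds A σ q U P G) {C : ℝ} (hC : 0 ≤ C)
    (hlip : ∀ M a b, |a| ≤ M → |b| ≤ M → |nonlin χ m a - nonlin χ m b| ≤
      C * ((1 + M ^ 2) * Real.exp (M ^ 2)) * |a - b|) {v₁ v₂ d : ℝ}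
    (hv₁ : q * |v₁| ≤ 1) (hv₂ : q * |v₂| ≤ 1) (hd : q * |v₁ - v₂| ≤ d) :
    |nonlin χ m (U + v₁) - nonlin χ m (U + v₂)| ≤
      d * (C * (10 * A ^ 3 * Real.exp (4 * A + 1))) * (σ * q)⁻¹ * P := by
  have hq := h.one_le
  have hq0 : 0 < q := by linarith
  have hA := h.one_le_const
  have hσ := h.pos
  have hP : 0 < P := (Real.exp_pos _).trans_le h.exp_le
  have h1 := hlip _ _ _ (h.abs_add_le hv₁) (h.abs_add_le hv₂)
  rw [add_sub_add_left_eq_sub] at h1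
  have h2 : |v₁ - v₂| ≤ d * q⁻¹ := by
    rw [← div_eq_mul_inv, le_div_iff₀ hq0, mul_comm]; exact hd
  have h3 : 1 + (U + q⁻¹) ^ 2 ≤ 10 * A ^ 2 * q ^ 2 := by
    have h4 : (U + q⁻¹) ^ 2 ≤ (3 * A * q) ^ 2 :=
      pow_le_pow_left₀ (add_nonneg h.nonneg (by positivity)) h.add_inv_le 2
    have h5 : 1 ≤ A ^ 2 * q ^ 2 := by
      rw [← mul_pow]; exact one_le_pow₀ (by nlinarith)
    nlinarith
  calc |nonlin χ m (U + v₁) - nonlin χ m (U + v₂)|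
      ≤ C * ((1 + (U + q⁻¹) ^ 2) * Real.exp ((U + q⁻¹) ^ 2)) * |v₁ - v₂| := h1
    _ ≤ C * ((10 * A ^ 2 * q ^ 2) * (Real.exp (4 * A + 1) * (A * (σ * q ^ 2)⁻¹) * P)) *
          (d * q⁻¹) := by
        refine mul_le_mul (mul_le_mul_of_nonneg_left (mul_le_mul h3 h.exp_sq_le_mul
          (Real.exp_pos _).le (by positivity)) hC) h2 (abs_nonneg _) (by positivity)
    _ = _ := by field_simp

end FlowBounds

/-! ### Integrable time weights -/

/-- The weight `s^{-1/2} |log s|^{-κ}`. -/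
def timeWeight (κ s : ℝ) : ℝ := (Real.sqrt s * |Real.log s| ^ κ)⁻¹

lemma timeWeight_nonneg (κ s : ℝ) : 0 ≤ timeWeight κ s := by unfold timeWeight; positivity

lemma abs_log_antitone {s t : ℝ} (hs : 0 < s) (hst : s ≤ t) (ht : t ≤ 1) :
    |Real.log t| ≤ |Real.log s| := by
  rw [abs_of_nonpos (Real.log_nonpos (hs.le.trans hst) ht),
    abs_of_nonpos (Real.log_nonpos hs.le (hst.trans ht))]
  exact neg_le_neg (Real.log_le_log hs hst)

lemma abs_log_pos {t : ℝ} (ht : t ∈ Ioo 0 1) : 0 < |Real.log t| :=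
  abs_pos.2 (Real.log_neg ht.1 ht.2).ne

lemma timeWeight_le {κ s t : ℝ} (hκ : 0 ≤ κ) (hs : 0 < s) (hst : s ≤ t) (ht : t < 1) :
    timeWeight κ s ≤ (|Real.log t| ^ κ)⁻¹ * s ^ (-(1 / 2) : ℝ) := by
  have h1 := abs_log_pos ⟨hs.trans_le hst, ht⟩
  have h2 := abs_log_antitone hs hst ht.le
  rw [timeWeight, Real.rpow_neg hs.le, ← Real.sqrt_eq_rpow, mul_inv, mul_comm]
  exact mul_le_mul_of_nonneg_right (inv_anti₀ (by positivity)
    (Real.rpow_le_rpow h1.le h2 hκ)) (by positivity)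

lemma integrableOn_rpow_neg_half (t : ℝ) (ht : 0 ≤ t) :
    IntegrableOn (fun s : ℝ => s ^ (-(1 / 2) : ℝ)) (Ioo 0 t) := by
  have := intervalIntegral.intervalIntegrable_rpow' (a := 0) (b := t)
    (by norm_num : (-1 : ℝ) < -(1 / 2))
  rw [intervalIntegrable_iff_integrableOn_Ioo_of_le ht] at this
  exact this

lemma integral_rpow_neg_half {t : ℝ} (ht : 0 ≤ t) :
    ∫ s in Ioo 0 t, s ^ (-(1 / 2) : ℝ) = 2 * Real.sqrt t := by
  rw [← integral_Ioc_eq_integral_Ioo, ← intervalIntegral.integral_of_le ht,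
    integral_rpow (Or.inl (by norm_num)), Real.sqrt_eq_rpow]
  norm_num
  ring

lemma measurable_timeWeight (κ : ℝ) : Measurable (timeWeight κ) := by
  unfold timeWeight
  exact ((Real.continuous_sqrt.measurable).mul
    ((continuous_abs.measurable.comp Real.measurable_log).pow_const κ)).inv

lemma integrableOn_timeWeight {κ t : ℝ} (hκ : 0 ≤ κ) (ht : t ∈ Ioo 0 1) :
    IntegrableOn (timeWeight κ) (Ioo 0 t) := by
  refine Integrable.mono' ((integrableOn_rpow_neg_half t ht.1.le).const_mul
    (|Real.log t| ^ κ)⁻¹) (measurable_timeWeight κ).aestronglyMeasurable ?_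
  refine (ae_restrict_iff' measurableSet_Ioo).2 (Eventually.of_forall fun s hs => ?_)
  rw [Real.norm_of_nonneg (timeWeight_nonneg _ _)]
  exact timeWeight_le hκ hs.1 hs.2.le ht.2

lemma integral_timeWeight_le {κ t : ℝ} (hκ : 0 ≤ κ) (ht : t ∈ Ioo 0 1) :
    ∫ s in Ioo 0 t, timeWeight κ s ≤ 2 * Real.sqrt t * (|Real.log t| ^ κ)⁻¹ := by
  rw [← integral_rpow_neg_half ht.1.le, mul_comm, ← integral_const_mul]
  exact setIntegral_mono_on (integrableOn_timeWeight hκ ht)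
    ((integrableOn_rpow_neg_half t ht.1.le).const_mul _) measurableSet_Ioo
    fun s hs => timeWeight_le hκ hs.1 hs.2.le ht.2

/-! ### The fixed point of the Duhamel map -/

/-- The properties of the initial datum `g` on which the construction of the solution rests: the
integrability of `g e^{g²/2}`, and the bound `e^{tΔ} e^{g²/2} = O(t^{-1/2} |log t|^{-1})`. -/
structure IsSingularDatum (g : Plane → ℝ) : Prop where
  aesm : AEStronglyMeasurable g
  nonneg : ∀ᵐ y, 0 ≤ g y
  continuousAt : ∀ᵐ y, ContinuousAt g y
  integrable : Integrable fun y => g y * Real.exp (g y ^ 2 / 2)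
  heat_exp_le : ∃ A, 1 ≤ A ∧ ∀ t ∈ Ioo 0 (Real.exp (-1)), ∀ x,
    heat t (fun y => Real.exp (g y ^ 2 / 2)) x ≤ A * (Real.sqrt t * |Real.log t|)⁻¹

/-- As `e^{g²/2}` is not integrable at infinity, its heat flow is controlled by that of
`1 + g e^{g²/2}`. -/
lemma exp_half_sq_le {s : ℝ} (hs : 0 ≤ s) :
    Real.exp (s ^ 2 / 2) ≤ 1 + s * Real.exp (s ^ 2 / 2) := by
  have h1 : 1 - s ≤ Real.exp (-(s ^ 2 / 2)) := by
    rcases le_total 1 s with h | h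
    · linarith [Real.exp_pos (-(s ^ 2 / 2))]
    · nlinarith [Real.add_one_le_exp (-(s ^ 2 / 2))]
  have h2 := mul_le_mul_of_nonneg_right h1 (Real.exp_pos (s ^ 2 / 2)).le
  rw [← Real.exp_add, neg_add_cancel, Real.exp_zero] at h2
  linarith

lemma rpow_le_mul_exp_half_sq {q : ℝ} (hq : 1 ≤ q) :
    ∃ C, ∀ a, 0 ≤ a → a ^ q ≤ C * (a * Real.exp (a ^ 2 / 2)) := by
  set n := ⌈q⌉₊
  refine ⟨1 + 2 ^ n * n.factorial, fun a ha => ?_⟩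
  have hexp : 1 ≤ Real.exp (a ^ 2 / 2) := Real.one_le_exp (by positivity)
  have hf : (0 : ℝ) < 2 ^ n * n.factorial := by positivity
  rcases le_total a 1 with h | h
  · calc a ^ q ≤ a ^ (1 : ℝ) := Real.rpow_le_rpow_of_exponent_ge' ha h zero_le_one hq
      _ = 1 * (a * 1) := by simp
      _ ≤ _ := by gcongr; linarith
  · have h1 := Real.pow_div_factorial_le_exp (a ^ 2 / 2) (by positivity) n
    rw [div_le_iff₀ (by positivity), div_pow, div_le_iff₀ (by positivity)] at h1
    have h2 : a ^ q ≤ a * (a ^ 2) ^ n := by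
      calc a ^ q ≤ a ^ ((2 * n + 1 : ℕ) : ℝ) := by
            refine Real.rpow_le_rpow_of_exponent_le h ?_
            push_cast
            have : (q : ℝ) ≤ n := Nat.le_ceil q
            linarith [(Nat.cast_nonneg n : (0 : ℝ) ≤ n)]
        _ = _ := by rw [Real.rpow_natCast, pow_succ, pow_mul]; ring
    calc a ^ q ≤ a * (a ^ 2) ^ n := h2
      _ ≤ a * (Real.exp (a ^ 2 / 2) * n.factorial * 2 ^ n) := mul_le_mul_of_nonneg_left h1 ha
      _ ≤ _ := by nlinarith [mul_nonneg ha (Real.exp_pos (a ^ 2 / 2)).le]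

namespace IsSingularDatum

variable {g : Plane → ℝ}

lemma integrable_rpow (hg : IsSingularDatum g) {q : ℝ} (hq : 1 ≤ q) :
    Integrable fun y => g y ^ q := by
  obtain ⟨C, hC⟩ := rpow_le_mul_exp_half_sq hq
  refine (hg.integrable.const_mul C).mono' (hg.aesm.aemeasurable.pow_const q).aestronglyMeasurable ?_
  filter_upwards [hg.nonneg] with y hy
  rw [Real.norm_of_nonneg (Real.rpow_nonneg hy q)]
  exact hC _ hy

lemma integrable_self (hg : IsSingularDatum g) : Integrable g := by
  simpa using hg.integrable_rpow le_rfl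

lemma admissible (hg : IsSingularDatum g) : HeatAdmissible g :=
  HeatAdmissible.of_integrable hg.integrable_self

lemma admissible_mul_exp (hg : IsSingularDatum g) :
    HeatAdmissible fun y => g y * Real.exp (g y ^ 2 / 2) :=
  HeatAdmissible.of_integrable hg.integrable

lemma admissible_exp (hg : IsSingularDatum g) :
    HeatAdmissible fun y => Real.exp (g y ^ 2 / 2) := by
  refine ((HeatAdmissible.const 1).add hg.admissible_mul_exp).mono ?_ ?_
  · exact (Real.continuous_exp.comp (by fun_prop : Continuous fun s : ℝ => s ^ 2 / 2)
      ).comp_aestronglyMeasurable hg.aesm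
  · filter_upwards [hg.nonneg] with y hy
    rw [abs_of_pos (Real.exp_pos _)]
    exact exp_half_sq_le hy

lemma mul_exp_nonneg (hg : IsSingularDatum g) :
    ∀ᵐ y, 0 ≤ g y * Real.exp (g y ^ 2 / 2) := by
  filter_upwards [hg.nonneg] with y hy using mul_nonneg hy (Real.exp_pos _).le

lemma exists_flowBounds (hg : IsSingularDatum g) : ∃ A, 1 ≤ A ∧
    (∀ t ∈ Ioo 0 (Real.exp (-1)), ∀ x,
      FlowBounds A (Real.sqrt t) (|Real.log t| ^ (1 / 2 : ℝ)) (heat t g x)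
        (heat t (fun y => Real.exp (g y ^ 2 / 2)) x)
        (heat t (fun y => g y * Real.exp (g y ^ 2 / 2)) x)) := by
  obtain ⟨A, hA, hle⟩ := hg.heat_exp_le
  refine ⟨A, hA, fun t ht x => ?_⟩
  have hlog : Real.log t < -1 := by
    rw [← Real.log_exp (-1)]; exact Real.log_lt_log ht.1 ht.2
  have habs : |Real.log t| = -Real.log t := abs_of_neg (by linarith)
  have hsq : (|Real.log t| ^ (1 / 2 : ℝ)) ^ 2 = |Real.log t| := by
    rw [← Real.sqrt_eq_rpow, Real.sq_sqrt (abs_nonneg _)]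
  refine ⟨hA, Real.sqrt_pos.2 ht.1, Real.one_le_rpow (by rw [habs]; linarith) (by norm_num), ?_,
    heat_nonneg ht.1 hg.nonneg x, ?_, ?_, ?_⟩
  · rw [hsq, habs, Real.log_sqrt ht.1.le]; ring
  · exact comp_heat_le_heat_comp (h := fun s => Real.exp (s ^ 2 / 2))
      (fun b _ => exists_support_exp_half_sq b) hg.admissible hg.nonneg hg.admissible_exp ht.1 x
  · exact comp_heat_le_heat_comp (h := fun s => s * Real.exp (s ^ 2 / 2))
      (fun b hb => exists_support_mul_exp_half_sq hb) hg.admissible hg.nonneg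
      hg.admissible_mul_exp ht.1 x
  · rw [hsq]; exact hle t ht x

end IsSingularDatum

lemma IsDominatedSource.duhamelIntegral_sub {T : ℝ} {b₁ b₂ : ℝ → ℝ} {h₁ h₂ : Plane → ℝ}
    {F₁ F₂ : ℝ → Plane → ℝ} (H₁ : IsDominatedSource T b₁ h₁ F₁)
    (H₂ : IsDominatedSource T b₂ h₂ F₂) {t : ℝ} (ht : t ∈ Ioo 0 T) (x : Plane) :
    duhamelIntegral F₁ t x - duhamelIntegral F₂ t x =
      duhamelIntegral (fun s y => F₁ s y - F₂ s y) t x := by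
  rw [duhamelIntegral_eq_setIntegral _ ht.1.le, duhamelIntegral_eq_setIntegral _ ht.1.le,
    duhamelIntegral_eq_setIntegral _ ht.1.le,
    ← integral_sub (H₁.integrableOn_heat_slice ht x) (H₂.integrableOn_heat_slice ht x)]
  refine setIntegral_congr_fun measurableSet_Ioo fun s hs => ?_
  have hsT : s ∈ Ioo 0 T := ⟨hs.1, hs.2.trans ht.2⟩
  exact (heat_sub (sub_pos.2 hs.2) (H₁.slice_admissible hsT) (H₂.slice_admissible hsT) x).symm

/-- The nonlinearity evaluated along a perturbation `v` of the heat flow of `g`. -/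
def source (χ : ℝ → ℝ) (m : ℝ) (g : Plane → ℝ) (v : ℝ × Plane → ℝ) (s : ℝ) (y : Plane) : ℝ :=
  nonlin χ m (heat s g y + v (s, y))

/-- The weight `|log t|^{1/2}` on space-time. -/
def logWeight (q : ℝ × Plane) : ℝ := |Real.log q.1| ^ (1 / 2 : ℝ)

lemma continuousOn_source {χ : ℝ → ℝ} (hχ : IsCutoff χ) (m : ℝ) {g : Plane → ℝ}
    (hg : HeatAdmissible g) {T : ℝ} {v : ℝ × Plane → ℝ}
    (hv : ContinuousOn v (Ioo 0 T ×ˢ univ)) :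
    ContinuousOn (fun q : ℝ × Plane => source χ m g v q.1 q.2) (Ioo 0 T ×ˢ univ) :=
  (continuous_nonlin hχ m).comp_continuousOn
    ((hg.continuousOn_heat.mono (prod_mono_left Ioo_subset_Ioi_self)).add hv)

/-- The nonlinearity along perturbations in the weighted ball is a dominated source: with respect to
`e^{g²/2}` in general, and with respect to `g e^{g²/2}` if the perturbation is at most
`s^{1/2} e^{sΔ}(g e^{g²/2})`. Differences scale with the weighted distance. -/
lemma exists_isDominatedSource {χ : ℝ → ℝ} (hχ : IsCutoff χ) {m : ℝ} (hm : 0 ≤ m)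
    {g : Plane → ℝ} (hg : IsSingularDatum g) : ∃ C, 0 < C ∧ ∀ T ∈ Ioc 0 (Real.exp (-1)),
      (∀ v ∈ weightedBall (Ioo 0 T ×ˢ univ) logWeight,
        IsDominatedSource T (fun s => C * timeWeight (1 / 2) s)
          (fun y => Real.exp (g y ^ 2 / 2)) (source χ m g v) ∧
        ((∀ q ∈ (Ioo 0 T ×ˢ univ : Set (ℝ × Plane)), |v q| ≤
            Real.sqrt q.1 * heat q.1 (fun y => g y * Real.exp (g y ^ 2 / 2)) q.2) →
          IsDominatedSource T (fun s => C * timeWeight 1 s)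
            (fun y => g y * Real.exp (g y ^ 2 / 2)) (source χ m g v))) ∧
      ∀ v₁ ∈ weightedBall (Ioo 0 T ×ˢ univ) logWeight,
      ∀ v₂ ∈ weightedBall (Ioo 0 T ×ˢ univ) logWeight, ∀ d, 0 ≤ d →
        (∀ q ∈ (Ioo 0 T ×ˢ univ : Set (ℝ × Plane)), logWeight q * |v₁ q - v₂ q| ≤ d) →
        IsDominatedSource T (fun s => d * C * timeWeight (1 / 2) s)
          (fun y => Real.exp (g y ^ 2 / 2))
          (fun s y => source χ m g v₁ s y - source χ m g v₂ s y) := by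
  obtain ⟨A, hA, hflow⟩ := hg.exists_flowBounds
  obtain ⟨L, hL, hlip⟩ := exists_abs_nonlin_sub_le hχ hm
  set C₁ := (1 + m) * (3 * A ^ 2 * Real.exp (4 * A + 1)) with hC₁
  set C₂ := (1 + m) * (2 * A ^ 2 * Real.exp (4 * A + 1)) with hC₂
  set C₃ := L * (10 * A ^ 3 * Real.exp (4 * A + 1)) with hC₃
  have h1 : 0 < C₁ := by positivity
  have h2 : 0 < C₂ := by positivity
  have h3 : 0 ≤ C₃ := by positivity
  refine ⟨C₁ + C₂ + C₃, by positivity, fun T hT => ?_⟩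
  have hT1 : T < 1 := hT.2.trans_lt (Real.exp_lt_one_iff.2 (by norm_num))
  have hsub : ∀ s ∈ Ioo 0 T, s ∈ Ioo 0 (Real.exp (-1)) := fun s hs => ⟨hs.1, hs.2.trans_le hT.2⟩
  have hint : ∀ κ, 0 ≤ κ → IntegrableOn (timeWeight κ) (Ioo 0 T) := fun κ hκ =>
    integrableOn_timeWeight hκ ⟨hT.1, hT1⟩
  refine ⟨fun v hv => ⟨⟨continuousOn_source hχ m hg.admissible hv.1,
    (hint _ (by norm_num)).const_mul _,
    fun s _ => mul_nonneg (by positivity) (timeWeight_nonneg _ _), hg.admissible_exp,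
    fun s hs y => ?_⟩, fun hvG => ⟨continuousOn_source hχ m hg.admissible hv.1,
    (hint _ (by norm_num)).const_mul _,
    fun s _ => mul_nonneg (by positivity) (timeWeight_nonneg _ _), hg.admissible_mul_exp,
    fun s hs y => ?_⟩⟩, fun v₁ hv₁ v₂ hv₂ d hd0 hd =>
    ⟨(continuousOn_source hχ m hg.admissible hv₁.1).sub
      (continuousOn_source hχ m hg.admissible hv₂.1),
    (hint _ (by norm_num)).const_mul _,
    fun s _ => mul_nonneg (by positivity) (timeWeight_nonneg _ _), hg.admissible_exp,
    fun s hs y => ?_⟩⟩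
  · have hf := hflow s (hsub s hs) y
    have hP : 0 ≤ heat s (fun y => Real.exp (g y ^ 2 / 2)) y :=
      (Real.exp_pos _).le.trans hf.exp_le
    refine (hf.abs_nonlin_add_le hχ hm (hv.2 (s, y) ⟨hs, mem_univ _⟩)).trans ?_
    refine mul_le_mul_of_nonneg_right (mul_le_mul_of_nonneg_right ?_ ?_) hP
    · linarith
    · exact timeWeight_nonneg (1 / 2) s
  · have hf := hflow s (hsub s hs) y
    have hG : 0 ≤ heat s (fun y => g y * Real.exp (g y ^ 2 / 2)) y :=
      heat_nonneg hs.1 hg.mul_exp_nonneg y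
    refine (hf.abs_nonlin_add_le_of_le hχ hm (hv.2 (s, y) ⟨hs, mem_univ _⟩)
      (hvG (s, y) ⟨hs, mem_univ _⟩)).trans ?_
    have hsq : (|Real.log s| ^ (1 / 2 : ℝ)) ^ 2 = |Real.log s| ^ (1 : ℝ) := by
      rw [← Real.rpow_natCast, ← Real.rpow_mul (abs_nonneg _)]; norm_num
    rw [hsq]
    refine mul_le_mul_of_nonneg_right (mul_le_mul_of_nonneg_right ?_ ?_) hG
    · linarith
    · exact timeWeight_nonneg 1 s
  · have hf := hflow s (hsub s hs) y
    have hP : 0 ≤ heat s (fun y => Real.exp (g y ^ 2 / 2)) y :=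
      (Real.exp_pos _).le.trans hf.exp_le
    refine (hf.abs_nonlin_sub_le hL hlip (hv₁.2 (s, y) ⟨hs, mem_univ _⟩)
      (hv₂.2 (s, y) ⟨hs, mem_univ _⟩) (hd (s, y) ⟨hs, mem_univ _⟩)).trans ?_
    refine mul_le_mul_of_nonneg_right (mul_le_mul_of_nonneg_right ?_ ?_) hP
    · exact mul_le_mul_of_nonneg_left (by linarith) hd0
    · exact timeWeight_nonneg (1 / 2) s

/-- For small `T` the Duhamel map has exactly one fixed point in the weighted ball; it obeys the
additional bound `|v(t)| ≤ t^{1/2} e^{tΔ}(g e^{g²/2})`, which makes it small in every `L^p`. -/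
lemma exists_duhamel_fixedPoint {χ : ℝ → ℝ} (hχ : IsCutoff χ) {m : ℝ} (hm : 0 ≤ m)
    {g : Plane → ℝ} (hg : IsSingularDatum g) : ∃ T, 0 < T ∧ T ≤ Real.exp (-1) ∧ ∃ b,
      (∀ v ∈ weightedBall (Ioo 0 T ×ˢ univ) logWeight,
        IsDominatedSource T b (fun y => Real.exp (g y ^ 2 / 2)) (source χ m g v)) ∧
      ∃ v ∈ weightedBall (Ioo 0 T ×ˢ univ) logWeight,
        (∀ q ∈ (Ioo 0 T ×ˢ univ : Set (ℝ × Plane)),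
          duhamelIntegral (source χ m g v) q.1 q.2 = v q) ∧
        (∀ q ∈ (Ioo 0 T ×ˢ univ : Set (ℝ × Plane)), |v q| ≤
            Real.sqrt q.1 * heat q.1 (fun y => g y * Real.exp (g y ^ 2 / 2)) q.2) ∧
        ∀ v' ∈ weightedBall (Ioo 0 T ×ˢ univ) logWeight,
          (∀ q ∈ (Ioo 0 T ×ˢ univ : Set (ℝ × Plane)),
            duhamelIntegral (source χ m g v') q.1 q.2 = v' q) →
          ∀ q ∈ (Ioo 0 T ×ˢ univ : Set (ℝ × Plane)), v' q = v q := by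
  obtain ⟨C, hC, hdom⟩ := exists_isDominatedSource hχ hm hg
  obtain ⟨A, hA, hflow⟩ := hg.exists_flowBounds
  -- The three smallness conditions are `2 C A ≤ q²`, `4 C A ≤ q²` and `2 C ≤ q²` for `q² = |log t|`.
  set T := Real.exp (-(4 * C * A + 1)) with hTdef
  have hT0 : 0 < T := Real.exp_pos _
  have hCA : 0 < C * A := by positivity
  have hTe : T ≤ Real.exp (-1) := Real.exp_le_exp.2 (by nlinarith)
  have hT1 : T < 1 := Real.exp_lt_one_iff.2 (by nlinarith)
  obtain ⟨hdom1, hdom2⟩ := hdom T ⟨hT0, hTe⟩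
  have hlog : ∀ t ∈ Ioo 0 T, 4 * C * A ≤ |Real.log t| := by
    intro t ht
    have h1 : Real.log t < -(4 * C * A + 1) := by
      rw [← Real.log_exp (-(4 * C * A + 1))]; exact Real.log_lt_log ht.1 ht.2
    rw [abs_of_neg (by nlinarith)]; linarith
  have hIoo1 : ∀ t ∈ Ioo 0 T, t ∈ Ioo 0 1 := fun t ht => ⟨ht.1, ht.2.trans hT1⟩
  have hint : ∀ c, 0 ≤ c → ∀ κ, 0 ≤ κ → ∀ t ∈ Ioo 0 T, ∫ s in Ioo 0 t, c * timeWeight κ s ≤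
      c * (2 * Real.sqrt t * (|Real.log t| ^ κ)⁻¹) := by
    intro c hc κ hκ t ht
    rw [integral_const_mul]
    exact mul_le_mul_of_nonneg_left (integral_timeWeight_le hκ (hIoo1 t ht)) hc
  have hsize : ∀ c, 0 ≤ c → ∀ F : ℝ → Plane → ℝ, IsDominatedSource T
      (fun s => c * C * timeWeight (1 / 2) s) (fun y => Real.exp (g y ^ 2 / 2)) F →
      ∀ q ∈ (Ioo 0 T ×ˢ univ : Set (ℝ × Plane)),
        logWeight q * |duhamelIntegral F q.1 q.2| ≤ c / 2 := by
    rintro c hc F hF ⟨t, x⟩ ⟨ht, -⟩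
    have ht : t ∈ Ioo 0 T := ht
    have hf := hflow t ⟨ht.1, ht.2.trans_le hTe⟩ x
    have hsq : (|Real.log t| ^ (1 / 2 : ℝ)) ^ 2 = |Real.log t| := by
      rw [← Real.sqrt_eq_rpow, Real.sq_sqrt (abs_nonneg _)]
    have h1 := hF.abs_duhamelIntegral_le ht x
    have h2 := hint (c * C) (by positivity) (1 / 2) (by norm_num) t ht
    have hlt := hlog t ht
    rw [← hsq] at hlt
    unfold logWeight
    simp only
    set r := |Real.log t| ^ (1 / 2 : ℝ) with hr
    set σ := Real.sqrt t
    have hq : 0 < r := by linarith [hf.one_le]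
    have hσ := hf.pos
    have hP := (Real.exp_pos _).trans_le hf.exp_le
    calc r * |duhamelIntegral F t x|
        ≤ r * ((c * C * (2 * σ * r⁻¹)) * (A * (σ * r ^ 2)⁻¹)) := by
          refine mul_le_mul_of_nonneg_left (h1.trans ?_) hq.le
          exact mul_le_mul h2 hf.le hP.le (by positivity)
      _ = c * (2 * C * A) / r ^ 2 := by field_simp
      _ ≤ c / 2 := by
          rw [div_le_div_iff₀ (by positivity) (by norm_num)]
          nlinarith [mul_le_mul_of_nonneg_left hlt hc]
  have hsize1 : ∀ v ∈ weightedBall (Ioo 0 T ×ˢ univ) logWeight,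
      ∀ q ∈ (Ioo 0 T ×ˢ univ : Set (ℝ × Plane)),
        logWeight q * |duhamelIntegral (source χ m g v) q.1 q.2| ≤ 1 := by
    intro v hv q hq
    have := hsize 1 zero_le_one _ (by simpa only [one_mul] using (hdom1 v hv).1) q hq
    linarith
  have hwpos : ∀ q ∈ (Ioo 0 T ×ˢ univ : Set (ℝ × Plane)), 0 < logWeight q := by
    rintro ⟨t, x⟩ ⟨ht, -⟩
    exact Real.rpow_pos_of_pos (abs_log_pos (hIoo1 t ht)) _
  have hwcont : ContinuousOn logWeight (Ioo 0 T ×ˢ univ) := by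
    unfold logWeight
    refine ContinuousOn.rpow_const (ContinuousOn.abs (continuousOn_fst.log ?_)) ?_
    · rintro ⟨t, x⟩ ⟨ht, -⟩; exact (ht.1 : 0 < t).ne'
    · intro q _; right; norm_num
  refine ⟨T, hT0, hTe, _, fun v hv => (hdom1 v hv).1, ?_⟩
  refine exists_fixedPoint_weightedBall
    (Γ := fun v q => duhamelIntegral (source χ m g v) q.1 q.2) hwcont hwpos
    (fun v hv => ⟨(hdom1 v hv).1.continuousOn_duhamelIntegral, hsize1 v hv⟩) ?_ ?_ ?_
  · intro v₁ h₁ v₂ h₂ d hd0 hd q hq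
    rw [(hdom1 v₁ h₁).1.duhamelIntegral_sub (hdom1 v₂ h₂).1 hq.1]
    exact hsize d hd0 _ (hdom2 v₁ h₁ v₂ h₂ d hd0 hd) q hq
  · rintro ⟨t, x⟩ ⟨ht, -⟩
    exact mul_nonneg (Real.sqrt_nonneg _) (heat_nonneg ht.1 hg.mul_exp_nonneg x)
  · rintro v hv hvG ⟨t, x⟩ ⟨ht, -⟩
    have ht : t ∈ Ioo 0 T := ht
    have hG : 0 ≤ heat t (fun y => g y * Real.exp (g y ^ 2 / 2)) x :=
      heat_nonneg ht.1 hg.mul_exp_nonneg x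
    refine (((hdom1 v hv).2 hvG).abs_duhamelIntegral_le ht x).trans
      (mul_le_mul_of_nonneg_right ((hint C hC.le 1 zero_le_one t ht).trans ?_) hG)
    have hl := abs_log_pos (hIoo1 t ht)
    have h1 : 2 * C ≤ |Real.log t| := le_trans (by nlinarith) (hlog t ht)
    rw [Real.rpow_one]
    calc C * (2 * Real.sqrt t * |Real.log t|⁻¹) = Real.sqrt t * (2 * C / |Real.log t|) := by
          ring
      _ ≤ Real.sqrt t := mul_le_of_le_one_right (Real.sqrt_nonneg _) ((div_le_one hl).2 h1)

/-! ### From the fixed point to the strong solution -/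

/-- The function `heat flow + v` on `[0, T)`, with no perturbation at time zero. -/
def perturbedFlow (g : Plane → ℝ) (v : ℝ × Plane → ℝ) (t : ℝ) (x : Plane) : ℝ :=
  heat t g x + if 0 < t then v (t, x) else 0

lemma perturbedFlow_of_pos (g : Plane → ℝ) (v : ℝ × Plane → ℝ) {t : ℝ} (ht : 0 < t) (x : Plane) :
    perturbedFlow g v t x = heat t g x + v (t, x) := by
  rw [perturbedFlow, if_pos ht]

lemma perturbedFlow_zero (g : Plane → ℝ) (v : ℝ × Plane → ℝ) : perturbedFlow g v 0 = g := by
  ext x; simp [perturbedFlow, heat]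

lemma duhamelIntegral_congr {F F' : ℝ → Plane → ℝ} {t : ℝ} (ht : 0 ≤ t)
    (h : ∀ s ∈ Ioo 0 t, F s = F' s) (x : Plane) :
    duhamelIntegral F t x = duhamelIntegral F' t x := by
  rw [duhamelIntegral_eq_setIntegral _ ht, duhamelIntegral_eq_setIntegral _ ht]
  refine setIntegral_congr_fun measurableSet_Ioo fun s hs => ?_
  simp only [h s hs]

/-- The conventions `log 0 = 0` and `0⁻¹ = 0` give the right value at `0`. -/
lemma continuousAt_inv_abs_log_rpow :
    ContinuousAt (fun t : ℝ => (|Real.log t| ^ (1 / 2 : ℝ))⁻¹) 0 := by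
  rw [continuousAt_iff_punctured_nhds]
  have h0 : (|Real.log 0| ^ (1 / 2 : ℝ))⁻¹ = 0 := by
    rw [Real.log_zero, abs_zero, Real.zero_rpow (by norm_num), inv_zero]
  rw [h0]
  exact tendsto_inv_atTop_zero.comp ((tendsto_rpow_atTop (by norm_num)).comp
    (tendsto_abs_atBot_atTop.comp Real.tendsto_log_nhdsNE_zero))

section

variable {T : ℝ} {v : ℝ × Plane → ℝ}

lemma abs_le_of_mem_weightedBall (hT : T ≤ Real.exp (-1))
    (hv : v ∈ weightedBall (Ioo 0 T ×ˢ univ) logWeight) {t : ℝ} (ht : t ∈ Ioo 0 T) (x : Plane) :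
    |v (t, x)| ≤ (|Real.log t| ^ (1 / 2 : ℝ))⁻¹ := by
  have h1 := hv.2 (t, x) ⟨ht, mem_univ _⟩
  have h2 : 0 < |Real.log t| := abs_log_pos
    ⟨ht.1, (ht.2.trans_le hT).trans (Real.exp_lt_one_iff.2 (by norm_num))⟩
  rw [inv_eq_one_div, le_div_iff₀ (by positivity), mul_comm]
  exact h1

lemma abs_le_one_of_mem_weightedBall (hT : T ≤ Real.exp (-1))
    (hv : v ∈ weightedBall (Ioo 0 T ×ˢ univ) logWeight) {t : ℝ} (ht : t ∈ Ioo 0 T) (x : Plane) :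
    |v (t, x)| ≤ 1 := by
  refine (abs_le_of_mem_weightedBall hT hv ht x).trans (inv_le_one_of_one_le₀ ?_)
  have h1 : Real.log t < -1 := by
    rw [← Real.log_exp (-1)]; exact Real.log_lt_log ht.1 (ht.2.trans_le hT)
  exact Real.one_le_rpow (by rw [abs_of_neg (by linarith)]; linarith) (by norm_num)

lemma inLogWeightedBall_of_mem_weightedBall (hT : T ≤ Real.exp (-1))
    (hv : v ∈ weightedBall (Ioo 0 T ×ˢ univ) logWeight) :
    InLogWeightedBall T fun t x => if 0 < t then v (t, x) else 0 := by
  constructor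
  · rintro ⟨t, x⟩ ⟨ht, -⟩
    rcases ht.1.eq_or_lt with h | h
    · have h : t = 0 := h.symm
      subst h
      unfold ContinuousWithinAt
      simp only [lt_irrefl, if_false]
      have hlim : Tendsto (fun q : ℝ × Plane => (|Real.log q.1| ^ (1 / 2 : ℝ))⁻¹)
          (𝓝[Ico 0 T ×ˢ univ] (0, x)) (𝓝 0) := by
        have h1 := (ContinuousAt.comp (f := fun q : ℝ × Plane => q.1) (x := ((0 : ℝ), x))
          continuousAt_inv_abs_log_rpow continuousAt_fst).tendsto
        simp only [Function.comp, Real.log_zero, abs_zero] at h1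
        rw [Real.zero_rpow (by norm_num), inv_zero] at h1
        exact h1.mono_left nhdsWithin_le_nhds
      refine squeeze_zero_norm' ?_ hlim
      filter_upwards [self_mem_nhdsWithin] with q hq
      split_ifs with hq0
      · exact abs_le_of_mem_weightedBall hT hv ⟨hq0, hq.1.2⟩ q.2
      · rw [norm_zero]; positivity
    · have hmem : (Ioo 0 T ×ˢ univ : Set (ℝ × Plane)) ∈ 𝓝 (t, x) :=
        (isOpen_Ioo.prod isOpen_univ).mem_nhds ⟨⟨h, ht.2⟩, mem_univ _⟩
      refine ((hv.1.continuousAt hmem).congr ?_).continuousWithinAt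
      filter_upwards [hmem] with q hq
      rw [if_pos hq.1.1]
  · intro t ht x
    simp only [if_pos ht.1]
    exact hv.2 (t, x) ⟨ht, mem_univ _⟩

lemma InLogWeightedBall.inLogWeightedLinfty {V : ℝ → Plane → ℝ} (hV : InLogWeightedBall T V) :
    InLogWeightedLinfty T V := by
  have hms : MeasurableSet (Ico 0 T ×ˢ (univ : Set Plane)) :=
    measurableSet_Ico.prod MeasurableSet.univ
  refine memLp_top_of_bound ?_ 1 ?_
  · refine AEStronglyMeasurable.mul ?_ (hV.1.aestronglyMeasurable hms)
    exact (((continuous_abs.measurable.comp Real.measurable_log).pow_const _).comp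
      measurable_fst).aestronglyMeasurable
  · refine (ae_restrict_iff' hms).2 (Eventually.of_forall ?_)
    rintro ⟨t, x⟩ ⟨ht, -⟩
    rw [norm_mul, Real.norm_of_nonneg (by positivity)]
    rcases ht.1.eq_or_lt with h | h
    · have h : t = 0 := h.symm
      simp [h]
    · exact hV.2 t ⟨h, ht.2⟩ x

lemma continuousOn_perturbedFlow {g : Plane → ℝ} (hg : HeatAdmissible g)
    (hv : ContinuousOn v (Ioo 0 T ×ˢ univ)) :
    ContinuousOn (fun q : ℝ × Plane => perturbedFlow g v q.1 q.2) (Ioo 0 T ×ˢ univ) := by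
  refine ((hg.continuousOn_heat.mono (prod_mono_left Ioo_subset_Ioi_self)).add hv).congr ?_
  rintro ⟨t, x⟩ ⟨ht, -⟩
  exact perturbedFlow_of_pos g v ht.1 x

/-- The perturbed heat flow is a continuous curve in every `L^p`, `p < ∞`. At positive times it is
dominated by the integrable and bounded heat flow of `g + g e^{g²/2}`; at time zero the heat flow
is continuous in `L^p`, and the perturbation is at most one and small in `L¹`. -/
lemma isContinuousCurve_perturbedFlow {g : Plane → ℝ} (hg : IsSingularDatum g)
    (hT : T ≤ Real.exp (-1)) (hv : v ∈ weightedBall (Ioo 0 T ×ˢ univ) logWeight)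
    (hvG : ∀ q ∈ (Ioo 0 T ×ˢ univ : Set (ℝ × Plane)), |v q| ≤
      Real.sqrt q.1 * heat q.1 (fun y => g y * Real.exp (g y ^ 2 / 2)) q.2) :
    IsContinuousCurve T (perturbedFlow g v) := by
  intro p hp hp' t ht
  have hq : 1 ≤ p.toReal := by
    rw [← ENNReal.toReal_one]; exact ENNReal.toReal_mono hp' hp
  have hT1 : T < 1 := hT.trans_lt (Real.exp_lt_one_iff.2 (by norm_num))
  set r := p.toReal
  have hcont := continuousOn_perturbedFlow hg.admissible hv.1
  rcases ht.1.eq_or_lt with h | h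
  · subst h
    rw [perturbedFlow_zero]
    refine ⟨memLp_of_rpow_le hp hp' hg.aesm (hg.integrable_rpow hq) ?_, ?_⟩
    · filter_upwards [hg.nonneg] with y hy
      rw [abs_of_nonneg hy]
    rw [← Ioo_insert_left ht.2, nhdsWithin_insert, tendsto_sup]
    constructor
    · rw [tendsto_pure_left]
      intro s hs
      rw [perturbedFlow_zero, sub_self, eLpNorm_zero]
      exact mem_of_mem_nhds hs
    · have hle : 𝓝[Ioo 0 T] (0 : ℝ) ≤ 𝓝[>] 0 := nhdsWithin_mono _ Ioo_subset_Ioi_self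
      have h1 := (tendsto_eLpNorm_heat_sub hg.integrable_self hg.nonneg hg.continuousAt hp hp'
        (hg.integrable_rpow hq)).mono_left hle
      have h2 : Tendsto (fun s => eLpNorm (fun x => v (s, x)) p volume) (𝓝[Ioo 0 T] 0) (𝓝 0) := by
        refine tendsto_eLpNorm_zero_of_le (h := fun s x => Real.sqrt s *
          heat s (fun y => g y * Real.exp (g y ^ 2 / 2)) x) hp hp' ?_ ?_ ?_
        · filter_upwards [self_mem_nhdsWithin] with s hs
          exact (integrable_heat hg.integrable hs.1).const_mul _
        · filter_upwards [self_mem_nhdsWithin] with s hs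
          filter_upwards with x
          refine le_trans ?_ (hvG (s, x) ⟨hs, mem_univ _⟩)
          calc |v (s, x)| ^ r ≤ |v (s, x)| ^ (1 : ℝ) :=
                Real.rpow_le_rpow_of_exponent_ge' (abs_nonneg _)
                  (abs_le_one_of_mem_weightedBall hT hv hs x) zero_le_one hq
            _ = _ := Real.rpow_one _
        · have h3 := ((Real.continuous_sqrt.tendsto 0).mono_left
            (nhdsWithin_le_nhds (s := Ioo 0 T))).mul_const
              (∫ y, g y * Real.exp (g y ^ 2 / 2))
          rw [Real.sqrt_zero, zero_mul] at h3
          refine h3.congr' ?_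
          filter_upwards [self_mem_nhdsWithin] with s hs
          rw [integral_const_mul, integral_heat hg.integrable hs.1]
      have h3 := h1.add h2
      rw [add_zero] at h3
      refine tendsto_of_tendsto_of_tendsto_of_le_of_le' tendsto_const_nhds h3
        (Eventually.of_forall fun _ => bot_le) ?_
      filter_upwards [self_mem_nhdsWithin] with s hs
      have h4 : perturbedFlow g v s - g = (fun x => heat s g x - g x) + fun x => v (s, x) := by
        ext x
        simp only [Pi.sub_apply, Pi.add_apply, perturbedFlow_of_pos g v hs.1]
        ring
      rw [h4]
      exact eLpNorm_add_le ((integrable_heat hg.integrable_self hs.1).1.sub hg.aesm)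
        (continuous_slice (F := fun s x => v (s, x)) hv.1 hs).aestronglyMeasurable hp
  · have htT : t ∈ Ioo 0 T := ⟨h, ht.2⟩
    set γ : Plane → ℝ := fun y => g y + g y * Real.exp (g y ^ 2 / 2) with hγ
    have hγi : Integrable γ := hg.integrable_self.add hg.integrable
    have hγ0 : ∀ᵐ y, 0 ≤ γ y := by
      filter_upwards [hg.nonneg, hg.mul_exp_nonneg] with y h1 h2 using add_nonneg h1 h2
    have hγa : HeatAdmissible γ := HeatAdmissible.of_integrable hγi
    have hle : ∀ s ∈ Ioo 0 T, ∀ x, |perturbedFlow g v s x| ≤ heat s γ x := by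
      intro s hs x
      rw [perturbedFlow_of_pos g v hs.1, hγ, heat_add hs.1 hg.admissible hg.admissible_mul_exp]
      refine (abs_add_le _ _).trans (add_le_add
        (abs_of_nonneg (heat_nonneg hs.1 hg.nonneg x)).le ?_)
      refine (hvG (s, x) ⟨hs, mem_univ _⟩).trans
        (mul_le_of_le_one_left (heat_nonneg hs.1 hg.mul_exp_nonneg x) ?_)
      exact Real.sqrt_le_one.2 (by linarith [hs.2])
    set N : Plane → ℝ := fun x => T / (t / 2) * heat T γ x with hN
    have hT0 : 0 < T := h.trans ht.2
    have hNi : Integrable N := (integrable_heat hγi hT0).const_mul _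
    have hN0 : ∀ x, 0 ≤ N x := fun x => mul_nonneg (by positivity) (heat_nonneg hT0 hγ0 x)
    set B := T / (t / 2) * ((4 * Real.pi * T)⁻¹ * ∫ y, γ y) with hB
    have hNB : ∀ x, N x ≤ B := fun x =>
      mul_le_mul_of_nonneg_left (heat_le_integral hT0 hγi hγ0 x) (by positivity)
    have hleN : ∀ s ∈ Ioo (t / 2) T, ∀ x, |perturbedFlow g v s x| ≤ N x := by
      intro s hs x
      have hs0 : 0 < s := by linarith [hs.1]
      refine (hle s ⟨hs0, hs.2⟩ x).trans ((heat_le_mul_heat hs0 hs.2.le hγa hγ0 x).trans ?_)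
      refine mul_le_mul_of_nonneg_right ?_ (heat_nonneg hT0 hγ0 x)
      exact div_le_div_of_nonneg_left hT0.le (by linarith) hs.1.le
    have hpow : ∀ a x, |a| ≤ 2 * N x → |a| ^ r ≤ (2 * B) ^ (r - 1) * (2 * N x) := by
      intro a x ha
      have h2N : 0 ≤ 2 * N x := by linarith [hN0 x]
      rcases (abs_nonneg a).eq_or_lt with h0 | h0
      · rw [← h0, Real.zero_rpow (by linarith)]
        exact mul_nonneg (Real.rpow_nonneg (by linarith [hN0 x, hNB x]) _) h2N
      · calc |a| ^ r = |a| ^ (r - 1) * |a| := by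
              rw [← Real.rpow_add_one h0.ne', sub_add_cancel]
          _ ≤ _ := mul_le_mul (Real.rpow_le_rpow h0.le (by linarith [hNB x]) (by linarith)) ha
              h0.le (Real.rpow_nonneg (by linarith [hN0 x, hNB x]) _)
    have hint : Integrable fun x => (2 * B) ^ (r - 1) * (2 * N x) :=
      (hNi.const_mul 2).const_mul _
    have htmem : t ∈ Ioo (t / 2) T := ⟨by linarith, ht.2⟩
    have hmeas : ∀ s ∈ Ioo 0 T, AEStronglyMeasurable (perturbedFlow g v s) := fun s hs =>
      (continuous_slice hcont hs).aestronglyMeasurable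
    refine ⟨memLp_of_rpow_le hp hp' (hmeas t htT) hint (Eventually.of_forall fun x =>
      hpow _ x ((hleN t htmem x).trans (by linarith [hN0 x]))), ?_⟩
    refine Tendsto.mono_left ?_ nhdsWithin_le_nhds
    have hnear : ∀ᶠ s in 𝓝 t, s ∈ Ioo (t / 2) T := Ioo_mem_nhds htmem.1 htmem.2
    have hsub : ∀ s ∈ Ioo (t / 2) T, s ∈ Ioo 0 T := fun s hs => ⟨by linarith [hs.1], hs.2⟩
    have hbound : ∀ s ∈ Ioo (t / 2) T, ∀ x,
        |perturbedFlow g v s x - perturbedFlow g v t x| ^ r ≤ (2 * B) ^ (r - 1) * (2 * N x) := by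
      intro s hs x
      refine hpow _ x ((abs_sub _ _).trans ?_)
      linarith [hleN s hs x, hleN t htmem x]
    have hmeas' : ∀ s ∈ Ioo (t / 2) T, AEStronglyMeasurable fun x =>
        |perturbedFlow g v s x - perturbedFlow g v t x| ^ r := fun s hs =>
      ((((hmeas s (hsub s hs)).sub (hmeas t htT)).norm).aemeasurable.pow_const
        r).aestronglyMeasurable
    refine tendsto_eLpNorm_zero_of_le
      (h := fun s x => |perturbedFlow g v s x - perturbedFlow g v t x| ^ r) hp hp' ?_
      (Eventually.of_forall fun s => Eventually.of_forall fun x => le_rfl) ?_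
    · filter_upwards [hnear] with s hs
      refine hint.mono' (hmeas' s hs) (Eventually.of_forall fun x => ?_)
      rw [Real.norm_of_nonneg (Real.rpow_nonneg (abs_nonneg _) _)]
      exact hbound s hs x
    · rw [show (0 : ℝ) = ∫ _ : Plane, (0 : ℝ) by simp]
      refine tendsto_integral_filter_of_dominated_convergence _ ?_ ?_ hint ?_
      · filter_upwards [hnear] with s hs using hmeas' s hs
      · filter_upwards [hnear] with s hs
        filter_upwards with x
        rw [Real.norm_of_nonneg (Real.rpow_nonneg (abs_nonneg _) _)]
        exact hbound s hs x
      · filter_upwards with x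
        have h1 : ContinuousAt (fun s => perturbedFlow g v s x) t :=
          ContinuousAt.comp (f := fun s : ℝ => (s, x))
            (g := fun q : ℝ × Plane => perturbedFlow g v q.1 q.2)
            (hcont.continuousAt ((isOpen_Ioo.prod isOpen_univ).mem_nhds ⟨htT, mem_univ _⟩))
            (by fun_prop)
        have h2 := ((h1.tendsto.sub_const (perturbedFlow g v t x)).abs).rpow_const
          (p := r) (Or.inr (by linarith))
        rwa [sub_self, abs_zero, Real.zero_rpow (by linarith)] at h2

end

/-- Strong solutions with a singular initial datum, unique in the weighted ball around the heat
flow. -/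
theorem IsSingularDatum.exists_unique_isStrongSolution {χ : ℝ → ℝ} (hχ : IsCutoff χ) {m : ℝ}
    (hm : 0 ≤ m) {g : Plane → ℝ} (hg : IsSingularDatum g) :
    ∃ T : ℝ, 0 < T ∧ T < 1 ∧ ∃ u : ℝ → Plane → ℝ,
      IsStrongSolution (nonlin χ m) T g u ∧
      InLogWeightedLinfty T (fun t x => u t x - heat t g x) ∧
      InLogWeightedBall T (fun t x => u t x - heat t g x) ∧
      ∀ w : ℝ → Plane → ℝ, IsStrongSolution (nonlin χ m) T g w →
        InLogWeightedBall T (fun t x => w t x - heat t g x) →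
        ∀ t ∈ Ico 0 T, w t =ᵐ[volume] u t := by
  obtain ⟨T, hT0, hTe, b, hdom, v, hv, hfix, hvG, huniq⟩ := exists_duhamel_fixedPoint hχ hm hg
  have hT1 : T < 1 := hTe.trans_lt (Real.exp_lt_one_iff.2 (by norm_num))
  have hball : InLogWeightedBall T (fun t x => perturbedFlow g v t x - heat t g x) := by
    simp only [perturbedFlow, add_sub_cancel_left]
    exact inLogWeightedBall_of_mem_weightedBall hTe hv
  have hsrc : ∀ s, 0 < s → source χ m g v s = fun y => nonlin χ m (perturbedFlow g v s y) := by
    intro s hs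
    ext y
    rw [perturbedFlow_of_pos g v hs, source]
  refine ⟨T, hT0, hT1, perturbedFlow g v,
    ⟨isContinuousCurve_perturbedFlow hg hTe hv hvG, ?_, fun t ht => ?_, fun t ht => ?_⟩,
    hball.inLogWeightedLinfty, hball, fun w hw hwb t ht => ?_⟩
  · rw [perturbedFlow_zero]
  · filter_upwards with x
    refine ((hdom v hv).integrableOn_prod ht x).congr_fun ?_
      (measurableSet_Ioo.prod MeasurableSet.univ)
    rintro ⟨s, y⟩ ⟨hs, -⟩
    simp only [hsrc s hs.1]
  · filter_upwards with x
    have h1 := hfix (t, x) ⟨ht, mem_univ _⟩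
    rw [perturbedFlow_of_pos g v ht.1, ← h1]
    congr 1
    exact duhamelIntegral_congr ht.1.le (fun s hs => hsrc s hs.1) x
  · rcases ht.1.eq_or_lt with h | h
    · subst h
      rw [perturbedFlow_zero]
      exact hw.initial
    · have htT : t ∈ Ioo 0 T := ⟨h, ht.2⟩
      set v' : ℝ × Plane → ℝ := fun q => w q.1 q.2 - heat q.1 g q.2 with hv'
      have hv'b : v' ∈ weightedBall (Ioo 0 T ×ˢ univ) logWeight :=
        ⟨hwb.1.mono (prod_mono_left Ioo_subset_Ico_self), fun q hq => hwb.2 q.1 hq.1 q.2⟩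
      have hsrc' : ∀ s, source χ m g v' s = fun y => nonlin χ m (w s y) := by
        intro s
        ext y
        simp only [source, hv', add_sub_cancel]
      -- Duhamel's formula holds almost everywhere, hence everywhere by continuity.
      have hfix' : ∀ q ∈ (Ioo 0 T ×ˢ univ : Set (ℝ × Plane)),
          duhamelIntegral (source χ m g v') q.1 q.2 = v' q := by
        rintro ⟨s, x⟩ ⟨hs, -⟩
        have hc1 : Continuous fun x => duhamelIntegral (source χ m g v') s x :=
          continuous_slice (hdom v' hv'b).continuousOn_duhamelIntegral hs
        have hc2 : Continuous fun x => v' (s, x) :=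
          continuous_slice (F := fun s x => v' (s, x)) hv'b.1 hs
        have hae : (fun x => duhamelIntegral (source χ m g v') s x) =ᵐ[volume]
            fun x => v' (s, x) := by
          filter_upwards [hw.duhamel s hs] with x hx
          simp only [hv']
          rw [hx, add_sub_cancel_left]
          exact duhamelIntegral_congr hs.1.le (fun s _ => hsrc' s) x
        exact congrFun ((hc1.ae_eq_iff_eq volume hc2).1 hae) x
      refine Eventually.of_forall fun x => ?_
      have h1 := huniq v' hv'b hfix' (t, x) ⟨htT, mem_univ _⟩
      rw [perturbedFlow_of_pos g v h, ← h1, hv']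
      ring

/-! ### Singular profiles are admissible initial data -/

lemma ae_ne_zero_plane : ∀ᵐ y : Plane, y ≠ 0 := Measure.ae_ne volume 0

lemma mul_neg_log_mono {a r : ℝ} (ha : 0 < a) (har : a ≤ r) (hr : r ≤ Real.exp (-1)) :
    a * -Real.log a ≤ r * -Real.log r := by
  have hr0 := ha.trans_le har
  have h1 : Real.log r ≤ -1 := by
    rw [← Real.log_exp (-1)]; exact Real.log_le_log hr0 hr
  have h2 := Real.log_le_sub_one_of_pos (div_pos hr0 ha)
  rw [Real.log_div hr0.ne' ha.ne'] at h2
  have h3 : a * (Real.log r - Real.log a) ≤ r - a := by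
    calc a * (Real.log r - Real.log a) ≤ a * (r / a - 1) := mul_le_mul_of_nonneg_left h2 ha.le
      _ = r - a := by field_simp
  nlinarith [mul_nonneg (sub_nonneg.2 har) (by linarith : 0 ≤ -1 - Real.log r)]

/-- The function `‖y‖⁻¹` truncated to a ball. -/
def truncInvNorm (ρ : ℝ) (y : Plane) : ℝ := (Iio ρ).indicator (fun r => r⁻¹) ‖y‖

lemma truncInvNorm_nonneg (ρ : ℝ) (y : Plane) : 0 ≤ truncInvNorm ρ y :=
  Set.indicator_apply_nonneg fun _ => inv_nonneg.2 (norm_nonneg y)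

lemma pow_smul_indicator_inv (ρ : ℝ) :
    EqOn (fun r : ℝ => r ^ (Module.finrank ℝ Plane - 1) • (Iio ρ).indicator (fun r => r⁻¹) r)
      ((Iio ρ).indicator fun _ => (1 : ℝ)) (Ioi 0) := by
  intro r (hr : 0 < r)
  by_cases h : r < ρ
  · simp [h, hr.ne']
  · simp [h]

lemma integrable_truncInvNorm (ρ : ℝ) : Integrable (truncInvNorm ρ) := by
  unfold truncInvNorm
  rw [integrable_fun_norm_addHaar (volume : Measure Plane),
    integrableOn_congr_fun (pow_smul_indicator_inv ρ) measurableSet_Ioi, IntegrableOn,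
    integrable_indicator_iff measurableSet_Iio, IntegrableOn,
    Measure.restrict_restrict measurableSet_Iio]
  refine integrable_const_iff.2 (Or.inr ⟨?_⟩)
  rw [Measure.restrict_apply_univ, inter_comm, Ioi_inter_Iio]
  exact measure_Ioo_lt_top

lemma exists_integral_truncInvNorm_le :
    ∃ κ, 0 ≤ κ ∧ ∀ ρ, 0 ≤ ρ → ∫ y, truncInvNorm ρ y ≤ κ * ρ := by
  refine ⟨2 * volume.real (Metric.ball (0 : Plane) 1), by positivity, fun ρ hρ => ?_⟩
  unfold truncInvNorm
  rw [integral_fun_norm_addHaar (volume : Measure Plane),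
    setIntegral_congr_fun measurableSet_Ioi (pow_smul_indicator_inv ρ),
    setIntegral_indicator measurableSet_Iio, Ioi_inter_Iio]
  simp [hρ]
  linarith

namespace IsSingularProfile

variable {φ : ℝ → ℝ}

/-- The two bounds of a singular profile with complementary ranges of radii: compactness covers the
radii in between. -/
lemma exists_bounds (hφ : IsSingularProfile φ) : ∃ K c δ, 0 < K ∧ 0 < c ∧ 0 < δ ∧
    δ ≤ Real.exp (-1) ∧
    (∀ r ∈ Ioo 0 δ, Real.exp (φ r ^ 2 / 2) ≤ K * (r * -Real.log r)⁻¹) ∧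
    ∀ r, δ ≤ r → φ r ≤ K * Real.exp (-(c * r)) := by
  obtain ⟨C₁, δ₁, hC₁, hδ₁, -, h1⟩ := hφ.singular
  obtain ⟨C₂, c, R, hC₂, hc, hR, h2⟩ := hφ.decay
  set δ := min δ₁ (Real.exp (-1)) with hδ
  have hδ0 : 0 < δ := lt_min hδ₁ (Real.exp_pos _)
  obtain ⟨M, hM⟩ := (isCompact_Icc (a := δ) (b := R)).bddAbove_image
    (hφ.continuousOn.mono fun r hr => (hδ0.trans_le hr.1 : 0 < r))
  have hM' : ∀ r ∈ Icc δ R, φ r ≤ |M| := fun r hr =>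
    (hM (mem_image_of_mem φ hr)).trans (le_abs_self M)
  refine ⟨C₁ + C₂ + |M| * Real.exp (c * R), c, δ, by positivity, hc, hδ0, min_le_right _ _,
    fun r hr => ?_, fun r hr => ?_⟩
  · have hrδ : r ∈ Ioo 0 δ₁ := ⟨hr.1, hr.2.trans_le (min_le_left _ _)⟩
    have hlog : Real.log r < 0 := Real.log_neg hr.1
      ((hr.2.trans_le (min_le_right _ _)).trans (Real.exp_lt_one_iff.2 (by norm_num)))
    refine (h1 r hrδ).trans (mul_le_mul_of_nonneg_right ?_ ?_)
    · have : 0 ≤ |M| * Real.exp (c * R) := by positivity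
      linarith
    · exact inv_nonneg.2 (mul_nonneg hr.1.le (by linarith))
  · rcases le_total R r with h | h
    · refine (h2 r h).trans (mul_le_mul_of_nonneg_right ?_ (Real.exp_pos _).le)
      have : 0 ≤ |M| * Real.exp (c * R) := by positivity
      linarith
    · calc φ r ≤ |M| * 1 := by rw [mul_one]; exact hM' r ⟨hr, h⟩
        _ ≤ |M| * (Real.exp (c * R) * Real.exp (-(c * r))) := by
            refine mul_le_mul_of_nonneg_left ?_ (abs_nonneg _)
            rw [← Real.exp_add]
            exact Real.one_le_exp (by nlinarith)
        _ = |M| * Real.exp (c * R) * Real.exp (-(c * r)) := by ring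
        _ ≤ _ := mul_le_mul_of_nonneg_right (by linarith) (Real.exp_pos _).le

lemma continuousAt_radial (hφ : IsSingularProfile φ) {y : Plane} (hy : y ≠ 0) :
    ContinuousAt (radial φ) y :=
  ContinuousAt.comp (f := fun y : Plane => ‖y‖) (g := φ)
    (hφ.continuousOn.continuousAt (Ioi_mem_nhds (norm_pos_iff.2 hy))) continuous_norm.continuousAt

lemma aestronglyMeasurable_radial (hφ : IsSingularProfile φ) :
    AEStronglyMeasurable (radial φ) := by
  have h : ContinuousOn (radial φ) {0}ᶜ := fun y hy =>
    (hφ.continuousAt_radial hy).continuousWithinAt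
  have h1 := h.aestronglyMeasurable (μ := volume) (measurableSet_singleton _).compl
  rwa [restrict_compl_singleton] at h1

lemma mul_exp_half_sq_le {a E : ℝ} (ha : 0 ≤ a) (hE : Real.exp (a ^ 2 / 2) ≤ E) :
    a * Real.exp (a ^ 2 / 2) ≤ 2 * E ^ (3 / 2 : ℝ) := by
  have hE0 : 0 < E := (Real.exp_pos _).trans_le hE
  have h1 : a ≤ 2 * Real.sqrt E := by
    have h2 := Real.add_one_le_exp (a ^ 2 / 2)
    have h3 : a ^ 2 ≤ (2 * Real.sqrt E) ^ 2 := by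
      rw [mul_pow, Real.sq_sqrt hE0.le]; linarith
    exact (sq_le_sq₀ ha (by positivity)).1 h3
  calc a * Real.exp (a ^ 2 / 2) ≤ 2 * Real.sqrt E * E :=
        mul_le_mul h1 hE (Real.exp_pos _).le (by positivity)
    _ = 2 * E ^ (3 / 2 : ℝ) := by
        rw [Real.sqrt_eq_rpow, mul_assoc, ← Real.rpow_add_one hE0.ne']; norm_num

lemma integrable_mul_exp_radial (hφ : IsSingularProfile φ) :
    Integrable fun y => radial φ y * Real.exp (radial φ y ^ 2 / 2) := by
  obtain ⟨K, c, δ, hK, hc, hδ, hδe, hin, hout⟩ := hφ.exists_bounds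
  have hint : IntegrableOn (fun r : ℝ => r ^ (Module.finrank ℝ Plane - 1) •
      (φ r * Real.exp (φ r ^ 2 / 2))) (Ioi 0) := by
    have hcont : ContinuousOn (fun r : ℝ => r ^ (Module.finrank ℝ Plane - 1) •
        (φ r * Real.exp (φ r ^ 2 / 2))) (Ioi 0) :=
      (by fun_prop : ContinuousOn (fun r : ℝ => r ^ (Module.finrank ℝ Plane - 1)) (Ioi 0)).smul
        (hφ.continuousOn.mul (Real.continuous_exp.comp_continuousOn
          ((hφ.continuousOn.pow 2).div_const 2)))
    have hm := hcont.aestronglyMeasurable (μ := volume) measurableSet_Ioi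
    have h1 : ∀ r, 0 < r → 0 ≤ φ r * Real.exp (φ r ^ 2 / 2) := fun r hr =>
      mul_nonneg (hφ.pos r hr).le (Real.exp_pos _).le
    rw [← Ioo_union_Ici_eq_Ioi hδ] at hm ⊢
    refine IntegrableOn.union ?_ ?_
    · refine Integrable.mono' ((integrableOn_rpow_neg_half δ hδ.le).const_mul
        (2 * K ^ (3 / 2 : ℝ))) (hm.mono_set subset_union_left) ?_
      refine (ae_restrict_iff' measurableSet_Ioo).2 (Eventually.of_forall fun r hr => ?_)
      have hr0 : 0 < r := hr.1
      have hlog : 1 ≤ -Real.log r := by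
        have : Real.log r ≤ -1 := by
          rw [← Real.log_exp (-1)]; exact Real.log_le_log hr0 (hr.2.le.trans hδe)
        linarith
      have hE : Real.exp (φ r ^ 2 / 2) ≤ K * r⁻¹ := by
        refine (hin r hr).trans (mul_le_mul_of_nonneg_left ?_ hK.le)
        exact inv_anti₀ hr0 (le_mul_of_one_le_right hr0.le hlog)
      simp only [finrank_euclideanSpace, Fintype.card_fin, Nat.add_one_sub_one, pow_one,
        smul_eq_mul]
      rw [Real.norm_of_nonneg (mul_nonneg hr0.le (h1 r hr0))]
      calc r * (φ r * Real.exp (φ r ^ 2 / 2)) ≤ r * (2 * (K * r⁻¹) ^ (3 / 2 : ℝ)) :=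
            mul_le_mul_of_nonneg_left (mul_exp_half_sq_le (hφ.pos r hr0).le hE) hr0.le
        _ = 2 * K ^ (3 / 2 : ℝ) * (r ^ (1 : ℝ) * r ^ (-(3 / 2) : ℝ)) := by
            rw [Real.mul_rpow hK.le (inv_nonneg.2 hr0.le), Real.inv_rpow hr0.le,
              Real.rpow_neg hr0.le, Real.rpow_one]
            ring
        _ = _ := by rw [← Real.rpow_add hr0]; norm_num
    · have hexp : IntegrableOn (fun r : ℝ => Real.exp (-(c / 2) * r)) (Ici δ) := by
        rw [integrableOn_Ici_iff_integrableOn_Ioi]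
        exact exp_neg_integrableOn_Ioi δ (by positivity)
      refine Integrable.mono' (hexp.const_mul (2 / c * K * Real.exp (K ^ 2 / 2)))
        (hm.mono_set subset_union_right) ?_
      refine (ae_restrict_iff' measurableSet_Ici).2 (Eventually.of_forall fun r hr => ?_)
      have hr0 : 0 < r := hδ.trans_le hr
      have hφr := hout r hr
      have hφK : φ r ≤ K := hφr.trans
        (mul_le_of_le_one_right hK.le (Real.exp_le_one_iff.2 (by nlinarith)))
      have h2 : Real.exp (φ r ^ 2 / 2) ≤ Real.exp (K ^ 2 / 2) :=
        Real.exp_le_exp.2 (by nlinarith [hφ.pos r hr0])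
      have h3 : r ≤ 2 / c * Real.exp (c / 2 * r) := by
        have := Real.add_one_le_exp (c / 2 * r)
        calc r = 2 / c * (c / 2 * r) := by field_simp
          _ ≤ _ := mul_le_mul_of_nonneg_left (by linarith) (by positivity)
      simp only [finrank_euclideanSpace, Fintype.card_fin, Nat.add_one_sub_one, pow_one,
        smul_eq_mul]
      rw [Real.norm_of_nonneg (mul_nonneg hr0.le (h1 r hr0))]
      calc r * (φ r * Real.exp (φ r ^ 2 / 2))
          ≤ 2 / c * Real.exp (c / 2 * r) * (K * Real.exp (-(c * r)) * Real.exp (K ^ 2 / 2)) := by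
            refine mul_le_mul h3 (mul_le_mul hφr h2 (Real.exp_pos _).le (by positivity))
              (h1 r hr0) (by positivity)
        _ = 2 / c * K * Real.exp (K ^ 2 / 2) *
              (Real.exp (c / 2 * r) * Real.exp (-(c * r))) := by ring
        _ = _ := by rw [← Real.exp_add]; ring_nf
  exact (integrable_fun_norm_addHaar (volume : Measure Plane)
    (f := fun r => φ r * Real.exp (φ r ^ 2 / 2))).2 hint

/-- For `‖y‖ < √t` the kernel is bounded by `(4πt)⁻¹` and `‖y‖⁻¹` is integrated, while
`|log ‖y‖| ≥ |log t| / 2`; for `‖y‖ ≥ √t` the singular bound is at most its value at `√t`. -/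
lemma exists_heat_exp_le (hφ : IsSingularProfile φ) :
    ∃ A, 1 ≤ A ∧ ∀ t ∈ Ioo 0 (Real.exp (-1)), ∀ x,
      heat t (fun y => Real.exp (radial φ y ^ 2 / 2)) x ≤ A * (Real.sqrt t * |Real.log t|)⁻¹ := by
  obtain ⟨K, c, δ, hK, hc, hδ, hδe, hin, hout⟩ := hφ.exists_bounds
  obtain ⟨κ, hκ, hball⟩ := exists_integral_truncInvNorm_le
  set M := Real.exp (K ^ 2 / 2) with hM
  have hM0 : 0 < M := Real.exp_pos _
  refine ⟨2 * K * κ + 2 * K + 2 * M + 1, ?_, fun t ht x => ?_⟩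
  · have : 0 ≤ 2 * K * κ := by positivity
    linarith
  have ht0 : 0 < t := ht.1
  have hlog : Real.log t < -1 := by
    rw [← Real.log_exp (-1)]; exact Real.log_lt_log ht.1 ht.2
  rw [abs_of_neg (by linarith)]
  set σ := Real.sqrt t with hσ
  set l := -Real.log t with hl
  have hl1 : 1 < l := by linarith
  have hσ0 : 0 < σ := Real.sqrt_pos.2 ht0
  have hσsq : σ ^ 2 = t := Real.sq_sqrt ht0.le
  have hlogσ : -Real.log σ = l / 2 := by rw [hσ, Real.log_sqrt ht0.le, hl]; ring
  have hσl : σ * l ≤ 2 := by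
    have h1 := Real.log_le_sub_one_of_pos (inv_pos.2 hσ0)
    rw [Real.log_inv, hlogσ] at h1
    calc σ * l ≤ σ * (2 * σ⁻¹) := mul_le_mul_of_nonneg_left (by linarith) hσ0.le
      _ = 2 := by field_simp
  have hadm := (((HeatAdmissible.of_integrable (integrable_truncInvNorm σ)).const_mul
    (2 * K * l⁻¹)).add (HeatAdmissible.const (2 * K * (σ * l)⁻¹ + M)))
  have hpt : ∀ᵐ y : Plane, |Real.exp (radial φ y ^ 2 / 2)| ≤
      2 * K * l⁻¹ * truncInvNorm σ y + (2 * K * (σ * l)⁻¹ + M) := by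
    filter_upwards [ae_ne_zero_plane] with y hy
    have hr0 : 0 < ‖y‖ := norm_pos_iff.2 hy
    have h0 : 0 ≤ 2 * K * l⁻¹ * truncInvNorm σ y :=
      mul_nonneg (by positivity) (truncInvNorm_nonneg _ _)
    have h0' : 0 ≤ 2 * K * (σ * l)⁻¹ := by positivity
    rw [abs_of_pos (Real.exp_pos _)]
    unfold radial
    rcases lt_or_ge ‖y‖ δ with hrδ | hrδ
    · have h1 := hin ‖y‖ ⟨hr0, hrδ⟩
      rcases lt_or_ge ‖y‖ σ with hrσ | hrσ
      · have h2 : l / 2 ≤ -Real.log ‖y‖ := by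
          rw [← hlogσ]; exact neg_le_neg (Real.log_le_log hr0 hrσ.le)
        have h3 : (‖y‖ * -Real.log ‖y‖)⁻¹ ≤ (‖y‖ * (l / 2))⁻¹ :=
          inv_anti₀ (by positivity) (mul_le_mul_of_nonneg_left h2 hr0.le)
        have h4 : K * (‖y‖ * (l / 2))⁻¹ = 2 * K * l⁻¹ * truncInvNorm σ y := by
          rw [truncInvNorm, indicator_of_mem (mem_Iio.2 hrσ)]
          field_simp
        have h5 := mul_le_mul_of_nonneg_left h3 hK.le
        linarith
      · have h2 := mul_neg_log_mono hσ0 hrσ (hrδ.le.trans hδe)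
        rw [hlogσ] at h2
        have h3 : (‖y‖ * -Real.log ‖y‖)⁻¹ ≤ (σ * (l / 2))⁻¹ := inv_anti₀ (by positivity) h2
        have h4 : K * (σ * (l / 2))⁻¹ = 2 * K * (σ * l)⁻¹ := by field_simp
        have h5 := mul_le_mul_of_nonneg_left h3 hK.le
        linarith
    · have hφK : φ ‖y‖ ≤ K := (hout _ hrδ).trans
        (mul_le_of_le_one_right hK.le (Real.exp_le_one_iff.2 (by nlinarith)))
      have h2 : Real.exp (φ ‖y‖ ^ 2 / 2) ≤ M :=
        Real.exp_le_exp.2 (by nlinarith [hφ.pos _ hr0])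
      linarith
  refine (le_abs_self _).trans ((abs_heat_le ht0 hadm hpt x).trans ?_)
  rw [heat_add ht0 ((HeatAdmissible.of_integrable (integrable_truncInvNorm σ)).const_mul _)
    (HeatAdmissible.const _), heat_const_mul ht0, heat_const ht0]
  have h1 : heat t (truncInvNorm σ) x ≤ κ * σ⁻¹ := by
    refine (heat_le_integral ht0 (integrable_truncInvNorm σ)
      (Eventually.of_forall (truncInvNorm_nonneg σ)) x).trans ?_
    calc (4 * Real.pi * t)⁻¹ * ∫ y, truncInvNorm σ y ≤ t⁻¹ * (κ * σ) := by
          refine mul_le_mul (inv_anti₀ ht0 ?_) (hball σ hσ0.le)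
            (integral_nonneg (truncInvNorm_nonneg σ)) (inv_nonneg.2 ht0.le)
          nlinarith [Real.pi_gt_three]
      _ = κ * σ⁻¹ := by rw [← hσsq]; field_simp
  have h2 : 1 ≤ 2 * (σ * l)⁻¹ := by
    rw [← div_eq_mul_inv, le_div_iff₀ (by positivity)]; linarith
  calc 2 * K * l⁻¹ * heat t (truncInvNorm σ) x + (2 * K * (σ * l)⁻¹ + M)
      ≤ 2 * K * l⁻¹ * (κ * σ⁻¹) + (2 * K * (σ * l)⁻¹ + M * (2 * (σ * l)⁻¹)) := by
        refine add_le_add (mul_le_mul_of_nonneg_left h1 (by positivity)) ?_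
        have := mul_le_mul_of_nonneg_left h2 hM0.le
        linarith
    _ = (2 * K * κ + 2 * K + 2 * M) * (σ * l)⁻¹ := by
        rw [mul_inv]; ring
    _ ≤ _ := mul_le_mul_of_nonneg_right (by linarith) (by positivity)

lemma isSingularDatum (hφ : IsSingularProfile φ) : IsSingularDatum (radial φ) where
  aesm := hφ.aestronglyMeasurable_radial
  nonneg := by
    filter_upwards [ae_ne_zero_plane] with y hy using (hφ.pos _ (norm_pos_iff.2 hy)).le
  continuousAt := by
    filter_upwards [ae_ne_zero_plane] with y hy using hφ.continuousAt_radial hy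
  integrable := hφ.integrable_mul_exp_radial
  heat_exp_le := hφ.exists_heat_exp_le

end IsSingularProfile

end HeatExp

end

theorem theorem3p1 (χ : ℝ → ℝ) (hχ : HeatExp.IsCutoff χ) :
    (∃ (m : ℝ) (φ : ℝ → ℝ), HeatExp.IsSingularSoliton χ m φ) ∧
    ∀ (m : ℝ) (φ : ℝ → ℝ), HeatExp.IsSingularSoliton χ m φ →
      (∀ t : ℝ, 0 < t →
        (∀ x : HeatExp.Plane,
          Integrable (fun y => HeatExp.heatKernel t (x - y) * HeatExp.radial φ y) volume) ∧
        ∃ C : ℝ, ∀ x : HeatExp.Plane, |HeatExp.heat t (HeatExp.radial φ) x| ≤ C) ∧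
      ∃ T : ℝ, 0 < T ∧ T < 1 ∧
        ∃ u : ℝ → HeatExp.Plane → ℝ,
          HeatExp.IsStrongSolution (HeatExp.nonlin χ m) T (HeatExp.radial φ) u ∧
          HeatExp.InLogWeightedLinfty T (fun t x => u t x - HeatExp.heat t (HeatExp.radial φ) x) ∧
          HeatExp.InLogWeightedBall T (fun t x => u t x - HeatExp.heat t (HeatExp.radial φ) x) ∧
          ∀ w : ℝ → HeatExp.Plane → ℝ,
            HeatExp.IsStrongSolution (HeatExp.nonlin χ m) T (HeatExp.radial φ) w →
            HeatExp.InLogWeightedBall T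
              (fun t x => w t x - HeatExp.heat t (HeatExp.radial φ) x) →
            ∀ t ∈ Ico 0 T, w t =ᵐ[volume] u t := by
  refine ⟨?_, fun m φ h => ?_⟩
  · obtain ⟨ρ, u, hu⟩ := HeatExp.exists_isSingularDiskSolution hχ
    exact HeatExp.exists_isSingularSoliton hχ hu
  · obtain ⟨hm, hφ⟩ := h.mass_nonneg_and_profile hχ
    have hg := hφ.isSingularDatum
    refine ⟨fun t ht => ⟨hg.admissible.integrable t ht,
      (4 * Real.pi * t)⁻¹ * ∫ y, HeatExp.radial φ y, fun x => ?_⟩,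
      hg.exists_unique_isStrongSolution hχ hm⟩
    rw [abs_of_nonneg (HeatExp.heat_nonneg ht hg.nonneg x)]
    exact HeatExp.heat_le_integral ht hg.integrable_self hg.nonneg x
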